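/- Let $(\mathcal Y,\mathcal A)$ be a measurable space, $\mathcal P$ the set of all probability measures on it, and $\mathcal W\subset\mathcal P$ a non-empty set. For a probability mass function $p$ with finite support in $\mathcal W$ and $\alpha\in(0,\infty]$, let $\nu$ be a $\sigma$-finite measure with $W\ll\nu$ for all $W$ with $p(W)>0$, and let $\mu_{\alpha,p}$ be the measure with $\nu$-density $\big(\sum_W p(W)(\tfrac{dW}{d\nu})^{\alpha}\big)^{1/\alpha}$ if $\alpha<\infty$ and $\max_{p(W)>0}\tfrac{dW}{d\nu}$ if $\alpha=\infty$ (it does not depend on $\nu$). The order $\alpha$ Rényi information is $$I_\alpha(p)=\begin{cases}\tfrac{\alpha}{\alpha-1}\ln\mu_{\alpha,p}(\mathcal Y)&\alpha\in(0,1)\cup(1,\infty),\\ \int\sum_{W} p(W|y)\ln\tfrac{p(W|y)}{p(W)}\,\mu_{1,p}(dy)&\alpha=1,\\ \ln\mu_{\infty,p}(\mathcal Y)&\alpha=\infty,\end{cases}$$ where $p(W|y)=p(W)\tfrac{dW}{d\mu_{1,p}}(y)$. The order $\alpha$ Rényi capacity of $\mathcal W$ is $C_\alpha(\mathcal W)=\sup_p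 I_\alpha(p)\in[0,\infty]$, the supremum being over all probability mass functions $p$ with finite support in $\mathcal W$. For $W,Q\in\mathcal P$ and any $\nu$ with $W,Q\ll\nu$, with densities $w=\tfrac{dW}{d\nu}$ and $q=\tfrac{dQ}{d\nu}$, the order $\alpha$ Rényi divergence is $$D_\alpha(W\|Q)=\begin{cases}\tfrac1{\alpha-1}\ln\int w^\alpha q^{1-\alpha}\,d\nu&\alpha\in(0,1)\cup(1,\infty),\\ \int w\ln\tfrac{w}{q}\,d\nu&\alpha=1,\\ \ln\operatorname{ess\,sup}_\nu \tfrac wq&\alpha=\infty,\end{cases}$$ with the conventions $0\cdot\infty=\tfrac00=0\ln\tfrac{0}{x}=0$ for $x\ge0$, and $\tfrac x0=\infty$ for $x>0$, $\ln0=-\infty$, $\ln\infty=\infty$. Suppose that $\vartheta\in(0,\infty]$ and $C_\vartheta(\mathcal W)<\infty$. Then for every $\alpha\in(0,\vartheta]$ there is a unique $q_{\alpha,\mathcal W}\in\mathcal P$, called the order $\alpha$ Rényi center of $\mathcal W$, such that $C_\alpha(\mathcal W)=\sup_{W\in\mathcal W}D_\alpha(W\|q_{\alpha,\mathcal W})$;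 it satisfies $$C_\beta(\mathcal W)-C_\alpha(\mathcal W)\ \ge\ D_\alpha(q_{\alpha,\mathcal W}\|q_{\beta,\mathcal W})\qquad\text{for all }\alpha,\beta\text{ with }0<\alpha<\beta\le\vartheta;$$ and the map $\alpha\mapsto q_{\alpha,\mathcal W}$ is continuous on $(0,\vartheta]$ (as a subspace of $(0,\infty]$ with its usual topology) for the topology on $\mathcal P$ given by the total variation metric $\|P-Q\|=\sup_{E\in\mathcal A}\big[(P-Q)(E)-(P-Q)(\mathcal Y\setminus E)\big]$. -/

import Mathlib

open MeasureTheory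
open scoped ENNReal

noncomputable section

/-- The total variation norm `sup_E (s E - s Eᶜ)` of a finite signed measure, the supremum being
over all measurable sets. -/
def tvNorm {Ω : Type*} [MeasurableSpace Ω] (s : SignedMeasure Ω) : ℝ :=
  ⨆ E : {E : Set Ω // MeasurableSet E}, (s E.1 - s E.1ᶜ)

/-- The total variation distance `‖P - Q‖` between probability measures. -/
def tvDist {Ω : Type*} [MeasurableSpace Ω] (P Q : ProbabilityMeasure Ω) : ℝ :=
  tvNorm ((P : Measure Ω).toSignedMeasure - (Q : Measure Ω).toSignedMeasure)

theorem tvDist_eq {Ω : Type*} [MeasurableSpace Ω] (P Q : ProbabilityMeasure Ω) :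
    tvDist P Q = ⨆ E : {E : Set Ω // MeasurableSet E},
      2 * ((P : Measure Ω).real E.1 - (Q : Measure Ω).real E.1) := by
  unfold tvDist tvNorm
  congr 1
  funext E
  rw [_root_.sub_apply, _root_.sub_apply,
    Measure.toSignedMeasure_apply_measurable E.2, Measure.toSignedMeasure_apply_measurable E.2,
    Measure.toSignedMeasure_apply_measurable E.2.compl,
    Measure.toSignedMeasure_apply_measurable E.2.compl,
    probReal_compl_eq_one_sub E.2, probReal_compl_eq_one_sub E.2]
  ring

theorem tvDist_bddAbove {Ω : Type*} [MeasurableSpace Ω] (P Q : ProbabilityMeasure Ω) :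
    BddAbove (Set.range fun E : {E : Set Ω // MeasurableSet E} =>
      2 * ((P : Measure Ω).real E.1 - (Q : Measure Ω).real E.1)) := by
  refine ⟨2, ?_⟩
  rintro _ ⟨E, rfl⟩
  have h1 : (P : Measure Ω).real E.1 ≤ 1 := measureReal_le_one
  have h2 : 0 ≤ (Q : Measure Ω).real E.1 := measureReal_nonneg
  simp only
  linarith

theorem le_tvDist {Ω : Type*} [MeasurableSpace Ω] (P Q : ProbabilityMeasure Ω) {E : Set Ω}
    (hE : MeasurableSet E) :
    2 * ((P : Measure Ω).real E - (Q : Measure Ω).real E) ≤ tvDist P Q := by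
  rw [tvDist_eq]
  exact le_ciSup (tvDist_bddAbove P Q) ⟨E, hE⟩

theorem tvDist_le {Ω : Type*} [MeasurableSpace Ω] {P Q : ProbabilityMeasure Ω} {c : ℝ}
    (h : ∀ E : Set Ω, MeasurableSet E →
      2 * ((P : Measure Ω).real E - (Q : Measure Ω).real E) ≤ c) :
    tvDist P Q ≤ c := by
  rw [tvDist_eq]
  have : Nonempty {E : Set Ω // MeasurableSet E} := ⟨⟨∅, MeasurableSet.empty⟩⟩
  exact ciSup_le fun E => h E.1 E.2

theorem tvDist_self {Ω : Type*} [MeasurableSpace Ω] (P : ProbabilityMeasure Ω) :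
    tvDist P P = 0 := by
  rw [tvDist_eq]
  simp

theorem tvDist_le_comm {Ω : Type*} [MeasurableSpace Ω] (P Q : ProbabilityMeasure Ω) :
    tvDist P Q ≤ tvDist Q P := by
  refine tvDist_le fun E hE => ?_
  have h := le_tvDist Q P hE.compl
  rw [probReal_compl_eq_one_sub hE, probReal_compl_eq_one_sub hE] at h
  linarith

/-- The total variation metric on the set of probability measures on a measurable space. -/
@[reducible]
def tvMetricSpace (Ω : Type*) [MeasurableSpace Ω] : MetricSpace (ProbabilityMeasure Ω) where
  dist := tvDist
  dist_self := tvDist_self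
  dist_comm P Q := le_antisymm (tvDist_le_comm P Q) (tvDist_le_comm Q P)
  dist_triangle P Q R := by
    refine tvDist_le fun E hE => ?_
    have h1 := le_tvDist P Q hE
    have h2 := le_tvDist Q R hE
    linarith
  eq_of_dist_eq_zero := by
    intro P Q h
    change tvDist P Q = 0 at h
    have h' : tvDist Q P ≤ 0 := h ▸ tvDist_le_comm Q P
    refine Subtype.ext (show (P : Measure Ω) = (Q : Measure Ω) from ?_)
    ext E hE
    have h1 := le_tvDist P Q hE
    have h2 := le_tvDist Q P hE
    have h3 : (P : Measure Ω).real E = (Q : Measure Ω).real E := by linarith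
    exact (measureReal_eq_measureReal_iff ..).1 h3

/-- The total variation topology on the set of probability measures. -/
@[reducible]
def tvTopology (Ω : Type*) [MeasurableSpace Ω] : TopologicalSpace (ProbabilityMeasure Ω) :=
  (tvMetricSpace Ω).toUniformSpace.toTopologicalSpace

/-- The Rényi divergence `D_α(W‖Q)` of order `α ∈ [0, ∞]` between probability measures. The
densities are taken with respect to the reference measure `W + Q`; any other reference measure
gives the same value. Order one is the Kullback-Leibler divergence. The conventions `0 ^ (-s) = ∞`
for `s > 0`, `0 * ∞ = 0`, `x / 0 = ∞` for `x > 0`, `log 0 = -∞` and `log ∞ = ∞` are those of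
`ℝ≥0∞` and of `ENNReal.log`. -/
def renyiDiv {Ω : Type*} [MeasurableSpace Ω] (α : ℝ≥0∞) (W Q : ProbabilityMeasure Ω) : EReal :=
  let ν : Measure Ω := (W : Measure Ω) + (Q : Measure Ω)
  let w : Ω → ℝ≥0∞ := (W : Measure Ω).rnDeriv ν
  let q : Ω → ℝ≥0∞ := (Q : Measure Ω).rnDeriv ν
  if α = 0 then -ENNReal.log ((Q : Measure Ω) {y | 0 < w y})
  else if α = 1 then (InformationTheory.klDiv (W : Measure Ω) (Q : Measure Ω) : EReal)
  else if α = ∞ then ENNReal.log (essSup (fun y => w y / q y) ν)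
  else ((1 / (α.toReal - 1) : ℝ) : EReal) *
    ENNReal.log (∫⁻ y, w y ^ α.toReal * q y ^ (1 - α.toReal) ∂ν)

/-- The mixture `∑ P(W) W` of the probability measures `W` with the weights of a prior `P`. It is
the mean measure of order one, and it dominates every `W` with `P(W) > 0`. -/
def mixture {Ω : Type*} [MeasurableSpace Ω] (P : PMF (ProbabilityMeasure Ω)) : Measure Ω :=
  Measure.sum fun W : ProbabilityMeasure Ω => P W • (W : Measure Ω)

/-- The density of the mean measure of order `α ∈ [0, ∞]` for the prior `P`, with respect to the
reference measure `mixture P`: the `P`-weighted power mean of order `α` of the densities. -/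
def meanDensity {Ω : Type*} [MeasurableSpace Ω] (α : ℝ≥0∞) (P : PMF (ProbabilityMeasure Ω))
    (y : Ω) : ℝ≥0∞ :=
  if α = 0 then
    ∏ᶠ W ∈ P.support, ((W : Measure Ω).rnDeriv (mixture P) y) ^ (P W).toReal
  else if α = ∞ then ⨆ W ∈ P.support, (W : Measure Ω).rnDeriv (mixture P) y
  else (∑' W : ProbabilityMeasure Ω,
    P W * ((W : Measure Ω).rnDeriv (mixture P) y) ^ α.toReal) ^ (1 / α.toReal)

/-- The mean measure of order `α` for the prior `P`. -/
def meanMeasure {Ω : Type*} [MeasurableSpace Ω] (α : ℝ≥0∞) (P : PMF (ProbabilityMeasure Ω)) :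
    Measure Ω :=
  (mixture P).withDensity (meanDensity α P)

/-- The order one posterior `P(W | y)`. -/
def posterior {Ω : Type*} [MeasurableSpace Ω] (P : PMF (ProbabilityMeasure Ω))
    (W : ProbabilityMeasure Ω) (y : Ω) : ℝ≥0∞ :=
  P W * (W : Measure Ω).rnDeriv (mixture P) y

open Classical in
/-- The Rényi information of order `α ∈ [0, ∞]` for the prior `P`, a probability mass function
with finite support on the set of probability measures. For order one the integrand is a finite
sum of functions that are bounded almost everywhere, so the integral exists. -/
def renyiInformation {Ω : Type*} [MeasurableSpace Ω] (α : ℝ≥0∞)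
    (P : PMF (ProbabilityMeasure Ω)) : EReal :=
  if α = 0 then
    essInf (fun y => ENNReal.log
      ((∑' W : ProbabilityMeasure Ω, if 0 < posterior P W y then P W else 0)⁻¹)) (mixture P)
  else if α = 1 then
    ((∫ y, ∑' W : ProbabilityMeasure Ω, (posterior P W y).toReal *
      Real.log ((posterior P W y).toReal / (P W).toReal) ∂(mixture P) : ℝ) : EReal)
  else if α = ∞ then ENNReal.log (meanMeasure ∞ P Set.univ)
  else ((α.toReal / (α.toReal - 1) : ℝ) : EReal) * ENNReal.log (meanMeasure α P Set.univ)

/-- The Rényi capacity `C_α(𝒲)`: the supremum of the Rényi information over all priors with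
finite support in `𝒲`. -/
def renyiCapacity {Ω : Type*} [MeasurableSpace Ω] (α : ℝ≥0∞)
    (𝒲 : Set (ProbabilityMeasure Ω)) : EReal :=
  ⨆ P ∈ {P : PMF (ProbabilityMeasure Ω) | P.support.Finite ∧ P.support ⊆ 𝒲},
    renyiInformation α P

/-- `q` is a Rényi center of order `α` of `𝒲`: the order `α` radius of `𝒲` relative to `q` is the
Rényi capacity of `𝒲`. -/
def IsRenyiCenter {Ω : Type*} [MeasurableSpace Ω] (α : ℝ≥0∞) (𝒲 : Set (ProbabilityMeasure Ω))
    (q : ProbabilityMeasure Ω) : Prop :=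
  renyiCapacity α 𝒲 = ⨆ W ∈ 𝒲, renyiDiv α W q

end

noncomputable section

open Filter Topology

variable {Ω : Type*} [MeasurableSpace Ω]

/-! Write S_a(W,Q) = ∫ w^a q^(1-a) (`powerAffinity`). For α ≠ 1, ∞ the inequality D_α(W‖Q) ≤ c
compares S_α(W,Q) with exp((α-1)c), and log-convexity of S_a in a (`powerAffinity_le_mul`) controls
how D_α varies with the order.

The engine is Sibson's identity (`exists_sum_powerAffinity_eq`): the average of S_α(W,Q) over a
prior P factors as a constant encoding I_α(P) times S_α(q_P,Q), with q_P the normalised mean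
measure. Two nearly optimal priors have nearby q_P, because both are close, by a Pinsker inequality,
to the center of their even mixture. Total variation is complete, so the q_P of a maximising
sequence converge to some q. Mixing a little of the point mass at W into these priors shows D_α(W‖q)
≤ C_α (`exists_minimax`). Passing to the limit in Sibson's identity gives the strong property of
`IsStrongCenter`: if all D_α(W‖Q) ≤ c', then D_α(q‖Q) ≤ c' - C_α. Taking c' = C_α gives uniqueness;
taking Q = q_β gives the bound by the capacity difference.

Orders one and infinity are reached from below. Since D_α(q_α‖q_β) ≤ C_β - C_α and the capacities
are monotone and bounded, the centers are Cauchy as the order increases to γ; lower semicontinuity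
of D_α and left continuity in the order make the limit a strong center of order γ
(`exists_isStrongCenter_tendsto`). By uniqueness this is also left continuity of the center map.

Right continuity of the centers follows in the same way from right continuity of the capacity
(`exists_renyiCapacity_le_add`). Below order one the center q_γ itself serves as reference measure.
From order one on, q_γ is mixed with a little of the center of a larger order, which bounds the
divergences at larger orders uniformly in W and permits interpolation; order one needs a separate
second-order estimate of S_(1+t) + S_(1-t). -/

theorem ENNReal.mul_rpow_of_ne_zero_of_ne_top {u : ℝ≥0∞} (h0 : u ≠ 0) (ht : u ≠ ∞) (x : ℝ≥0∞)
    (s : ℝ) : (u * x) ^ s = u ^ s * x ^ s := by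
  rw [ENNReal.mul_rpow_eq_ite, if_neg]
  rintro ⟨h, -⟩
  tauto

theorem ENNReal.zero_rpow_mul_zero_rpow_one_sub {a : ℝ} (ha : 0 ≤ a) :
    (0 : ℝ≥0∞) ^ a * 0 ^ (1 - a) = 0 := by
  rcases ha.eq_or_lt with rfl | ha
  · simp
  · simp [ENNReal.zero_rpow_of_pos ha]

theorem ENNReal.log_le_coe_iff (x : ℝ≥0∞) (c : ℝ) :
    ENNReal.log x ≤ (c : EReal) ↔ x ≤ ENNReal.ofReal (Real.exp c) := by
  rw [← EReal.exp_coe, ← ENNReal.log_le_log_iff, EReal.log_exp]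

theorem ENNReal.ofReal_exp_rpow (c s : ℝ) :
    ENNReal.ofReal (Real.exp c) ^ s = ENNReal.ofReal (Real.exp (c * s)) := by
  rw [ENNReal.ofReal_rpow_of_pos (Real.exp_pos c), Real.exp_mul]

/-- Divergences and informations are mostly handled through real upper bounds `c`. This equivalence
and its negative counterpart turn such bounds into inequalities in `ℝ≥0∞`, avoiding logarithms of
integrals in `EReal`. -/
theorem ENNReal.inv_mul_log_le_iff_of_pos {s : ℝ} (hs : 0 < s) (x : ℝ≥0∞) (c : ℝ) :
    ((1 / s : ℝ) : EReal) * ENNReal.log x ≤ (c : EReal) ↔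
      x ≤ ENNReal.ofReal (Real.exp (s * c)) := by
  rw [← ENNReal.log_rpow, ENNReal.log_le_coe_iff, mul_comm s c, ← ENNReal.ofReal_exp_rpow,
    ENNReal.le_rpow_inv_iff (by positivity : (0 : ℝ) < 1 / s) |>.symm]
  simp

theorem ENNReal.inv_mul_log_le_iff_of_neg {s : ℝ} (hs : s < 0) (x : ℝ≥0∞) (c : ℝ) :
    ((1 / s : ℝ) : EReal) * ENNReal.log x ≤ (c : EReal) ↔
      ENNReal.ofReal (Real.exp (s * c)) ≤ x := by
  have h1 : (1 / s : ℝ) = -(1 / (-s)) := by rw [div_neg, neg_neg]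
  have hs' : 0 < 1 / (-s) := one_div_pos.2 (neg_pos.2 hs)
  rw [← ENNReal.log_rpow, ENNReal.log_le_coe_iff, h1, ENNReal.rpow_neg, ENNReal.inv_le_iff_inv_le,
    ← ENNReal.ofReal_inv_of_pos (Real.exp_pos c), ← Real.exp_neg,
    ← ENNReal.rpow_inv_le_iff hs', ENNReal.ofReal_exp_rpow]
  simp only [one_div, inv_inv]
  rw [show -c * -s = s * c by ring]

/-! ### The power affinity and its log-convexity. -/

/-- The power affinity `∫ w ^ a q ^ (1 - a)` of two measures with densities `w` and `q`. -/
def powerAffinity (a : ℝ) (μ ρ : Measure Ω) : ℝ≥0∞ :=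
  ∫⁻ y, μ.rnDeriv (μ + ρ) y ^ a * ρ.rnDeriv (μ + ρ) y ^ (1 - a) ∂(μ + ρ)

theorem renyiDiv_eq_log_powerAffinity {α : ℝ≥0∞} (h0 : α ≠ 0) (h1 : α ≠ 1) (ht : α ≠ ∞)
    (W Q : ProbabilityMeasure Ω) :
    renyiDiv α W Q = ((1 / (α.toReal - 1) : ℝ) : EReal) *
      ENNReal.log (powerAffinity α.toReal (W : Measure Ω) Q) := by
  simp only [renyiDiv, if_neg h0, if_neg h1, if_neg ht, powerAffinity]

theorem renyiDiv_le_iff_of_lt_one {α : ℝ≥0∞} (h0 : 0 < α) (h1 : α < 1)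
    (W Q : ProbabilityMeasure Ω) (c : ℝ) :
    renyiDiv α W Q ≤ c ↔ ENNReal.ofReal (Real.exp ((α.toReal - 1) * c)) ≤
      powerAffinity α.toReal (W : Measure Ω) Q := by
  have hlt : α.toReal - 1 < 0 := by
    have := (ENNReal.toReal_lt_toReal (h1.trans ENNReal.one_lt_top).ne ENNReal.one_ne_top).2 h1
    simpa using this
  rw [renyiDiv_eq_log_powerAffinity h0.ne' h1.ne (h1.trans ENNReal.one_lt_top).ne,
    ENNReal.inv_mul_log_le_iff_of_neg hlt]

theorem renyiDiv_le_iff_of_one_lt {α : ℝ≥0∞} (h1 : 1 < α) (ht : α ≠ ∞)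
    (W Q : ProbabilityMeasure Ω) (c : ℝ) :
    renyiDiv α W Q ≤ c ↔ powerAffinity α.toReal (W : Measure Ω) Q ≤
      ENNReal.ofReal (Real.exp ((α.toReal - 1) * c)) := by
  have hlt : 0 < α.toReal - 1 := by
    have := (ENNReal.toReal_lt_toReal ENNReal.one_ne_top ht).2 h1
    simpa using this
  rw [renyiDiv_eq_log_powerAffinity (zero_lt_one.trans h1).ne' h1.ne' ht,
    ENNReal.inv_mul_log_le_iff_of_pos hlt]

/-- The integrand is homogeneous of degree one in the pair of densities, so the factor `f + g`,
which is the density of the intrinsic reference measure, can be moved inside. Where it vanishes both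
densities do, and `0 ^ a * 0 ^ (1 - a) = 0`. This gives independence of the reference measure. -/
theorem powerAffinity_withDensity {ν : Measure Ω} [SigmaFinite ν] {f g : Ω → ℝ≥0∞}
    (hf : Measurable f) (hg : Measurable g) (hf' : ∫⁻ y, f y ∂ν ≠ ∞) (hg' : ∫⁻ y, g y ∂ν ≠ ∞)
    {a : ℝ} (ha : 0 ≤ a) :
    powerAffinity a (ν.withDensity f) (ν.withDensity g) = ∫⁻ y, f y ^ a * g y ^ (1 - a) ∂ν := by
  have hμ : IsFiniteMeasure (ν.withDensity f) := isFiniteMeasure_withDensity hf'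
  have hρ : IsFiniteMeasure (ν.withDensity g) := isFiniteMeasure_withDensity hg'
  have hsum : ν.withDensity f + ν.withDensity g = ν.withDensity (f + g) :=
    (withDensity_add_left hf g).symm
  unfold powerAffinity
  set μ := ν.withDensity f with hμdef
  set ρ := ν.withDensity g with hρdef
  have e1 : (μ + ρ).withDensity (μ.rnDeriv (μ + ρ)) = μ :=
    Measure.withDensity_rnDeriv_eq _ _ (Measure.AbsolutelyContinuous.rfl.add_right ρ)
  have e2 : (μ + ρ).withDensity (ρ.rnDeriv (μ + ρ)) = ρ :=
    Measure.withDensity_rnDeriv_eq _ _ (by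
      rw [add_comm]; exact Measure.AbsolutelyContinuous.rfl.add_right μ)
  have m1 := Measure.measurable_rnDeriv μ (μ + ρ)
  have m2 := Measure.measurable_rnDeriv ρ (μ + ρ)
  set φ := μ.rnDeriv (μ + ρ)
  set γ := ρ.rnDeriv (μ + ρ)
  rw [hsum] at e1 e2 ⊢
  rw [← withDensity_mul _ (hf.add hg) m1] at e1
  rw [← withDensity_mul _ (hf.add hg) m2] at e2
  have e1' : f =ᵐ[ν] (f + g) * φ :=
    (withDensity_eq_iff hf.aemeasurable ((hf.add hg).mul m1).aemeasurable hf').1 e1.symm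
  have e2' : g =ᵐ[ν] (f + g) * γ :=
    (withDensity_eq_iff hg.aemeasurable ((hf.add hg).mul m2).aemeasurable hg').1 e2.symm
  rw [lintegral_withDensity_eq_lintegral_mul _ (hf.add hg)
    (by fun_prop : Measurable fun y => φ y ^ a * γ y ^ (1 - a))]
  have ht : ∀ᵐ y ∂ν, f y + g y < ∞ := by
    filter_upwards [ae_lt_top hf hf', ae_lt_top hg hg'] with y h1 h2
    exact ENNReal.add_lt_top.2 ⟨h1, h2⟩
  refine lintegral_congr_ae ?_
  filter_upwards [e1', e2', ht] with y h1 h2 h3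
  by_cases h0 : f y + g y = 0
  · obtain ⟨hf0, hg0⟩ := add_eq_zero.1 h0
    simp [hf0, hg0, ENNReal.zero_rpow_mul_zero_rpow_one_sub ha]
  · simp only [Pi.mul_apply, Pi.add_apply] at h1 h2 ⊢
    have e (u x z : ℝ≥0∞) (hu : u ≠ 0) (hu' : u ≠ ∞) :
        u * (x ^ a * z ^ (1 - a)) = (u * x) ^ a * (u * z) ^ (1 - a) := by
      rw [ENNReal.mul_rpow_of_ne_zero_of_ne_top hu hu',
        ENNReal.mul_rpow_of_ne_zero_of_ne_top hu hu', mul_mul_mul_comm,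
        ← ENNReal.rpow_add _ _ hu hu', add_sub_cancel, ENNReal.rpow_one]
    rw [e _ _ _ h0 h3.ne, ← h1, ← h2]

/-- Finite measures are given by densities with respect to a common finite measure. -/
theorem exists_withDensity_eq (μ ρ : Measure Ω) [IsFiniteMeasure μ] [IsFiniteMeasure ρ] :
    ∃ (ν : Measure Ω) (f g : Ω → ℝ≥0∞), IsFiniteMeasure ν ∧ Measurable f ∧ Measurable g ∧
      μ = ν.withDensity f ∧ ρ = ν.withDensity g := by
  refine ⟨μ + ρ, μ.rnDeriv (μ + ρ), ρ.rnDeriv (μ + ρ), inferInstance,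
    Measure.measurable_rnDeriv _ _, Measure.measurable_rnDeriv _ _, ?_, ?_⟩
  · exact (Measure.withDensity_rnDeriv_eq _ _
      (Measure.AbsolutelyContinuous.rfl.add_right ρ)).symm
  · exact (Measure.withDensity_rnDeriv_eq _ _ (by
      rw [add_comm]; exact Measure.AbsolutelyContinuous.rfl.add_right μ)).symm

theorem lintegral_ne_top_of_eq_withDensity {μ ν : Measure Ω} [IsFiniteMeasure μ] {f : Ω → ℝ≥0∞}
    (h : μ = ν.withDensity f) : ∫⁻ y, f y ∂ν ≠ ∞ := by
  have : μ Set.univ ≠ ∞ := measure_ne_top _ _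
  rwa [h, withDensity_apply _ MeasurableSet.univ, setLIntegral_univ] at this

theorem lintegral_eq_of_eq_withDensity {μ ν : Measure Ω} {f : Ω → ℝ≥0∞}
    (h : μ = ν.withDensity f) : ∫⁻ y, f y ∂ν = μ Set.univ := by
  rw [h, withDensity_apply _ MeasurableSet.univ, setLIntegral_univ]

theorem powerAffinity_eq_lintegral {μ ρ ν : Measure Ω} [IsFiniteMeasure μ] [IsFiniteMeasure ρ]
    [SigmaFinite ν] {f g : Ω → ℝ≥0∞} (hf : Measurable f) (hg : Measurable g)
    (hμ : μ = ν.withDensity f) (hρ : ρ = ν.withDensity g) {a : ℝ} (ha : 0 ≤ a) :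
    powerAffinity a μ ρ = ∫⁻ y, f y ^ a * g y ^ (1 - a) ∂ν := by
  have h1 := lintegral_ne_top_of_eq_withDensity hμ
  have h2 := lintegral_ne_top_of_eq_withDensity hρ
  subst hμ hρ
  exact powerAffinity_withDensity hf hg h1 h2 ha

theorem powerAffinity_smul_left {μ ρ : Measure Ω} [IsFiniteMeasure μ] [IsFiniteMeasure ρ]
    {c : ℝ≥0∞} (hc : c ≠ ∞) {a : ℝ} (ha : 0 ≤ a) :
    powerAffinity a (c • μ) ρ = c ^ a * powerAffinity a μ ρ := by
  obtain ⟨ν, f, g, hν, hf, hg, hμ, hρ⟩ := exists_withDensity_eq μ ρ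
  have : IsFiniteMeasure (c • μ) := Measure.smul_finite μ hc
  have hcμ : c • μ = ν.withDensity (c • f) := by rw [withDensity_smul _ hf, hμ]
  rw [powerAffinity_eq_lintegral (hf.const_smul c) hg hcμ hρ ha,
    powerAffinity_eq_lintegral hf hg hμ hρ ha, ← lintegral_const_mul _ (by fun_prop)]
  refine lintegral_congr fun y => ?_
  rw [Pi.smul_apply, smul_eq_mul, ENNReal.mul_rpow_of_nonneg _ _ ha, mul_assoc]

theorem powerAffinity_one {μ ρ : Measure Ω} [IsFiniteMeasure μ] [IsFiniteMeasure ρ] :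
    powerAffinity 1 μ ρ = μ Set.univ := by
  obtain ⟨ν, f, g, hν, hf, hg, hμ, hρ⟩ := exists_withDensity_eq μ ρ
  rw [powerAffinity_eq_lintegral hf hg hμ hρ zero_le_one, ← lintegral_eq_of_eq_withDensity hμ]
  simp

theorem powerAffinity_zero {μ ρ : Measure Ω} [IsFiniteMeasure μ] [IsFiniteMeasure ρ] :
    powerAffinity 0 μ ρ = ρ Set.univ := by
  obtain ⟨ν, f, g, hν, hf, hg, hμ, hρ⟩ := exists_withDensity_eq μ ρ
  rw [powerAffinity_eq_lintegral hf hg hμ hρ le_rfl, ← lintegral_eq_of_eq_withDensity hρ]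
  simp

theorem powerAffinity_self (μ : Measure Ω) [IsFiniteMeasure μ] {a : ℝ} (ha : 0 ≤ a) :
    powerAffinity a μ μ = μ Set.univ := by
  have h : μ = μ.withDensity 1 := withDensity_one.symm
  rw [powerAffinity_eq_lintegral (ν := μ) (f := 1) (g := 1) (by fun_prop) (by fun_prop) h h ha]
  simp

theorem powerAffinity_symm (μ ρ : Measure Ω) [IsFiniteMeasure μ] [IsFiniteMeasure ρ] {a : ℝ}
    (ha : 0 ≤ a) (ha' : a ≤ 1) : powerAffinity (1 - a) ρ μ = powerAffinity a μ ρ := by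
  obtain ⟨ν, f, g, hν, hf, hg, hμ, hρ⟩ := exists_withDensity_eq μ ρ
  rw [powerAffinity_eq_lintegral hf hg hμ hρ ha,
    powerAffinity_eq_lintegral hg hf hρ hμ (sub_nonneg.2 ha')]
  refine lintegral_congr fun y => ?_
  rw [sub_sub_cancel, mul_comm]

/-- Log-convexity of the power affinity in the order. -/
theorem powerAffinity_le_mul {μ ρ : Measure Ω} [IsFiniteMeasure μ] [IsFiniteMeasure ρ]
    {a b c θ : ℝ} (ha : 0 ≤ a) (hab : a < b) (hbc : b < c) (hθ0 : 0 < θ) (hθ1 : θ < 1)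
    (hb : b = θ * a + (1 - θ) * c) (hc : powerAffinity c μ ρ ≠ ∞) :
    powerAffinity b μ ρ ≤ powerAffinity a μ ρ ^ θ * powerAffinity c μ ρ ^ (1 - θ) := by
  obtain ⟨ν, f, g, hν, hf, hg, hμ, hρ⟩ := exists_withDensity_eq μ ρ
  have hf' := lintegral_ne_top_of_eq_withDensity hμ
  have hg' := lintegral_ne_top_of_eq_withDensity hρ
  have hb0 : 0 < b := ha.trans_lt hab
  rw [powerAffinity_eq_lintegral hf hg hμ hρ (hb0.trans hbc).le] at hc ⊢
  rw [powerAffinity_eq_lintegral hf hg hμ hρ ha, powerAffinity_eq_lintegral hf hg hμ hρ hb0.le]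
  have mc : Measurable fun y => f y ^ c * g y ^ (1 - c) := by fun_prop
  have ma : Measurable fun y => f y ^ a * g y ^ (1 - a) := by fun_prop
  refine le_trans ?_ (ENNReal.lintegral_mul_norm_pow_le ma.aemeasurable mc.aemeasurable hθ0.le
    (sub_nonneg.2 hθ1.le) (by ring))
  refine lintegral_mono_ae ?_
  filter_upwards [ae_lt_top hf hf', ae_lt_top hg hg', ae_lt_top mc hc] with y hfy hgy hcy
  by_cases f0 : f y = 0
  · simp [f0, ENNReal.zero_rpow_of_pos hb0]
  by_cases g0 : g y = 0
  · rcases lt_or_ge b 1 with h1 | h1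
    · simp [g0, ENNReal.zero_rpow_of_pos (sub_pos.2 h1)]
    -- Here `f y ≠ 0`, `g y = 0` and the exponent of `g y` at order `c` is negative, so the
    -- integrand of order `c` is infinite. Finiteness of its integral excludes this almost
    -- everywhere.
    · have hc1 : 1 - c < 0 := by linarith
      rw [g0, ENNReal.zero_rpow_of_neg hc1, ENNReal.mul_top] at hcy
      · exact absurd hcy (lt_irrefl _)
      · exact (ENNReal.rpow_pos (pos_iff_ne_zero.2 f0) hfy.ne).ne'
  · rw [ENNReal.mul_rpow_of_nonneg _ _ hθ0.le, ENNReal.mul_rpow_of_nonneg _ _ (sub_nonneg.2 hθ1.le),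
      ← ENNReal.rpow_mul, ← ENNReal.rpow_mul, ← ENNReal.rpow_mul, ← ENNReal.rpow_mul,
      mul_mul_mul_comm, ← ENNReal.rpow_add _ _ f0 hfy.ne, ← ENNReal.rpow_add _ _ g0 hgy.ne]
    apply le_of_eq
    congr 2 <;> rw [hb] <;> ring

/-! ### Consequences of log-convexity: bounds and monotonicity in the order. -/

theorem powerAffinity_le_one (P Q : ProbabilityMeasure Ω) {a : ℝ} (ha : 0 < a) (ha1 : a < 1) :
    powerAffinity a (P : Measure Ω) Q ≤ 1 := by
  have := powerAffinity_le_mul (μ := (P : Measure Ω)) (ρ := Q) le_rfl ha ha1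
    (θ := 1 - a) (by linarith) (by linarith) (by ring) (by simp [powerAffinity_one])
  simpa [powerAffinity_one, powerAffinity_zero] using this

/-- Order one lies between the orders 0 and `a`, and the affinities of orders 0 and 1 equal one, so
log-convexity bounds the affinity of order `a` from below. -/
theorem one_le_powerAffinity (P Q : ProbabilityMeasure Ω) {a : ℝ} (ha1 : 1 < a) :
    1 ≤ powerAffinity a (P : Measure Ω) Q := by
  by_cases hT : powerAffinity a (P : Measure Ω) Q = ∞
  · simp [hT]
  have ha : 0 < a := zero_lt_one.trans ha1
  have := powerAffinity_le_mul (μ := (P : Measure Ω)) (ρ := Q) le_rfl zero_lt_one ha1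
    (θ := 1 - 1 / a) (by rw [sub_pos, div_lt_one ha]; exact ha1)
    (by linarith [one_div_pos.2 ha]) (by field_simp; ring) hT
  simp only [powerAffinity_one, powerAffinity_zero, measure_univ, ENNReal.one_rpow, one_mul,
    sub_sub_cancel] at this
  by_contra! h
  exact absurd (this.trans_lt (ENNReal.rpow_lt_one h (by positivity))) (lt_irrefl _)

theorem powerAffinity_le_rpow_powerAffinity_half {P Q : ProbabilityMeasure Ω} {a : ℝ} (ha : 0 < a)
    (ha' : a < 1 / 2) : powerAffinity a (P : Measure Ω) Q ≤
      powerAffinity (1 / 2) (P : Measure Ω) Q ^ (2 * a) := by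
  have := powerAffinity_le_mul (μ := (P : Measure Ω)) (ρ := Q) le_rfl ha ha'
    (θ := 1 - 2 * a) (by linarith) (by linarith) (by ring)
    ((powerAffinity_le_one P Q (by norm_num) (by norm_num)).trans_lt ENNReal.one_lt_top).ne
  simpa [powerAffinity_zero] using this

/-- The convex function a ↦ ln S_a vanishes at a = 1, and D_a is its slope from that point. The
three cases are the positions of order one relative to the two orders. -/
theorem renyiDiv_le_of_le_of_lt {α β : ℝ≥0∞} (h0 : 0 < α) (hαβ : α < β) (hβ : β ≠ ∞) (hα1 : α ≠ 1)
    (hβ1 : β ≠ 1) {W Q : ProbabilityMeasure Ω} {c : ℝ} (h : renyiDiv β W Q ≤ c) :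
    renyiDiv α W Q ≤ c := by
  have hα : α ≠ ∞ := (hαβ.trans_le le_top).ne
  have ha : 0 < α.toReal := ENNReal.toReal_pos h0.ne' hα
  have hab : α.toReal < β.toReal := (ENNReal.toReal_lt_toReal hα hβ).2 hαβ
  rcases lt_or_gt_of_ne hβ1 with hb | hb
  · have hb' : β.toReal < 1 := by simpa using (ENNReal.toReal_lt_toReal hβ ENNReal.one_ne_top).2 hb
    rw [renyiDiv_le_iff_of_lt_one (h0.trans hαβ) hb] at h
    rw [renyiDiv_le_iff_of_lt_one h0 (hαβ.trans hb)]
    have hθ : 0 < (1 - β.toReal) / (1 - α.toReal) := div_pos (by linarith) (by linarith)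
    have hpos : 0 < 1 - α.toReal := by linarith
    have key := powerAffinity_le_mul (μ := (W : Measure Ω)) (ρ := Q) ha.le hab hb' hθ
      ((div_lt_one (by linarith)).2 (by linarith)) (by field_simp; ring)
      (by simp [powerAffinity_one])
    rw [powerAffinity_one, measure_univ, ENNReal.one_rpow, mul_one] at key
    have := (ENNReal.rpow_inv_le_iff hθ).2 (h.trans key)
    rw [ENNReal.ofReal_exp_rpow] at this
    convert this using 3
    have : 1 - β.toReal ≠ 0 := by linarith
    field_simp
    ring
  · have hb' : 1 < β.toReal := by simpa using (ENNReal.toReal_lt_toReal ENNReal.one_ne_top hβ).2 hb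
    rw [renyiDiv_le_iff_of_one_lt hb hβ] at h
    have hfin : powerAffinity β.toReal (W : Measure Ω) Q ≠ ∞ :=
      (h.trans_lt ENNReal.ofReal_lt_top).ne
    rcases lt_or_gt_of_ne hα1 with h1 | h1
    · have h1' : α.toReal < 1 := by
        simpa using (ENNReal.toReal_lt_toReal hα ENNReal.one_ne_top).2 h1
      rw [renyiDiv_le_iff_of_lt_one h0 h1]
      have hpos : 0 < β.toReal - α.toReal := by linarith
      have hθ : 0 < (β.toReal - 1) / (β.toReal - α.toReal) :=
        div_pos (by linarith) (by linarith)
      have hθ1 : (β.toReal - 1) / (β.toReal - α.toReal) < 1 :=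
        (div_lt_one (by linarith)).2 (by linarith)
      -- Order one is now the intermediate order: 1 ≤ S_α^θ S_β^(1-θ) is solved for S_α as a lower
      -- bound.
      have key := powerAffinity_le_mul (μ := (W : Measure Ω)) (ρ := Q) ha.le h1' hb' hθ hθ1
        (by field_simp; ring) hfin
      rw [powerAffinity_one, measure_univ] at key
      have key2 := key.trans (mul_le_mul_right (ENNReal.rpow_le_rpow h (sub_nonneg.2 hθ1.le)) _)
      rw [ENNReal.ofReal_exp_rpow] at key2
      set x := (β.toReal - 1) * c * (1 - (β.toReal - 1) / (β.toReal - α.toReal)) with hx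
      have key3 : ENNReal.ofReal (Real.exp (-x)) ≤
          powerAffinity α.toReal (W : Measure Ω) Q ^ ((β.toReal - 1) / (β.toReal - α.toReal)) := by
        calc _ = ENNReal.ofReal (Real.exp (-x)) * 1 := (mul_one _).symm
          _ ≤ ENNReal.ofReal (Real.exp (-x)) * _ := mul_le_mul_right key2 _
          _ = _ := by
            rw [mul_left_comm, ← ENNReal.ofReal_mul (Real.exp_pos _).le, ← Real.exp_add]
            simp
      have := (ENNReal.rpow_inv_le_iff hθ).2 key3
      rw [ENNReal.ofReal_exp_rpow] at this
      convert this using 3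
      have : β.toReal - 1 ≠ 0 := by linarith
      rw [hx]
      field_simp
      ring
    · have h1' : 1 < α.toReal := by
        simpa using (ENNReal.toReal_lt_toReal ENNReal.one_ne_top hα).2 h1
      rw [renyiDiv_le_iff_of_one_lt h1 hα]
      have hpos : 0 < β.toReal - 1 := by linarith
      have hθ : 0 < (α.toReal - 1) / (β.toReal - 1) := div_pos (by linarith) (by linarith)
      have hθ1 : (α.toReal - 1) / (β.toReal - 1) < 1 :=
        (div_lt_one (by linarith)).2 (by linarith)
      have key := powerAffinity_le_mul (μ := (W : Measure Ω)) (ρ := Q) zero_le_one h1' hab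
        (θ := 1 - (α.toReal - 1) / (β.toReal - 1)) (by linarith) (by linarith)
        (by field_simp; ring) hfin
      rw [powerAffinity_one, measure_univ, ENNReal.one_rpow, one_mul, sub_sub_cancel] at key
      refine key.trans ((ENNReal.rpow_le_rpow h hθ.le).trans_eq ?_)
      rw [ENNReal.ofReal_exp_rpow]
      congr 2
      field_simp

/-- `(1 - α) / α` times the Rényi divergence of order `α < 1` is antitone in `α`. -/
theorem renyiDiv_le_ratio_mul {γ β : ℝ≥0∞} (h0 : 0 < γ) (hγβ : γ < β) (hβ : β < 1)
    {W Q : ProbabilityMeasure Ω} {c : ℝ} (h : renyiDiv γ W Q ≤ c) :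
    renyiDiv β W Q ≤
      ((β.toReal * (1 - γ.toReal) / (γ.toReal * (1 - β.toReal)) * c : ℝ) : EReal) := by
  have hβt : β ≠ ∞ := (hβ.trans ENNReal.one_lt_top).ne
  have hγt : γ ≠ ∞ := (hγβ.trans_le le_top).ne
  have hg : 0 < γ.toReal := ENNReal.toReal_pos h0.ne' hγt
  have hgb : γ.toReal < β.toReal := (ENNReal.toReal_lt_toReal hγt hβt).2 hγβ
  have hb : β.toReal < 1 := by simpa using (ENNReal.toReal_lt_toReal hβt ENNReal.one_ne_top).2 hβ
  rw [renyiDiv_le_iff_of_lt_one h0 (hγβ.trans hβ)] at h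
  rw [renyiDiv_le_iff_of_lt_one (h0.trans hγβ) hβ]
  have hb0 : 0 < β.toReal := hg.trans hgb
  have hθ : 0 < γ.toReal / β.toReal := div_pos hg hb0
  -- Interpolation against order zero, where the affinity is also one, in place of order one.
  have key := powerAffinity_le_mul (μ := (W : Measure Ω)) (ρ := Q) le_rfl hg hgb
    (θ := 1 - γ.toReal / β.toReal) (by rw [sub_pos]; exact (div_lt_one hb0).2 hgb) (by linarith)
    (by field_simp; ring) ((powerAffinity_le_one W Q hb0 hb).trans_lt ENNReal.one_lt_top).ne
  rw [powerAffinity_zero, measure_univ, ENNReal.one_rpow, one_mul, sub_sub_cancel] at key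
  have := (ENNReal.rpow_inv_le_iff hθ).2 (h.trans key)
  rw [ENNReal.ofReal_exp_rpow] at this
  convert this using 3
  have : 1 - β.toReal ≠ 0 := by linarith
  field_simp
  ring

/-! ### Pinsker-type inequalities. -/

theorem powerAffinity_le_partition {μ ρ : Measure Ω} [IsFiniteMeasure μ] [IsFiniteMeasure ρ]
    {E : Set Ω} (hE : MeasurableSet E) {a : ℝ} (ha : 0 ≤ a) (ha1 : a ≤ 1) :
    powerAffinity a μ ρ ≤ μ E ^ a * ρ E ^ (1 - a) + μ Eᶜ ^ a * ρ Eᶜ ^ (1 - a) := by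
  obtain ⟨ν, f, g, hν, hf, hg, hμ, hρ⟩ := exists_withDensity_eq μ ρ
  rw [powerAffinity_eq_lintegral hf hg hμ hρ ha, ← lintegral_add_compl _ hE]
  have h (F : Set Ω) (hF : MeasurableSet F) :
      ∫⁻ y in F, f y ^ a * g y ^ (1 - a) ∂ν ≤ μ F ^ a * ρ F ^ (1 - a) := by
    -- Hölder on each cell: this is data processing for the partition into `E` and its complement.
    have := ENNReal.lintegral_mul_norm_pow_le (μ := ν.restrict F) hf.aemeasurable hg.aemeasurable
      ha (sub_nonneg.2 ha1) (add_sub_cancel _ _)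
    rwa [← withDensity_apply f hF, ← withDensity_apply g hF, ← hμ, ← hρ] at this
  exact add_le_add (h E hE) (h _ hE.compl)

/-- Factor p - q = (√p - √q)(√p + √q) with second factor at most 2, and use that twice one minus the
affinity is (√p - √q)² + (√(1-p) - √(1-q))². -/
theorem Real.sq_sub_le_one_sub_affinity {p q : ℝ} (hp : 0 ≤ p) (hp1 : p ≤ 1) (hq : 0 ≤ q)
    (hq1 : q ≤ 1) : (p - q) ^ 2 ≤ 8 * (1 - (√p * √q + √(1 - p) * √(1 - q))) := by
  have h1 := Real.sq_sqrt hp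
  have h2 := Real.sq_sqrt hq
  have h3 := Real.sq_sqrt (sub_nonneg.2 hp1)
  have h4 := Real.sq_sqrt (sub_nonneg.2 hq1)
  have h5 : √p ≤ 1 := Real.sqrt_le_one.2 hp1
  have h6 : √q ≤ 1 := Real.sqrt_le_one.2 hq1
  have h7 := Real.sqrt_nonneg p
  have h8 := Real.sqrt_nonneg q
  have e : (p - q) ^ 2 = (√p - √q) ^ 2 * (√p + √q) ^ 2 := by
    rw [← mul_pow, ← h1, ← h2]; simp only [Real.sqrt_sq h7, Real.sqrt_sq h8]; ring
  have h9 : (√p + √q) ^ 2 ≤ 4 := by nlinarith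
  have h10 := mul_le_mul_of_nonneg_left h9 (sq_nonneg (√p - √q))
  nlinarith [sq_nonneg (√(1 - p) - √(1 - q))]

/-- The constant 32 is 4 · 8: the distance is twice the supremum of P(E) - Q(E). -/
theorem tvDist_le_sqrt (P Q : ProbabilityMeasure Ω) :
    tvDist P Q ≤ √(32 * (1 - (powerAffinity (1 / 2) (P : Measure Ω) Q).toReal)) := by
  refine tvDist_le fun E hE => Real.le_sqrt_of_sq_le ?_
  have key := powerAffinity_le_partition (μ := (P : Measure Ω)) (ρ := Q) hE
    (a := 1 / 2) (by norm_num) (by norm_num)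
  have h1 (R : ProbabilityMeasure Ω) (F : Set Ω) : (R : Measure Ω) F ^ (1 / 2 : ℝ) ≠ ∞ :=
    ENNReal.rpow_ne_top_of_nonneg (by norm_num) (measure_ne_top _ _)
  rw [show (1 - 1 / 2 : ℝ) = 1 / 2 by norm_num] at key
  have key2 := ENNReal.toReal_mono (ENNReal.add_ne_top.2
    ⟨ENNReal.mul_ne_top (h1 P E) (h1 Q E), ENNReal.mul_ne_top (h1 P Eᶜ) (h1 Q Eᶜ)⟩) key
  rw [ENNReal.toReal_add (ENNReal.mul_ne_top (h1 P E) (h1 Q E))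
    (ENNReal.mul_ne_top (h1 P Eᶜ) (h1 Q Eᶜ))] at key2
  simp only [ENNReal.toReal_mul, ← ENNReal.toReal_rpow, ← Real.sqrt_eq_rpow,
    ← measureReal_def, probReal_compl_eq_one_sub hE] at key2
  have := Real.sq_sub_le_one_sub_affinity (p := (P : Measure Ω).real E)
    (q := (Q : Measure Ω).real E) measureReal_nonneg measureReal_le_one measureReal_nonneg
    measureReal_le_one
  nlinarith

/-- A form of Pinsker's inequality, uniform in the order. -/
theorem exists_tvDist_le_of_renyiDiv_le {α₀ : ℝ≥0∞} (h0 : 0 < α₀) {η : ℝ} (hη : 0 < η) :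
    ∃ δ : ℝ, 0 < δ ∧ ∀ α : ℝ≥0∞, α₀ ≤ α → α ≠ 1 → α ≠ ∞ → ∀ P Q : ProbabilityMeasure Ω,
      renyiDiv α P Q ≤ (δ : EReal) → tvDist P Q ≤ η := by
  obtain ⟨α₁, h1, h1'⟩ := exists_between (lt_min h0 (ENNReal.inv_pos.2 ENNReal.ofNat_ne_top :
    (0 : ℝ≥0∞) < 2⁻¹))
  have hα₀ := h1'.trans_le (min_le_left _ _)
  have h2 := h1'.trans_le (min_le_right _ _)
  have hα₁ : α₁ < 1 := h2.trans (by simp [ENNReal.inv_lt_one])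
  have ht := (hα₁.trans ENNReal.one_lt_top).ne
  set a := α₁.toReal with ha
  have ha0 : 0 < a := ENNReal.toReal_pos h1.ne' ht
  have ha2 : a < 1 / 2 := by
    have := (ENNReal.toReal_lt_toReal ht (by simp)).2 h2
    simpa using this
  -- Lowering every order to the fixed `α₁ < 1/2` makes the bound uniform. With this δ one gets
  -- S_(1/2) ≥ exp((a-1)δ/(2a)) = exp((a-1)η²/32) ≥ 1 - η²/32.
  refine ⟨2 * a * (η ^ 2 / 32), by positivity, fun α hα hα1 hαt P Q h => ?_⟩
  have h3 := renyiDiv_le_of_le_of_lt h1 (hα₀.trans_le hα) hαt hα₁.ne hα1 h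
  rw [renyiDiv_le_iff_of_lt_one h1 hα₁] at h3
  have h4 := (ENNReal.rpow_inv_le_iff (by positivity)).2
    (h3.trans (powerAffinity_le_rpow_powerAffinity_half ha0 ha2))
  rw [ENNReal.ofReal_exp_rpow] at h4
  have hle := powerAffinity_le_one P Q (a := 1 / 2) (by norm_num) (by norm_num)
  have h5 := (ENNReal.ofReal_le_iff_le_toReal (hle.trans_lt ENNReal.one_lt_top).ne).1 h4
  rw [← ha] at h5
  have h6 : (a - 1) * (2 * a * (η ^ 2 / 32)) * (2 * a)⁻¹ = (a - 1) * (η ^ 2 / 32) := by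
    field_simp
  rw [h6] at h5
  have h7 := Real.add_one_le_exp ((a - 1) * (η ^ 2 / 32))
  refine (tvDist_le_sqrt P Q).trans (Real.sqrt_le_iff.2 ⟨hη.le, ?_⟩)
  nlinarith [mul_nonneg ha0.le (sq_nonneg η)]

/-! ### Total variation and L¹ convergence of densities. -/

theorem tvDist_nonneg (P Q : ProbabilityMeasure Ω) : 0 ≤ tvDist P Q := by
  have := le_tvDist P Q MeasurableSet.empty
  simpa using this

/-- The set where `q ≤ p` is a Hahn set of the difference. Since both total masses are one, its two
sides contribute equally to the L¹ norm. -/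
theorem integral_abs_sub_le_tvDist {P Q : ProbabilityMeasure Ω} {ν : Measure Ω} [IsFiniteMeasure ν]
    (hP : (P : Measure Ω) ≪ ν) (hQ : (Q : Measure Ω) ≪ ν) :
    ∫ y, |((P : Measure Ω).rnDeriv ν y).toReal - ((Q : Measure Ω).rnDeriv ν y).toReal| ∂ν ≤
      tvDist P Q := by
  set p := fun y => ((P : Measure Ω).rnDeriv ν y).toReal with hp
  set q := fun y => ((Q : Measure Ω).rnDeriv ν y).toReal with hq
  have hpi : Integrable p ν := Measure.integrable_toReal_rnDeriv
  have hqi : Integrable q ν := Measure.integrable_toReal_rnDeriv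
  have hpm : Measurable p := (Measure.measurable_rnDeriv _ _).ennreal_toReal
  have hqm : Measurable q := (Measure.measurable_rnDeriv _ _).ennreal_toReal
  have hE : MeasurableSet {y | q y ≤ p y} := measurableSet_le hqm hpm
  have hi : Integrable (fun y => |p y - q y|) ν := (hpi.sub hqi).abs
  rw [← integral_add_compl hE hi]
  have e1 : ∫ y in {y | q y ≤ p y}, |p y - q y| ∂ν =
      (P : Measure Ω).real {y | q y ≤ p y} - (Q : Measure Ω).real {y | q y ≤ p y} := by
    rw [setIntegral_congr_fun (g := fun y => p y - q y) hE
      fun y hy => abs_of_nonneg (sub_nonneg.2 hy), integral_sub hpi.integrableOn hqi.integrableOn,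
      Measure.setIntegral_toReal_rnDeriv hP, Measure.setIntegral_toReal_rnDeriv hQ]
  have e2 : ∫ y in {y | q y ≤ p y}ᶜ, |p y - q y| ∂ν =
      (Q : Measure Ω).real {y | q y ≤ p y}ᶜ - (P : Measure Ω).real {y | q y ≤ p y}ᶜ := by
    rw [setIntegral_congr_fun (g := fun y => q y - p y) hE.compl
      fun y hy => by
        have hy := (not_le.1 hy : p y < q y)
        simp only
        rw [abs_sub_comm, abs_of_nonneg (sub_nonneg.2 hy.le)],
      integral_sub hqi.integrableOn hpi.integrableOn,
      Measure.setIntegral_toReal_rnDeriv hP, Measure.setIntegral_toReal_rnDeriv hQ]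
  rw [e1, e2, probReal_compl_eq_one_sub hE, probReal_compl_eq_one_sub hE]
  have := le_tvDist P Q hE
  linarith

theorem lintegral_enorm_sub_le_tvDist {P Q : ProbabilityMeasure Ω} {ν : Measure Ω}
    [IsFiniteMeasure ν] (hP : (P : Measure Ω) ≪ ν) (hQ : (Q : Measure Ω) ≪ ν) :
    ∫⁻ y, ‖((P : Measure Ω).rnDeriv ν y).toReal - ((Q : Measure Ω).rnDeriv ν y).toReal‖ₑ ∂ν ≤
      ENNReal.ofReal (tvDist P Q) := by
  have hi : Integrable (fun y => ((P : Measure Ω).rnDeriv ν y).toReal -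
      ((Q : Measure Ω).rnDeriv ν y).toReal) ν :=
    Measure.integrable_toReal_rnDeriv.sub Measure.integrable_toReal_rnDeriv
  rw [← ofReal_integral_norm_eq_lintegral_enorm hi]
  exact ENNReal.ofReal_le_ofReal (integral_abs_sub_le_tvDist hP hQ)

/-! ### Lower semicontinuity of the divergence in total variation. -/

theorem exists_dominating (P : ℕ → ProbabilityMeasure Ω) :
    ∃ ν : Measure Ω, IsFiniteMeasure ν ∧ ∀ n, (P n : Measure Ω) ≪ ν :=
  ⟨(Measure.sum fun n => (P n : Measure Ω)).toFinite, inferInstance, fun n =>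
    (Measure.absolutelyContinuous_of_le (Measure.le_sum _ n)).trans
      (absolutelyContinuous_toFinite _)⟩

/-- L¹ convergence of the densities gives convergence in measure, hence an almost everywhere
convergent subsequence, to which Fatou's lemma can be applied. -/
theorem exists_subseq_rnDeriv_tendsto {P : ℕ → ProbabilityMeasure Ω} {R : ProbabilityMeasure Ω}
    (h : Tendsto (fun n => tvDist (P n) R) atTop (𝓝 0)) {ν : Measure Ω} [IsFiniteMeasure ν]
    (hP : ∀ n, (P n : Measure Ω) ≪ ν) (hR : (R : Measure Ω) ≪ ν) :
    ∃ ns : ℕ → ℕ, StrictMono ns ∧ ∀ᵐ y ∂ν, Tendsto (fun k => (P (ns k) : Measure Ω).rnDeriv ν y)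
      atTop (𝓝 ((R : Measure Ω).rnDeriv ν y)) := by
  have hm (Q : ProbabilityMeasure Ω) :
      AEStronglyMeasurable (fun y => ((Q : Measure Ω).rnDeriv ν y).toReal) ν :=
    (Measure.measurable_rnDeriv _ _).ennreal_toReal.aestronglyMeasurable
  have h1 : Tendsto (fun n => eLpNorm ((fun y => ((P n : Measure Ω).rnDeriv ν y).toReal) -
      fun y => ((R : Measure Ω).rnDeriv ν y).toReal) 1 ν) atTop (𝓝 0) := by
    have h2 := ENNReal.tendsto_ofReal h
    rw [ENNReal.ofReal_zero] at h2
    refine tendsto_of_tendsto_of_tendsto_of_le_of_le tendsto_const_nhds h2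
      (fun _ => bot_le) fun n => ?_
    rw [eLpNorm_one_eq_lintegral_enorm]
    exact lintegral_enorm_sub_le_tvDist (hP n) hR
  obtain ⟨ns, hns, hae⟩ := (tendstoInMeasure_of_tendsto_eLpNorm one_ne_zero (fun n => hm (P n))
    (hm R) h1).exists_seq_tendsto_ae
  refine ⟨ns, hns, ?_⟩
  filter_upwards [hae, ae_all_iff.2 fun n => Measure.rnDeriv_lt_top (P n : Measure Ω) ν,
    Measure.rnDeriv_lt_top (R : Measure Ω) ν] with y h1 h2 h3
  exact (ENNReal.tendsto_toReal_iff (fun k => (h2 (ns k)).ne) h3.ne).1 h1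

/-- For `a > 1` the product is continuous at the limit unless `x₀ = 0`, and there the left side is
zero whatever `y₀` is. -/
theorem ENNReal.tendsto_rpow_mul_rpow_one_sub_le {a : ℝ} (ha : 1 < a) {x y : ℕ → ℝ≥0∞}
    {x₀ y₀ : ℝ≥0∞} (hx : Tendsto x atTop (𝓝 x₀)) (hy : Tendsto y atTop (𝓝 y₀)) (hx₀ : x₀ ≠ ∞) :
    x₀ ^ a * y₀ ^ (1 - a) ≤ liminf (fun n => x n ^ a * y n ^ (1 - a)) atTop := by
  rcases eq_or_ne x₀ 0 with rfl | h0
  · simp [ENNReal.zero_rpow_of_pos (zero_lt_one.trans ha)]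
  · have h1 : Tendsto (fun n => x n ^ a) atTop (𝓝 (x₀ ^ a)) :=
      (ENNReal.continuous_rpow_const.tendsto _).comp hx
    have h2 : Tendsto (fun n => y n ^ (1 - a)) atTop (𝓝 (y₀ ^ (1 - a))) :=
      (ENNReal.continuous_rpow_const.tendsto _).comp hy
    refine (ENNReal.Tendsto.mul h1 (Or.inl ?_) h2 (Or.inr ?_)).liminf_eq.ge
    · exact (ENNReal.rpow_pos (pos_iff_ne_zero.2 h0) hx₀).ne'
    · exact ENNReal.rpow_ne_top_of_nonneg (by linarith) hx₀

theorem powerAffinity_le_of_tendsto_of_one_lt {a : ℝ} (ha : 1 < a) {P Q : ℕ → ProbabilityMeasure Ω}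
    {P₀ Q₀ : ProbabilityMeasure Ω} (hP : Tendsto (fun n => tvDist (P n) P₀) atTop (𝓝 0))
    (hQ : Tendsto (fun n => tvDist (Q n) Q₀) atTop (𝓝 0)) {t : ℕ → ℝ≥0∞} {t₀ : ℝ≥0∞}
    (ht : Tendsto t atTop (𝓝 t₀)) (h : ∀ n, powerAffinity a (P n : Measure Ω) (Q n) ≤ t n) :
    powerAffinity a (P₀ : Measure Ω) Q₀ ≤ t₀ := by
  have ha0 : 0 ≤ a := (zero_lt_one.trans ha).le
  obtain ⟨ν₁, h1, hν₁⟩ := exists_dominating P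
  obtain ⟨ν₂, h2, hν₂⟩ := exists_dominating Q
  set ν := ν₁ + ν₂ + P₀ + Q₀ with hν
  have hac₁ : ν₁ ≪ ν := Measure.absolutelyContinuous_of_le (by
    rw [hν, add_assoc, add_assoc]; exact Measure.le_add_right le_rfl)
  have hac₂ : ν₂ ≪ ν := Measure.absolutelyContinuous_of_le (by
    rw [hν, add_comm ν₁, add_assoc, add_assoc]; exact Measure.le_add_right le_rfl)
  have hP₀ : (P₀ : Measure Ω) ≪ ν := Measure.absolutelyContinuous_of_le (by
    rw [hν]; exact Measure.le_add_right (Measure.le_add_left le_rfl))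
  have hQ₀ : (Q₀ : Measure Ω) ≪ ν := Measure.absolutelyContinuous_of_le
    (Measure.le_add_left le_rfl)
  have hPν n : (P n : Measure Ω) ≪ ν := (hν₁ n).trans hac₁
  have hQν n : (Q n : Measure Ω) ≪ ν := (hν₂ n).trans hac₂
  obtain ⟨ns, hns, haeP⟩ := exists_subseq_rnDeriv_tendsto hP hPν hP₀
  obtain ⟨ms, hms, haeQ⟩ := exists_subseq_rnDeriv_tendsto (hQ.comp hns.tendsto_atTop)
    (fun k => hQν (ns k)) hQ₀
  have hS {A B : ProbabilityMeasure Ω} (hA : (A : Measure Ω) ≪ ν) (hB : (B : Measure Ω) ≪ ν) :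
      powerAffinity a (A : Measure Ω) B = ∫⁻ y, (A : Measure Ω).rnDeriv ν y ^ a *
        (B : Measure Ω).rnDeriv ν y ^ (1 - a) ∂ν :=
    powerAffinity_eq_lintegral (Measure.measurable_rnDeriv _ _) (Measure.measurable_rnDeriv _ _)
      (Measure.withDensity_rnDeriv_eq _ _ hA).symm (Measure.withDensity_rnDeriv_eq _ _ hB).symm ha0
  have hm (A : ProbabilityMeasure Ω) : Measurable ((A : Measure Ω).rnDeriv ν) :=
    Measure.measurable_rnDeriv _ _
  rw [hS hP₀ hQ₀]
  calc ∫⁻ y, (P₀ : Measure Ω).rnDeriv ν y ^ a * (Q₀ : Measure Ω).rnDeriv ν y ^ (1 - a) ∂ν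
      ≤ ∫⁻ y, liminf (fun k => (P (ns (ms k)) : Measure Ω).rnDeriv ν y ^ a *
        (Q (ns (ms k)) : Measure Ω).rnDeriv ν y ^ (1 - a)) atTop ∂ν := by
        refine lintegral_mono_ae ?_
        filter_upwards [haeP, haeQ, Measure.rnDeriv_lt_top (P₀ : Measure Ω) ν] with y h1 h2 h3
        exact ENNReal.tendsto_rpow_mul_rpow_one_sub_le ha (h1.comp hms.tendsto_atTop) h2 h3.ne
    _ ≤ liminf (fun k => ∫⁻ y, (P (ns (ms k)) : Measure Ω).rnDeriv ν y ^ a *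
        (Q (ns (ms k)) : Measure Ω).rnDeriv ν y ^ (1 - a) ∂ν) atTop :=
        lintegral_liminf_le fun k => ((hm _).pow_const _).mul ((hm _).pow_const _)
    _ ≤ liminf (fun k => t (ns (ms k))) atTop := by
        refine liminf_le_liminf (Eventually.of_forall fun k => ?_)
        rw [← hS (hPν _) (hQν _)]
        exact h _
    _ = t₀ := (ht.comp (hns.tendsto_atTop.comp hms.tendsto_atTop)).liminf_eq

/-- Subadditivity of x ↦ x^a gives p'^a ≤ p^a + |p' - p|^a, and Hölder bounds the integral of the
extra term. Exchanging the arguments and `a` with `1 - a` yields the same control in the second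
measure. -/
theorem powerAffinity_le_add_tvDist {a : ℝ} (ha : 0 < a) (ha1 : a < 1)
    (P P' Q : ProbabilityMeasure Ω) :
    powerAffinity a (P' : Measure Ω) Q ≤
      powerAffinity a (P : Measure Ω) Q + ENNReal.ofReal (tvDist P' P) ^ a := by
  set ν : Measure Ω := P' + P + Q with hν
  have hP' : (P' : Measure Ω) ≪ ν := Measure.absolutelyContinuous_of_le (by
    rw [hν, add_assoc]; exact Measure.le_add_right le_rfl)
  have hP : (P : Measure Ω) ≪ ν := Measure.absolutelyContinuous_of_le (by
    rw [hν]; exact Measure.le_add_right (Measure.le_add_left le_rfl))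
  have hQ : (Q : Measure Ω) ≪ ν := Measure.absolutelyContinuous_of_le (Measure.le_add_left le_rfl)
  have hS {A B : ProbabilityMeasure Ω} (hA : (A : Measure Ω) ≪ ν) (hB : (B : Measure Ω) ≪ ν) :
      powerAffinity a (A : Measure Ω) B = ∫⁻ y, (A : Measure Ω).rnDeriv ν y ^ a *
        (B : Measure Ω).rnDeriv ν y ^ (1 - a) ∂ν :=
    powerAffinity_eq_lintegral (Measure.measurable_rnDeriv _ _) (Measure.measurable_rnDeriv _ _)
      (Measure.withDensity_rnDeriv_eq _ _ hA).symm (Measure.withDensity_rnDeriv_eq _ _ hB).symm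
      ha.le
  have hm (A : ProbabilityMeasure Ω) : Measurable ((A : Measure Ω).rnDeriv ν) :=
    Measure.measurable_rnDeriv _ _
  have m1 := hm P
  have m2 := hm P'
  have m3 := hm Q
  set e : Ω → ℝ≥0∞ := fun y => ‖((P' : Measure Ω).rnDeriv ν y).toReal -
    ((P : Measure Ω).rnDeriv ν y).toReal‖ₑ with he
  have me : Measurable e := (m2.ennreal_toReal.sub m1.ennreal_toReal).enorm
  rw [hS hP' hQ, hS hP hQ]
  calc ∫⁻ y, (P' : Measure Ω).rnDeriv ν y ^ a * (Q : Measure Ω).rnDeriv ν y ^ (1 - a) ∂ν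
      ≤ ∫⁻ y, ((P : Measure Ω).rnDeriv ν y ^ a * (Q : Measure Ω).rnDeriv ν y ^ (1 - a) +
        e y ^ a * (Q : Measure Ω).rnDeriv ν y ^ (1 - a)) ∂ν := by
        refine lintegral_mono_ae ?_
        filter_upwards [Measure.rnDeriv_lt_top (P : Measure Ω) ν,
          Measure.rnDeriv_lt_top (P' : Measure Ω) ν] with y h1 h2
        rw [← add_mul]
        refine mul_le_mul_left ((ENNReal.rpow_le_rpow ?_ ha.le).trans
          (ENNReal.rpow_add_le_add_rpow _ _ ha.le ha1.le)) _
        simp only [he, Real.enorm_eq_ofReal_abs]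
        conv_lhs => rw [← ENNReal.ofReal_toReal h2.ne]
        conv_rhs => enter [1]; rw [← ENNReal.ofReal_toReal h1.ne]
        rw [← ENNReal.ofReal_add ENNReal.toReal_nonneg (abs_nonneg _)]
        refine ENNReal.ofReal_le_ofReal ?_
        linarith [le_abs_self (((P' : Measure Ω).rnDeriv ν y).toReal -
          ((P : Measure Ω).rnDeriv ν y).toReal)]
    _ = ∫⁻ y, (P : Measure Ω).rnDeriv ν y ^ a * (Q : Measure Ω).rnDeriv ν y ^ (1 - a) ∂ν +
        ∫⁻ y, e y ^ a * (Q : Measure Ω).rnDeriv ν y ^ (1 - a) ∂ν :=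
        lintegral_add_left (by fun_prop) _
    _ ≤ _ := by
        refine add_le_add_right ?_ _
        refine (ENNReal.lintegral_mul_norm_pow_le me.aemeasurable m3.aemeasurable ha.le
          (sub_nonneg.2 ha1.le) (by ring)).trans ?_
        rw [Measure.lintegral_rnDeriv hQ, measure_univ, ENNReal.one_rpow, mul_one]
        exact ENNReal.rpow_le_rpow (lintegral_enorm_sub_le_tvDist hP' hP) ha.le

theorem le_powerAffinity_of_tendsto_of_lt_one {a : ℝ} (ha0 : 0 < a) (ha : a < 1)
    {P Q : ℕ → ProbabilityMeasure Ω} {P₀ Q₀ : ProbabilityMeasure Ω}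
    (hP : Tendsto (fun n => tvDist (P n) P₀) atTop (𝓝 0))
    (hQ : Tendsto (fun n => tvDist (Q n) Q₀) atTop (𝓝 0)) {t : ℕ → ℝ≥0∞} {t₀ : ℝ≥0∞}
    (ht : Tendsto t atTop (𝓝 t₀)) (h : ∀ n, t n ≤ powerAffinity a (P n : Measure Ω) (Q n)) :
    t₀ ≤ powerAffinity a (P₀ : Measure Ω) Q₀ := by
  have hle n : t n ≤ powerAffinity a (P₀ : Measure Ω) Q₀ +
      ENNReal.ofReal (tvDist (Q n) Q₀) ^ (1 - a) + ENNReal.ofReal (tvDist (P n) P₀) ^ a := by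
    refine (h n).trans ((powerAffinity_le_add_tvDist ha0 ha P₀ (P n) (Q n)).trans ?_)
    refine add_le_add_left ?_ _
    rw [← powerAffinity_symm _ _ ha0.le ha.le, ← powerAffinity_symm _ _ ha0.le ha.le]
    exact powerAffinity_le_add_tvDist (by linarith) (by linarith) _ _ _
  have hlim {u : ℕ → ℝ} (hu : Tendsto u atTop (𝓝 0)) {s : ℝ} (hs : 0 < s) :
      Tendsto (fun n => ENNReal.ofReal (u n) ^ s) atTop (𝓝 0) := by
    have := ((ENNReal.continuous_rpow_const (y := s)).tendsto _).comp (ENNReal.tendsto_ofReal hu)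
    simpa [ENNReal.zero_rpow_of_pos hs, Function.comp_def] using this
  have := ((tendsto_const_nhds (x := powerAffinity a (P₀ : Measure Ω) Q₀)).add
    (hlim hQ (sub_pos.2 ha))).add (hlim hP ha0)
  rw [add_zero, add_zero] at this
  exact le_of_tendsto_of_tendsto' ht this hle

/-- The Rényi divergence is jointly lower semicontinuous for the total variation metric. -/
theorem renyiDiv_le_of_tendsto {α : ℝ≥0∞} (h0 : 0 < α) (h1 : α ≠ 1) (hα : α ≠ ∞)
    {P Q : ℕ → ProbabilityMeasure Ω} {P₀ Q₀ : ProbabilityMeasure Ω}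
    (hP : Tendsto (fun n => tvDist (P n) P₀) atTop (𝓝 0))
    (hQ : Tendsto (fun n => tvDist (Q n) Q₀) atTop (𝓝 0)) {c : ℕ → ℝ} {c₀ : ℝ}
    (hc : Tendsto c atTop (𝓝 c₀)) (h : ∀ n, renyiDiv α (P n) (Q n) ≤ (c n : EReal)) :
    renyiDiv α P₀ Q₀ ≤ (c₀ : EReal) := by
  have ht : Tendsto (fun n => ENNReal.ofReal (Real.exp ((α.toReal - 1) * c n))) atTop
      (𝓝 (ENNReal.ofReal (Real.exp ((α.toReal - 1) * c₀)))) :=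
    ENNReal.tendsto_ofReal ((Real.continuous_exp.tendsto _).comp (hc.const_mul _))
  rcases lt_or_gt_of_ne h1 with h1 | h1
  · rw [renyiDiv_le_iff_of_lt_one h0 h1]
    refine le_powerAffinity_of_tendsto_of_lt_one (ENNReal.toReal_pos h0.ne' hα) ?_ hP hQ ht
      fun n => (renyiDiv_le_iff_of_lt_one h0 h1 _ _ _).1 (h n)
    simpa using (ENNReal.toReal_lt_toReal hα ENNReal.one_ne_top).2 h1
  · rw [renyiDiv_le_iff_of_one_lt h1 hα]
    refine powerAffinity_le_of_tendsto_of_one_lt ?_ hP hQ ht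
      fun n => (renyiDiv_le_iff_of_one_lt h1 hα _ _ _).1 (h n)
    simpa using (ENNReal.toReal_lt_toReal ENNReal.one_ne_top hα).2 h1

/-! ### Completeness of the total variation metric. -/

theorem tvMetricSpace_completeSpace :
    @CompleteSpace (ProbabilityMeasure Ω) (tvMetricSpace Ω).toUniformSpace := by
  let _ := tvMetricSpace Ω
  refine Metric.complete_of_cauchySeq_tendsto fun u hu => ?_
  obtain ⟨ν, hνf, hν⟩ := exists_dominating u
  set p : ℕ → Ω → ℝ := fun n y => ((u n : Measure Ω).rnDeriv ν y).toReal with hp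
  have hpi n : Integrable (p n) ν := Measure.integrable_toReal_rnDeriv
  set F : ℕ → Lp ℝ 1 ν := fun n => (hpi n).toL1 (p n) with hF
  have hd n m : dist (F n) (F m) ≤ dist (u n) (u m) := by
    rw [dist_edist, hF, Integrable.edist_toL1_toL1]
    refine ENNReal.toReal_le_of_le_ofReal (tvDist_nonneg _ _) ?_
    simp only [edist_eq_enorm_sub]
    exact lintegral_enorm_sub_le_tvDist (hν n) (hν m)
  have hcF : CauchySeq F := by
    rw [Metric.cauchySeq_iff] at hu ⊢
    intro ε hε
    obtain ⟨N, hN⟩ := hu ε hε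
    exact ⟨N, fun m hm n hn => (hd m n).trans_lt (hN m hm n hn)⟩
  obtain ⟨G, hG⟩ := cauchySeq_tendsto_of_complete hcF
  have hGi : Integrable G ν := L1.integrable_coeFn G
  have hdist n : ∫ y, |p n y - G y| ∂ν = dist (F n) G := by
    conv_rhs => rw [← Integrable.toL1_coeFn G hGi]
    rw [dist_edist, hF, Integrable.edist_toL1_toL1]
    simp only [edist_eq_enorm_sub]
    have := ofReal_integral_norm_eq_lintegral_enorm ((hpi n).sub hGi)
    simp only [Pi.sub_apply] at this
    rw [← this, ENNReal.toReal_ofReal (integral_nonneg fun _ => norm_nonneg _)]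
    simp [Real.norm_eq_abs]
  have hset n (E : Set Ω) : |(u n : Measure Ω).real E - ∫ y in E, G y ∂ν| ≤ dist (F n) G := by
    rw [← hdist, ← Measure.setIntegral_toReal_rnDeriv (hν n),
      ← integral_sub (hpi n).integrableOn hGi.integrableOn]
    exact (abs_integral_le_integral_abs).trans
      (setIntegral_le_integral ((hpi n).sub hGi).abs (ae_of_all _ fun _ => abs_nonneg _))
  have hd0 : Tendsto (fun n => dist (F n) G) atTop (𝓝 0) := tendsto_iff_dist_tendsto_zero.1 hG
  have hlim (E : Set Ω) : Tendsto (fun n => (u n : Measure Ω).real E) atTop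
      (𝓝 (∫ y in E, G y ∂ν)) :=
    tendsto_iff_dist_tendsto_zero.2 (squeeze_zero (fun _ => dist_nonneg) (fun n => hset n E) hd0)
  -- The L¹ limit of the densities is nonnegative because its integrals over sets are limits of
  -- probabilities.
  have hG0 : 0 ≤ᵐ[ν] G := ae_nonneg_of_forall_setIntegral_nonneg hGi fun E _ _ =>
    ge_of_tendsto' (hlim E) fun n => measureReal_nonneg
  set R : Measure Ω := ν.withDensity fun y => ENNReal.ofReal (G y) with hR
  have hRE {E : Set Ω} (hE : MeasurableSet E) : R E = ENNReal.ofReal (∫ y in E, G y ∂ν) := by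
    rw [hR, withDensity_apply _ hE, ofReal_integral_eq_lintegral_ofReal hGi.integrableOn
      (ae_restrict_of_ae hG0)]
  have hRp : IsProbabilityMeasure R := by
    refine ⟨?_⟩
    have h1 : ∫ y in Set.univ, G y ∂ν = 1 := tendsto_nhds_unique (hlim Set.univ) (by simp)
    rw [hRE MeasurableSet.univ, h1, ENNReal.ofReal_one]
  refine ⟨⟨R, hRp⟩, tendsto_iff_dist_tendsto_zero.2 ?_⟩
  have h2 := hd0.const_mul 2
  rw [mul_zero] at h2
  refine squeeze_zero (fun _ => dist_nonneg) (fun n => ?_) h2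
  refine tvDist_le fun E hE => ?_
  have e : (R).real E = ∫ y in E, G y ∂ν := by
    rw [measureReal_def, hRE hE, ENNReal.toReal_ofReal (setIntegral_nonneg_of_ae hG0)]
  change 2 * ((u n : Measure Ω).real E - R.real E) ≤ _
  rw [e]
  linarith [le_abs_self ((u n : Measure Ω).real E - ∫ y in E, G y ∂ν), hset n E]

/-! ### Orders one and infinity; monotonicity and left continuity in the order. -/

theorem ENNReal.rpow_le_rpow_of_nonpos_exponent {x y : ℝ≥0∞} (h : x ≤ y) {s : ℝ} (hs : s ≤ 0) :
    y ^ s ≤ x ^ s := by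
  rw [← neg_neg s, ENNReal.rpow_neg y, ENNReal.rpow_neg x, ENNReal.inv_le_inv]
  exact ENNReal.rpow_le_rpow h (neg_nonneg.2 hs)

theorem EReal.coe_ennreal_le_coe_iff {x : ℝ≥0∞} {c : ℝ} :
    (x : EReal) ≤ (c : EReal) ↔ 0 ≤ c ∧ x ≤ ENNReal.ofReal c := by
  constructor
  · intro h
    have h0 : (0 : EReal) ≤ (c : EReal) := (EReal.coe_ennreal_nonneg x).trans h
    have h0' : 0 ≤ c := EReal.coe_nonneg.1 h0
    refine ⟨h0', ?_⟩
    rw [← EReal.coe_ennreal_le_coe_ennreal_iff, EReal.coe_ennreal_ofReal, max_eq_left h0']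
    exact h
  · rintro ⟨h0, h⟩
    rw [← EReal.coe_ennreal_le_coe_ennreal_iff, EReal.coe_ennreal_ofReal, max_eq_left h0] at h
    exact h

theorem renyiDiv_one_le_iff {W Q : ProbabilityMeasure Ω} {c : ℝ} :
    renyiDiv 1 W Q ≤ c ↔
      0 ≤ c ∧ InformationTheory.klDiv (W : Measure Ω) Q ≤ ENNReal.ofReal c := by
  rw [← EReal.coe_ennreal_le_coe_iff]
  simp [renyiDiv]

theorem renyiDiv_top_le_iff {W Q : ProbabilityMeasure Ω} {c : ℝ} :
    renyiDiv ∞ W Q ≤ c ↔ ∀ᵐ y ∂((W : Measure Ω) + Q),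
      (W : Measure Ω).rnDeriv (W + Q) y ≤
        ENNReal.ofReal (Real.exp c) * (Q : Measure Ω).rnDeriv (W + Q) y := by
  have e : renyiDiv ∞ W Q = ENNReal.log (essSup (fun y => (W : Measure Ω).rnDeriv (W + Q) y /
      (Q : Measure Ω).rnDeriv (W + Q) y) ((W : Measure Ω) + Q)) := by
    simp [renyiDiv]
  rw [e, ENNReal.log_le_coe_iff]
  have h1 : ∀ x q : ℝ≥0∞, q < ∞ → (x / q ≤ ENNReal.ofReal (Real.exp c) ↔
      x ≤ ENNReal.ofReal (Real.exp c) * q) := by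
    intro x q hq
    rcases eq_or_ne q 0 with rfl | h0
    · rcases eq_or_ne x 0 with rfl | hx
      · simp
      · simp [ENNReal.div_zero hx, hx]
    · rw [ENNReal.div_le_iff h0 hq.ne]
  have hq := Measure.rnDeriv_lt_top (Q : Measure Ω) ((W : Measure Ω) + Q)
  constructor
  · intro h
    filter_upwards [ENNReal.ae_le_essSup fun y => (W : Measure Ω).rnDeriv (W + Q) y /
      (Q : Measure Ω).rnDeriv (W + Q) y, hq] with y hy hqy
    exact (h1 _ _ hqy).1 (hy.trans h)
  · intro h
    refine essSup_le_of_ae_le _ ?_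
    filter_upwards [h, hq] with y hy hqy
    exact (h1 _ _ hqy).2 hy

/-- From w ≤ K q follows w^a q^(1-a) = w^(a-1) w q^(1-a) ≤ K^(a-1) w, and w has integral one. -/
theorem powerAffinity_le_of_le_mul {W Q : ProbabilityMeasure Ω} {c : ℝ}
    (h : renyiDiv ∞ W Q ≤ c) {a : ℝ} (ha : 1 < a) :
    powerAffinity a (W : Measure Ω) Q ≤ ENNReal.ofReal (Real.exp ((a - 1) * c)) := by
  rw [renyiDiv_top_le_iff] at h
  set ν := (W : Measure Ω) + Q
  set K := ENNReal.ofReal (Real.exp c)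
  have hW : (W : Measure Ω) ≪ ν := Measure.AbsolutelyContinuous.rfl.add_right _
  have ha1 : 0 < a - 1 := sub_pos.2 ha
  calc powerAffinity a (W : Measure Ω) Q
      ≤ ∫⁻ y, K ^ (a - 1) * (W : Measure Ω).rnDeriv ν y ∂ν := by
        refine lintegral_mono_ae ?_
        filter_upwards [h, Measure.rnDeriv_lt_top (W : Measure Ω) ν,
          Measure.rnDeriv_lt_top (Q : Measure Ω) ν] with y hy hw hq
        set w := (W : Measure Ω).rnDeriv ν y
        set q := (Q : Measure Ω).rnDeriv ν y
        rcases eq_or_ne w 0 with hw0 | hw0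
        · simp [hw0, ENNReal.zero_rpow_of_pos (zero_lt_one.trans ha)]
        have hq0 : q ≠ 0 := by
          intro hq0
          rw [hq0, mul_zero] at hy
          exact hw0 (le_bot_iff.1 hy)
        calc w ^ a * q ^ (1 - a) = w ^ (a - 1) * w * q ^ (1 - a) := by
              congr 1
              nth_rewrite 3 [← ENNReal.rpow_one w]
              rw [← ENNReal.rpow_add _ _ hw0 hw.ne, sub_add_cancel]
          _ ≤ (K * q) ^ (a - 1) * w * q ^ (1 - a) := by gcongr
          _ = K ^ (a - 1) * w * (q ^ (a - 1) * q ^ (1 - a)) := by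
              rw [ENNReal.mul_rpow_of_nonneg _ _ ha1.le]; ring
          _ = K ^ (a - 1) * w := by
              rw [← ENNReal.rpow_add _ _ hq0 hq.ne]; simp
    _ = ENNReal.ofReal (Real.exp ((a - 1) * c)) := by
        rw [lintegral_const_mul _ (Measure.measurable_rnDeriv _ _), Measure.lintegral_rnDeriv hW,
          measure_univ, mul_one, ENNReal.ofReal_exp_rpow, mul_comm]

/-- If w > e^x q on `E` with x > c, then S_a ≥ e^((a-1)x) W(E). Comparison with e^((a-1)c) as a → ∞
forces W(E) = 0. -/
theorem renyiDiv_top_le_of_forall {W Q : ProbabilityMeasure Ω} {c : ℝ}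
    (h : ∀ a : ℝ, 1 < a →
      powerAffinity a (W : Measure Ω) Q ≤ ENNReal.ofReal (Real.exp ((a - 1) * c))) :
    renyiDiv ∞ W Q ≤ c := by
  refine EReal.le_of_forall_lt_iff_le.1 fun x hx => ?_
  replace hx : c < x := EReal.coe_lt_coe_iff.1 hx
  rw [renyiDiv_top_le_iff]
  have hWm := Measure.measurable_rnDeriv (W : Measure Ω) ((W : Measure Ω) + Q)
  have hQm := Measure.measurable_rnDeriv (Q : Measure Ω) ((W : Measure Ω) + Q)
  set ν := (W : Measure Ω) + Q with hν
  set K := ENNReal.ofReal (Real.exp x) with hK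
  have hK0 : K ≠ 0 := (ENNReal.ofReal_pos.2 (Real.exp_pos x)).ne'
  have hKt : K ≠ ∞ := ENNReal.ofReal_ne_top
  have hW : (W : Measure Ω) ≪ ν := Measure.AbsolutelyContinuous.rfl.add_right _
  set E : Set Ω := {y | K * (Q : Measure Ω).rnDeriv ν y < (W : Measure Ω).rnDeriv ν y} with hE
  have hEm : MeasurableSet E := measurableSet_lt (hQm.const_mul K) hWm
  have hbound (a : ℝ) (ha : 1 < a) : K ^ (a - 1) * (W : Measure Ω) E ≤
      ENNReal.ofReal (Real.exp ((a - 1) * c)) := by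
    refine le_trans ?_ (h a ha)
    have ha1 : 1 - a ≤ 0 := by linarith
    calc K ^ (a - 1) * (W : Measure Ω) E
        = ∫⁻ y in E, K ^ (a - 1) * (W : Measure Ω).rnDeriv ν y ∂ν := by
          rw [lintegral_const_mul _ hWm, Measure.setLIntegral_rnDeriv hW]
      _ ≤ ∫⁻ y in E, (W : Measure Ω).rnDeriv ν y ^ a * (Q : Measure Ω).rnDeriv ν y ^ (1 - a) ∂ν := by
          refine lintegral_mono_ae ?_
          filter_upwards [ae_restrict_mem hEm, ae_restrict_of_ae
            (Measure.rnDeriv_lt_top (W : Measure Ω) ν)] with y hy hw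
          replace hy : K * (Q : Measure Ω).rnDeriv ν y < (W : Measure Ω).rnDeriv ν y := hy
          set w := (W : Measure Ω).rnDeriv ν y
          set q := (Q : Measure Ω).rnDeriv ν y
          have hw0 : w ≠ 0 := hy.bot_lt.ne'
          calc K ^ (a - 1) * w = K ^ (a - 1) * (w ^ a * w ^ (1 - a)) := by
                rw [← ENNReal.rpow_add _ _ hw0 hw.ne]; simp
            _ ≤ K ^ (a - 1) * (w ^ a * (K * q) ^ (1 - a)) := by
                have := ENNReal.rpow_le_rpow_of_nonpos_exponent hy.le ha1
                exact mul_le_mul_right (mul_le_mul_right this _) _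
            _ = K ^ (a - 1) * K ^ (1 - a) * (w ^ a * q ^ (1 - a)) := by
                rw [ENNReal.mul_rpow_of_ne_zero_of_ne_top hK0 hKt]; ring
            _ = w ^ a * q ^ (1 - a) := by
                rw [← ENNReal.rpow_add _ _ hK0 hKt]; simp
      _ ≤ powerAffinity a (W : Measure Ω) Q := setLIntegral_le_lintegral _ _
  have hWE : (W : Measure Ω) E = 0 := by
    have hlim : Tendsto (fun n : ℕ => ENNReal.ofReal (Real.exp ((n + 1 : ℝ) * (c - x)))) atTop
        (𝓝 0) := by
      rw [← ENNReal.ofReal_zero]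
      refine ENNReal.tendsto_ofReal (Real.tendsto_exp_atBot.comp ?_)
      exact (tendsto_natCast_atTop_atTop.atTop_add tendsto_const_nhds).atTop_mul_const_of_neg
        (sub_neg.2 hx)
    refine le_bot_iff.1 (ge_of_tendsto' hlim fun n => ?_)
    have hb := hbound (n + 2) (by linarith [(Nat.cast_nonneg n : (0 : ℝ) ≤ n)])
    rw [show (n : ℝ) + 2 - 1 = n + 1 by ring, hK, ENNReal.ofReal_exp_rpow] at hb
    calc (W : Measure Ω) E = ENNReal.ofReal (Real.exp (-(x * (n + 1)))) *
          (ENNReal.ofReal (Real.exp (x * (n + 1))) * (W : Measure Ω) E) := by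
          rw [← mul_assoc, ← ENNReal.ofReal_mul (Real.exp_pos _).le, ← Real.exp_add]
          simp
      _ ≤ ENNReal.ofReal (Real.exp (-(x * (n + 1)))) *
          ENNReal.ofReal (Real.exp ((n + 1) * c)) := by gcongr
      _ = _ := by
          rw [← ENNReal.ofReal_mul (Real.exp_pos _).le, ← Real.exp_add]
          congr 2; ring
  -- A `W`-null set is `ν`-null here because the density of `W` is positive on `E`.
  have hνE : ν E = 0 := by
    rw [← Measure.setLIntegral_rnDeriv hW, lintegral_eq_zero_iff hWm] at hWE
    by_contra hne
    have : (ae (ν.restrict E)).NeBot := by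
      rw [ae_neBot, Ne, Measure.restrict_eq_zero]; exact hne
    obtain ⟨y, hy, hyE⟩ := (hWE.and (ae_restrict_mem hEm)).exists
    replace hyE : K * (Q : Measure Ω).rnDeriv ν y < (W : Measure Ω).rnDeriv ν y := hyE
    rw [hy] at hyE
    exact not_lt_bot hyE
  have : ∀ᵐ y ∂ν, y ∉ E := measure_eq_zero_iff_ae_notMem.1 hνE
  filter_upwards [this] with y hy
  exact not_lt.1 hy

/-- Fatou's lemma in the order variable. At points with q = 0 < w the integrand is infinite at every
order above one, so orders `a n > 1` lose nothing there. -/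
theorem powerAffinity_le_of_forall_nat {γ : ℝ} {a : ℕ → ℝ} (ha1 : ∀ n, 1 < a n) (hγ : 1 < γ)
    (ha : Tendsto a atTop (𝓝 γ)) {W Q : ProbabilityMeasure Ω} {t : ℕ → ℝ≥0∞} {t₀ : ℝ≥0∞}
    (ht : Tendsto t atTop (𝓝 t₀)) (h : ∀ n, powerAffinity (a n) (W : Measure Ω) Q ≤ t n) :
    powerAffinity γ (W : Measure Ω) Q ≤ t₀ := by
  have hWm := Measure.measurable_rnDeriv (W : Measure Ω) ((W : Measure Ω) + Q)
  have hQm := Measure.measurable_rnDeriv (Q : Measure Ω) ((W : Measure Ω) + Q)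
  set ν : Measure Ω := (W : Measure Ω) + Q with hν
  calc powerAffinity γ (W : Measure Ω) Q
      ≤ ∫⁻ y, liminf (fun n => (W : Measure Ω).rnDeriv ν y ^ a n *
          (Q : Measure Ω).rnDeriv ν y ^ (1 - a n)) atTop ∂ν := by
        refine lintegral_mono_ae ?_
        filter_upwards [Measure.rnDeriv_lt_top (W : Measure Ω) ν,
          Measure.rnDeriv_lt_top (Q : Measure Ω) ν] with y hw hq
        set w := (W : Measure Ω).rnDeriv ν y
        set q := (Q : Measure Ω).rnDeriv ν y
        have hconst {x : ℝ≥0∞} (hx : x ≠ 0) (hxt : x ≠ ∞) {b : ℕ → ℝ} {b₀ : ℝ}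
            (hb : Tendsto b atTop (𝓝 b₀)) : Tendsto (fun n => x ^ b n) atTop (𝓝 (x ^ b₀)) := by
          have hx0 : 0 < x.toReal := ENNReal.toReal_pos hx hxt
          rw [← ENNReal.ofReal_toReal hxt]
          simp only [ENNReal.ofReal_rpow_of_pos hx0]
          exact ENNReal.tendsto_ofReal
            (((Real.continuous_const_rpow hx0.ne').tendsto _).comp hb)
        rcases eq_or_ne w 0 with hw0 | hw0
        · simp [hw0, ENNReal.zero_rpow_of_pos (zero_lt_one.trans hγ)]
        rcases eq_or_ne q 0 with hq0 | hq0
        · have e n : w ^ a n * q ^ (1 - a n) = ∞ := by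
            rw [hq0, ENNReal.zero_rpow_of_neg (sub_neg.2 (ha1 n)), ENNReal.mul_top]
            exact (ENNReal.rpow_pos (pos_iff_ne_zero.2 hw0) hw.ne).ne'
          simp [e]
        · have h1 := hconst hw0 hw.ne ha
          have h2 := hconst hq0 hq.ne (ha.const_sub 1)
          refine (ENNReal.Tendsto.mul h1 (Or.inl ?_) h2 (Or.inl ?_)).liminf_eq.ge
          · exact (ENNReal.rpow_pos (pos_iff_ne_zero.2 hw0) hw.ne).ne'
          · exact (ENNReal.rpow_pos (pos_iff_ne_zero.2 hq0) hq.ne).ne'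
    _ ≤ liminf (fun n => powerAffinity (a n) (W : Measure Ω) Q) atTop :=
        lintegral_liminf_le fun n => (hWm.pow_const _).mul (hQm.pow_const _)
    _ ≤ liminf t atTop := liminf_le_liminf (Eventually.of_forall h)
    _ = t₀ := ht.liminf_eq

theorem powerAffinity_eq_lintegral_rnDeriv {W Q : ProbabilityMeasure Ω}
    (hac : (W : Measure Ω) ≪ Q) {a : ℝ} (ha : 0 ≤ a) :
    powerAffinity a (W : Measure Ω) Q = ∫⁻ y, (W : Measure Ω).rnDeriv Q y ^ a ∂(Q : Measure Ω) := by
  rw [powerAffinity_eq_lintegral (ν := (Q : Measure Ω)) (g := 1)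
    (Measure.measurable_rnDeriv _ _) measurable_one
    (Measure.withDensity_rnDeriv_eq _ _ hac).symm withDensity_one.symm ha]
  simp

theorem integral_rnDeriv_rpow {W Q : ProbabilityMeasure Ω} (hac : (W : Measure Ω) ≪ Q) {a : ℝ}
    (ha : 0 < a) (ha1 : a < 1) :
    Integrable (fun y => ((W : Measure Ω).rnDeriv Q y).toReal ^ a) (Q : Measure Ω) ∧
      ∫ y, ((W : Measure Ω).rnDeriv Q y).toReal ^ a ∂(Q : Measure Ω) =
        (powerAffinity a (W : Measure Ω) Q).toReal := by
  have hm := (Measure.measurable_rnDeriv (W : Measure Ω) Q).pow_const a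
  have hS := powerAffinity_eq_lintegral_rnDeriv hac ha.le
  have hfin : ∫⁻ y, (W : Measure Ω).rnDeriv Q y ^ a ∂(Q : Measure Ω) ≠ ∞ := by
    rw [← hS]; exact ((powerAffinity_le_one W Q ha ha1).trans_lt ENNReal.one_lt_top).ne
  simp only [ENNReal.toReal_rpow]
  exact ⟨integrable_toReal_of_lintegral_ne_top hm.aemeasurable hfin, by
    rw [integral_toReal hm.aemeasurable (ae_lt_top hm hfin), hS]⟩

open InformationTheory in
theorem exp_le_powerAffinity_of_klDiv_le {W Q : ProbabilityMeasure Ω} {c : ℝ}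
    (h : renyiDiv 1 W Q ≤ c) {a : ℝ} (ha : 0 < a) (ha1 : a < 1) :
    ENNReal.ofReal (Real.exp ((a - 1) * c)) ≤ powerAffinity a (W : Measure Ω) Q := by
  rw [renyiDiv_one_le_iff] at h
  obtain ⟨hc, h⟩ := h
  have hne : klDiv (W : Measure Ω) Q ≠ ∞ := (h.trans_lt ENNReal.ofReal_lt_top).ne
  obtain ⟨hac, hint⟩ := klDiv_ne_top_iff.1 hne
  set r : Ω → ℝ := fun y => ((W : Measure Ω).rnDeriv Q y).toReal with hr
  set K := (klDiv (W : Measure Ω) Q).toReal with hK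
  have hKc : K ≤ c := ENNReal.toReal_le_of_le_ofReal hc h
  have hri : Integrable r (Q : Measure Ω) := Measure.integrable_toReal_rnDeriv
  have hr1 : ∫ y, r y ∂(Q : Measure Ω) = 1 := by
    rw [hr, Measure.integral_toReal_rnDeriv hac]; simp
  have hki : Integrable (fun y => klFun (r y)) (Q : Measure Ω) :=
    (integrable_klFun_rnDeriv_iff hac).2 hint
  have hk1 : ∫ y, klFun (r y) ∂(Q : Measure Ω) = K := (toReal_klDiv_eq_integral_klFun hac).symm
  obtain ⟨hai, ha2⟩ := integral_rnDeriv_rpow hac ha ha1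
  have hr0 y : 0 ≤ r y := ENNReal.toReal_nonneg
  -- The tangent line bound e^z ≥ 1 + z with z = (1-a)(K - ln r), multiplied by r e^(-(1-a)K). The
  -- correction integrates to zero because ∫ r ln r = K; it is written through `klFun r = r ln r + 1
  -- - r`, whose integral is known.
  have hpt (y : Ω) : Real.exp (-(1 - a) * K) * (((a + (1 - a) * K) * r y +
      (a - 1) * klFun (r y)) + (1 - a)) ≤ r y ^ a := by
    rcases (hr0 y).eq_or_lt with h0 | h0
    · rw [← h0, klFun_zero, Real.zero_rpow ha.ne']; simp
    · have e : r y ^ a = Real.exp (-(1 - a) * K) * (r y * Real.exp ((1 - a) * (K - Real.log (r y)))) := by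
        rw [Real.rpow_def_of_pos h0]
        nth_rewrite 2 [← Real.exp_log h0]
        rw [← Real.exp_add, ← Real.exp_add]
        congr 1; ring
      rw [e]
      refine mul_le_mul_of_nonneg_left ?_ (Real.exp_pos _).le
      have h3 := mul_le_mul_of_nonneg_left
        (Real.add_one_le_exp ((1 - a) * (K - Real.log (r y)))) h0.le
      refine le_trans (le_of_eq ?_) h3
      rw [klFun_apply]; ring
  have i1 : Integrable (fun y => (a + (1 - a) * K) * r y) (Q : Measure Ω) := hri.const_mul _
  have i2 : Integrable (fun y => (a - 1) * klFun (r y)) (Q : Measure Ω) := hki.const_mul _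
  have i3 : Integrable (fun y => (a + (1 - a) * K) * r y + (a - 1) * klFun (r y))
    (Q : Measure Ω) := i1.add i2
  have key := integral_mono ((i3.add (integrable_const (1 - a))).const_mul
    (Real.exp (-(1 - a) * K))) hai hpt
  rw [ha2] at key
  have e2 : ∫ y, Real.exp (-(1 - a) * K) * ((a + (1 - a) * K) * r y +
      (a - 1) * klFun (r y) + (1 - a)) ∂(Q : Measure Ω) = Real.exp (-(1 - a) * K) := by
    rw [integral_const_mul, integral_add i3 (integrable_const _), integral_add i1 i2, integral_const_mul,
      integral_const_mul, hr1, hk1]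
    simp
    ring
  replace key := e2.symm.le.trans key
  refine ENNReal.ofReal_le_of_le_toReal (le_trans (Real.exp_le_exp.2 ?_) key)
  nlinarith

open InformationTheory in
-- With s = 1 - a → 0, the nonnegative quotients ((1-s)r + s - r^(1-s))/s converge to `klFun r` and
-- have integral (1 - S_(1-s))/s ≤ c, so Fatou bounds the Kullback-Leibler divergence. Absolute
-- continuity comes first: if Q(E) = 0 < W(E), the two-cell bound keeps affinities of order near one
-- away from 1, against the hypothesis.
theorem renyiDiv_one_le_of_forall {W Q : ProbabilityMeasure Ω} {c : ℝ}
    (h : ∀ a : ℝ, 0 < a → a < 1 →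
      ENNReal.ofReal (Real.exp ((a - 1) * c)) ≤ powerAffinity a (W : Measure Ω) Q) :
    renyiDiv 1 W Q ≤ c := by
  have hc : 0 ≤ c := by
    have h1 := (h (1 / 2) (by norm_num) (by norm_num)).trans
      (powerAffinity_le_one W Q (by norm_num) (by norm_num))
    rw [ENNReal.ofReal_le_one, Real.exp_le_one_iff] at h1
    linarith
  -- The second `+ 1` keeps `s n` strictly below one.
  set s : ℕ → ℝ := fun n => 1 / ((n : ℝ) + 1 + 1) with hs
  have hs0 n : 0 < s n := by positivity
  have hs1 n : s n < 1 := by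
    rw [hs]; simp only; rw [div_lt_one (by positivity)]
    linarith [(Nat.cast_nonneg n : (0 : ℝ) ≤ n)]
  have hslim : Tendsto s atTop (𝓝 0) := by
    have := (tendsto_add_atTop_iff_nat 1).2 (tendsto_one_div_add_atTop_nhds_zero_nat (𝕜 := ℝ))
    simpa [hs] using this
  have hac : (W : Measure Ω) ≪ Q := by
    refine Measure.AbsolutelyContinuous.mk fun E hE hQE => ?_
    by_contra hWE
    have hlt : (W : Measure Ω) Eᶜ < 1 := by
      rw [prob_compl_eq_one_sub hE]
      exact ENNReal.sub_lt_self ENNReal.one_ne_top one_ne_zero hWE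
    have hb n : ENNReal.ofReal (Real.exp (-(s n / 2) * c)) ≤ (W : Measure Ω) Eᶜ ^ (1 / 2 : ℝ) := by
      have hn0 := hs0 n
      have hn1 := hs1 n
      have h1 := (h (1 - s n / 2) (by linarith) (by linarith)).trans
        (powerAffinity_le_partition hE (by linarith) (by linarith))
      rw [hQE, ENNReal.zero_rpow_of_pos (by linarith), mul_zero, zero_add,
        show 1 - s n / 2 - 1 = -(s n / 2) by ring] at h1
      refine h1.trans ?_
      calc _ ≤ (W : Measure Ω) Eᶜ ^ (1 - s n / 2) * 1 := by
            gcongr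
            exact ENNReal.rpow_le_one prob_le_one (by linarith)
        _ ≤ _ := by
            rw [mul_one]
            exact ENNReal.rpow_le_rpow_of_exponent_ge hlt.le (by linarith)
    have hl : Tendsto (fun n => ENNReal.ofReal (Real.exp (-(s n / 2) * c))) atTop (𝓝 1) := by
      have h2 := (Real.continuous_exp.tendsto _).comp (((hslim.div_const 2).neg).mul_const c)
      have h3 := ENNReal.tendsto_ofReal h2
      simpa [Function.comp_def] using h3
    exact absurd (le_of_tendsto' hl hb) (not_le.2 (ENNReal.rpow_lt_one hlt (by norm_num)))
  rw [renyiDiv_one_le_iff]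
  refine ⟨hc, ?_⟩
  rw [klDiv_eq_lintegral_klFun_of_ac hac]
  set r : Ω → ℝ := fun y => ((W : Measure Ω).rnDeriv Q y).toReal with hr
  have hri : Integrable r (Q : Measure Ω) := Measure.integrable_toReal_rnDeriv
  have hrm : Measurable r := (Measure.measurable_rnDeriv _ _).ennreal_toReal
  have hr1 : ∫ y, r y ∂(Q : Measure Ω) = 1 := by
    rw [hr, Measure.integral_toReal_rnDeriv hac]; simp
  set g : ℕ → Ω → ℝ := fun n y => ((1 - s n) * r y + s n - r y ^ (1 - s n)) / s n with hg
  have hr0 y : 0 ≤ r y := ENNReal.toReal_nonneg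
  have hg0 n y : 0 ≤ g n y := by
    have := Real.geom_mean_le_arith_mean2_weighted (sub_pos.2 (hs1 n)).le (hs0 n).le (hr0 y)
      zero_le_one (sub_add_cancel _ _)
    rw [Real.one_rpow, mul_one, mul_one] at this
    exact div_nonneg (by linarith) (hs0 n).le
  have hglim y : Tendsto (fun n => g n y) atTop (𝓝 (klFun (r y))) := by
    have hne : Tendsto s atTop (𝓝[≠] 0) :=
      tendsto_nhdsWithin_iff.2 ⟨hslim, Eventually.of_forall fun n => (hs0 n).ne'⟩
    rcases (hr0 y).eq_or_lt with h0 | h0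
    · have e n : g n y = 1 := by
        simp only [hg, ← h0]
        rw [Real.zero_rpow (sub_pos.2 (hs1 n)).ne']
        simp [(hs0 n).ne']
      simp [e, ← h0, klFun_zero]
    -- The quotient is the difference quotient at zero of a function vanishing there, so its limit
    -- is the derivative.
    · have hd : HasDerivAt (fun t : ℝ => (1 - t) * r y + t - r y ^ (1 - t)) (klFun (r y)) 0 := by
        have h1 : HasDerivAt (fun t : ℝ => 1 - t) (-1) 0 := by
          simpa using (hasDerivAt_id (0 : ℝ)).const_sub 1
        have h2 := h1.const_rpow h0
        have h3 := ((h1.mul_const (r y)).add (hasDerivAt_id 0)).sub h2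
        refine HasDerivAt.congr_deriv h3 ?_
        rw [klFun_apply, sub_zero, Real.rpow_one]
        ring
      have h4 := (hasDerivAt_iff_tendsto_slope_zero.1 hd).comp hne
      refine h4.congr fun n => ?_
      simp [hg]
      ring
  have hgi n : ∫⁻ y, ENNReal.ofReal (g n y) ∂(Q : Measure Ω) ≤ ENNReal.ofReal c := by
    have ha0 : 0 < 1 - s n := sub_pos.2 (hs1 n)
    have ha1 : 1 - s n < 1 := by linarith [hs0 n]
    obtain ⟨hai, ha2⟩ := integral_rnDeriv_rpow hac ha0 ha1
    have i1 : Integrable (fun y => (1 - s n) * r y + s n) (Q : Measure Ω) :=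
      (hri.const_mul _).add (integrable_const _)
    have hgint : Integrable (g n) (Q : Measure Ω) := (i1.sub hai).div_const _
    rw [← ofReal_integral_eq_lintegral_ofReal hgint (ae_of_all _ (hg0 n))]
    refine ENNReal.ofReal_le_ofReal ?_
    have e : ∫ y, g n y ∂(Q : Measure Ω) =
        (1 - (powerAffinity (1 - s n) (W : Measure Ω) Q).toReal) / s n := by
      rw [hg, integral_div, integral_sub i1 hai, ha2, integral_add (hri.const_mul _)
        (integrable_const _), integral_const_mul, hr1]
      simp
    rw [e, div_le_iff₀ (hs0 n)]
    have h1 := h _ ha0 ha1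
    rw [ENNReal.ofReal_le_iff_le_toReal ((powerAffinity_le_one W Q ha0 ha1).trans_lt
      ENNReal.one_lt_top).ne] at h1
    have h2 := Real.add_one_le_exp ((1 - s n - 1) * c)
    linarith
  calc ∫⁻ y, ENNReal.ofReal (klFun (r y)) ∂(Q : Measure Ω)
      = ∫⁻ y, liminf (fun n => ENNReal.ofReal (g n y)) atTop ∂(Q : Measure Ω) :=
        lintegral_congr fun y => ((ENNReal.tendsto_ofReal (hglim y)).liminf_eq).symm
    _ ≤ liminf (fun n => ∫⁻ y, ENNReal.ofReal (g n y) ∂(Q : Measure Ω)) atTop :=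
        lintegral_liminf_le fun n => by
          refine Measurable.ennreal_ofReal ?_
          simp only [hg]
          fun_prop
    _ ≤ liminf (fun _ : ℕ => ENNReal.ofReal c) atTop :=
        liminf_le_liminf (Eventually.of_forall hgi)
    _ = ENNReal.ofReal c := by simp

theorem renyiDiv_le_of_le_of_le {α β : ℝ≥0∞} (h0 : 0 < α) (hαβ : α ≤ β)
    {W Q : ProbabilityMeasure Ω} {c : ℝ} (h : renyiDiv β W Q ≤ c) : renyiDiv α W Q ≤ c := by
  have to_one {β : ℝ≥0∞} (hβ1 : 1 < β) (hβ : β ≠ ∞) (h : renyiDiv β W Q ≤ c) :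
      renyiDiv 1 W Q ≤ c := by
    refine renyiDiv_one_le_of_forall fun a ha ha1 => ?_
    have hlt : ENNReal.ofReal a < 1 := by
      rw [← ENNReal.ofReal_one]; exact (ENNReal.ofReal_lt_ofReal_iff one_pos).2 ha1
    have := renyiDiv_le_of_le_of_lt (ENNReal.ofReal_pos.2 ha) (hlt.trans hβ1) hβ hlt.ne hβ1.ne' h
    rwa [renyiDiv_le_iff_of_lt_one (ENNReal.ofReal_pos.2 ha) hlt, ENNReal.toReal_ofReal ha.le]
      at this
  have finite {α β : ℝ≥0∞} (h0 : 0 < α) (hαβ : α < β) (hβ : β ≠ ∞) (h : renyiDiv β W Q ≤ c) :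
      renyiDiv α W Q ≤ c := by
    have hαt := (hαβ.trans_le le_top).ne
    rcases eq_or_ne β 1 with rfl | hβ1
    · rw [renyiDiv_le_iff_of_lt_one h0 hαβ]
      exact exp_le_powerAffinity_of_klDiv_le h (ENNReal.toReal_pos h0.ne' hαt)
        (by simpa using (ENNReal.toReal_lt_toReal hαt hβ).2 hαβ)
    rcases eq_or_ne α 1 with rfl | hα1
    · exact to_one hαβ hβ h
    · exact renyiDiv_le_of_le_of_lt h0 hαβ hβ hα1 hβ1 h
  have from_top {α : ℝ≥0∞} (h1 : 1 < α) (hα : α ≠ ∞) (h : renyiDiv ∞ W Q ≤ c) :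
      renyiDiv α W Q ≤ c := by
    rw [renyiDiv_le_iff_of_one_lt h1 hα]
    exact powerAffinity_le_of_le_mul h
      (by simpa using (ENNReal.toReal_lt_toReal ENNReal.one_ne_top hα).2 h1)
  rcases hαβ.eq_or_lt with rfl | hlt
  · exact h
  rcases eq_or_ne β ∞ with rfl | hβ
  · rcases lt_or_ge 1 α with h1 | h1
    · exact from_top h1 hlt.ne h
    · exact finite h0 (h1.trans_lt ENNReal.one_lt_two) ENNReal.ofNat_ne_top
        (from_top ENNReal.one_lt_two ENNReal.ofNat_ne_top h)
  · exact finite h0 hlt hβ h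

theorem exists_seq_tendsto_of_lt {γ x : ℝ≥0∞} (hx : x < γ) :
    ∃ α : ℕ → ℝ≥0∞, (∀ n, x < α n ∧ α n < γ) ∧ Tendsto α atTop (𝓝 γ) := by
  obtain ⟨α, -, hα, hlim⟩ := exists_seq_strictMono_tendsto' hx
  exact ⟨α, hα, hlim⟩

/-- The Rényi divergence is left-continuous in the order. -/
theorem renyiDiv_le_of_forall_lt {γ : ℝ≥0∞} (h0 : 0 < γ) {W Q : ProbabilityMeasure Ω} {c : ℝ}
    (h : ∀ α : ℝ≥0∞, 0 < α → α < γ → α ≠ 1 → renyiDiv α W Q ≤ c) : renyiDiv γ W Q ≤ c := by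
  rcases eq_or_ne γ ∞ with rfl | ht
  · refine renyiDiv_top_le_of_forall fun a ha => ?_
    have h1 : 1 < ENNReal.ofReal a := by
      rw [← ENNReal.ofReal_one]
      exact (ENNReal.ofReal_lt_ofReal_iff (zero_lt_one.trans ha)).2 ha
    have := h _ (zero_lt_one.trans h1) ENNReal.ofReal_lt_top h1.ne'
    rwa [renyiDiv_le_iff_of_one_lt h1 ENNReal.ofReal_ne_top,
      ENNReal.toReal_ofReal (zero_lt_one.trans ha).le] at this
  rcases lt_trichotomy γ 1 with h1 | rfl | h1
  · obtain ⟨α, hα, hlim⟩ := exists_seq_tendsto_of_lt h0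
    have hαt n : α n ≠ ∞ := ((hα n).2.trans_le le_top).ne
    have hreal : Tendsto (fun n => (α n).toReal) atTop (𝓝 γ.toReal) :=
      (ENNReal.tendsto_toReal ht).comp hlim
    have hg : 0 < γ.toReal := ENNReal.toReal_pos h0.ne' ht
    have hg1 : γ.toReal < 1 := by simpa using (ENNReal.toReal_lt_toReal ht ENNReal.one_ne_top).2 h1
    have hne : γ.toReal * (1 - γ.toReal) ≠ 0 := (mul_pos hg (sub_pos.2 hg1)).ne'
    -- Below order one, D_γ is at most this ratio times any bound for D_α, and the ratio tends to
    -- one.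
    have hl : Tendsto (fun n => γ.toReal * (1 - (α n).toReal) /
        ((α n).toReal * (1 - γ.toReal)) * c) atTop (𝓝 (γ.toReal * (1 - γ.toReal) /
        (γ.toReal * (1 - γ.toReal)) * c)) :=
      (((hreal.const_sub 1).const_mul _).div (hreal.mul_const _) hne).mul_const c
    rw [div_self hne, one_mul] at hl
    refine ge_of_tendsto' ((continuous_coe_real_ereal.tendsto _).comp hl) fun n => ?_
    exact renyiDiv_le_ratio_mul (hα n).1 (hα n).2 h1
      (h _ (hα n).1 (hα n).2 ((hα n).2.trans h1).ne)
  · refine renyiDiv_one_le_of_forall fun a ha ha1 => ?_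
    have hlt : ENNReal.ofReal a < 1 := by
      rw [← ENNReal.ofReal_one]; exact (ENNReal.ofReal_lt_ofReal_iff one_pos).2 ha1
    have := h _ (ENNReal.ofReal_pos.2 ha) hlt hlt.ne
    rwa [renyiDiv_le_iff_of_lt_one (ENNReal.ofReal_pos.2 ha) hlt, ENNReal.toReal_ofReal ha.le]
      at this
  · obtain ⟨α, hα, hlim⟩ := exists_seq_tendsto_of_lt h1
    have hαt n : α n ≠ ∞ := ((hα n).2.trans_le le_top).ne
    have hreal : Tendsto (fun n => (α n).toReal) atTop (𝓝 γ.toReal) :=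
      (ENNReal.tendsto_toReal ht).comp hlim
    rw [renyiDiv_le_iff_of_one_lt h1 ht]
    refine powerAffinity_le_of_forall_nat (a := fun n => (α n).toReal) (fun n => ?_) ?_ hreal
      (ENNReal.tendsto_ofReal ((Real.continuous_exp.tendsto _).comp
        ((hreal.sub_const 1).mul_const c))) fun n => ?_
    · simpa using (ENNReal.toReal_lt_toReal ENNReal.one_ne_top (hαt n)).2 (hα n).1
    · simpa using (ENNReal.toReal_lt_toReal ENNReal.one_ne_top ht).2 h1
    · exact (renyiDiv_le_iff_of_one_lt (hα n).1 (hαt n) _ _ _).1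
        (h _ (zero_lt_one.trans (hα n).1) (hα n).2 (hα n).1.ne')

theorem eq_of_renyiDiv_le_zero {α : ℝ≥0∞} (h0 : 0 < α) {P Q : ProbabilityMeasure Ω}
    (h : renyiDiv α P Q ≤ (0 : ℝ)) : P = Q := by
  obtain ⟨β, hβ0, hβ⟩ := exists_between (lt_min h0 zero_lt_one)
  have hβ1 := hβ.trans_le (min_le_right _ _)
  have hβ' := renyiDiv_le_of_le_of_le hβ0 (hβ.trans_le (min_le_left _ _)).le h
  refine (tvMetricSpace Ω).eq_of_dist_eq_zero (le_antisymm (le_of_forall_pos_le_add fun η hη => ?_)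
    (tvDist_nonneg P Q))
  obtain ⟨δ, hδ, hP⟩ := exists_tvDist_le_of_renyiDiv_le (Ω := Ω) hβ0 hη
  rw [zero_add]
  exact hP β le_rfl hβ1.ne (hβ1.trans ENNReal.one_lt_top).ne P Q
    (hβ'.trans (EReal.coe_le_coe_iff.2 hδ.le))

/-! ### Finitely supported priors, mixtures and mean measures. -/

theorem PMF.tsum_mul_eq_sum {X : Type*} {P : PMF X} (hs : P.support.Finite) (f : X → ℝ≥0∞) :
    ∑' x, P x * f x = ∑ x ∈ hs.toFinset, P x * f x :=
  tsum_eq_sum fun x hx => by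
    rw [Set.Finite.mem_toFinset, PMF.mem_support_iff, not_not] at hx
    simp [hx]

theorem PMF.sum_toFinset_eq_one {X : Type*} {P : PMF X} (hs : P.support.Finite) :
    ∑ x ∈ hs.toFinset, P x = 1 := by
  simpa using (PMF.tsum_mul_eq_sum hs fun _ => 1).symm.trans (by simp [P.tsum_coe])

theorem PMF.sum_toReal_eq_one {X : Type*} {P : PMF X} (hs : P.support.Finite) :
    ∑ x ∈ hs.toFinset, (P x).toReal = 1 := by
  rw [← ENNReal.toReal_sum fun x _ => P.apply_ne_top x, PMF.sum_toFinset_eq_one hs,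
    ENNReal.toReal_one]

theorem mixture_apply (P : PMF (ProbabilityMeasure Ω)) {E : Set Ω} (hE : MeasurableSet E) :
    mixture P E = ∑' W, P W * (W : Measure Ω) E := by
  simp [mixture, Measure.sum_apply _ hE]

theorem mixture_eq_sum {P : PMF (ProbabilityMeasure Ω)} (hs : P.support.Finite) :
    mixture P = ∑ W ∈ hs.toFinset, P W • (W : Measure Ω) := by
  ext E hE
  rw [mixture_apply P hE, PMF.tsum_mul_eq_sum hs, Measure.finsetSum_apply]
  simp

instance mixture_isProbabilityMeasure (P : PMF (ProbabilityMeasure Ω)) :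
    IsProbabilityMeasure (mixture P) :=
  ⟨by rw [mixture_apply P MeasurableSet.univ]; simp [P.tsum_coe]⟩

theorem absolutelyContinuous_mixture {P : PMF (ProbabilityMeasure Ω)} {W : ProbabilityMeasure Ω}
    (hW : W ∈ P.support) : (W : Measure Ω) ≪ mixture P := by
  refine Measure.AbsolutelyContinuous.mk fun E hE h => ?_
  rw [mixture_apply P hE, ENNReal.tsum_eq_zero] at h
  exact (mul_eq_zero.1 (h W)).resolve_left ((P.mem_support_iff W).1 hW)

/-- The posterior weights sum to one, so each density is bounded by 1/P(W). All finiteness and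
integrability statements for a fixed prior rest on this. -/
theorem sum_mul_rnDeriv_mixture {P : PMF (ProbabilityMeasure Ω)} (hs : P.support.Finite) :
    ∀ᵐ y ∂(mixture P),
      ∑ W ∈ hs.toFinset, P W * (W : Measure Ω).rnDeriv (mixture P) y = 1 := by
  have hm (W : ProbabilityMeasure Ω) := Measure.measurable_rnDeriv (W : Measure Ω) (mixture P)
  refine ae_eq_of_forall_setLIntegral_eq_of_sigmaFinite (by fun_prop) measurable_const
    fun E hE _ => ?_
  rw [lintegral_finsetSum _ fun W _ => (hm W).const_mul _]
  simp only [lintegral_const, Measure.restrict_apply_univ, one_mul]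
  rw [mixture_apply P hE, PMF.tsum_mul_eq_sum hs]
  refine Finset.sum_congr rfl fun W hW => ?_
  rw [lintegral_const_mul _ (hm W), Measure.setLIntegral_rnDeriv
    (absolutelyContinuous_mixture (hs.mem_toFinset.1 hW))]

theorem mul_rnDeriv_mixture_le_one {P : PMF (ProbabilityMeasure Ω)} (hs : P.support.Finite) :
    ∀ᵐ y ∂(mixture P), ∀ W ∈ hs.toFinset, P W * (W : Measure Ω).rnDeriv (mixture P) y ≤ 1 := by
  filter_upwards [sum_mul_rnDeriv_mixture hs] with y hy W hW
  rw [← hy]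
  exact Finset.single_le_sum (f := fun W => P W * (W : Measure Ω).rnDeriv (mixture P) y)
    (fun _ _ => zero_le) hW

theorem meanDensity_eq {P : PMF (ProbabilityMeasure Ω)} (hs : P.support.Finite) {α : ℝ≥0∞}
    (h0 : α ≠ 0) (ht : α ≠ ∞) (y : Ω) : meanDensity α P y = (∑ W ∈ hs.toFinset,
      P W * (W : Measure Ω).rnDeriv (mixture P) y ^ α.toReal) ^ (1 / α.toReal) := by
  rw [meanDensity, if_neg h0, if_neg ht, PMF.tsum_mul_eq_sum hs]

theorem measurable_meanDensity {P : PMF (ProbabilityMeasure Ω)} (hs : P.support.Finite)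
    {α : ℝ≥0∞} (h0 : α ≠ 0) (ht : α ≠ ∞) : Measurable (meanDensity α P) := by
  have hm (W : ProbabilityMeasure Ω) := Measure.measurable_rnDeriv (W : Measure Ω) (mixture P)
  rw [funext (meanDensity_eq hs h0 ht)]
  fun_prop

theorem meanMeasure_univ (α : ℝ≥0∞) (P : PMF (ProbabilityMeasure Ω)) :
    meanMeasure α P Set.univ = ∫⁻ y, meanDensity α P y ∂(mixture P) := by
  rw [meanMeasure, withDensity_apply _ MeasurableSet.univ, setLIntegral_univ]

theorem meanMeasure_univ_ne_top {P : PMF (ProbabilityMeasure Ω)} (hs : P.support.Finite)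
    {α : ℝ≥0∞} (h0 : α ≠ 0) (ht : α ≠ ∞) : meanMeasure α P Set.univ ≠ ∞ := by
  rw [meanMeasure_univ]
  have ha : 0 < α.toReal := ENNReal.toReal_pos h0 ht
  set C : ℝ≥0∞ := (∑ W ∈ hs.toFinset, P W * (P W)⁻¹ ^ α.toReal) ^ (1 / α.toReal) with hC
  have hCt : C ≠ ∞ := by
    refine ENNReal.rpow_ne_top_of_nonneg (by positivity) (ENNReal.sum_ne_top.2 fun W hW => ?_)
    refine ENNReal.mul_ne_top (P.apply_ne_top W) (ENNReal.rpow_ne_top_of_nonneg ha.le ?_)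
    exact ENNReal.inv_ne_top.2 ((P.mem_support_iff W).1 (hs.mem_toFinset.1 hW))
  refine ((lintegral_mono_ae (g := fun _ => C) ?_).trans_lt ?_).ne
  · filter_upwards [mul_rnDeriv_mixture_le_one hs] with y hy
    rw [meanDensity_eq hs h0 ht, hC]
    gcongr with W hW
    exact ENNReal.le_inv_iff_mul_le.2 ((mul_comm _ _).trans_le (hy W hW))
  · simpa using hCt.lt_top

/-- The α-th power of the mean density is pointwise the P-average of the w^α, so averaging the
affinities replaces W by the mean measure. A measure `ν` dominating both the mixture and `Q` makes
all densities comparable. -/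
theorem sum_powerAffinity_eq {P : PMF (ProbabilityMeasure Ω)} (hs : P.support.Finite)
    {α : ℝ≥0∞} (h0 : α ≠ 0) (ht : α ≠ ∞) (Q : ProbabilityMeasure Ω) :
    ∑ W ∈ hs.toFinset, P W * powerAffinity α.toReal (W : Measure Ω) Q =
      powerAffinity α.toReal (meanMeasure α P) Q := by
  have ha : 0 < α.toReal := ENNReal.toReal_pos h0 ht
  have hw (W : ProbabilityMeasure Ω) := Measure.measurable_rnDeriv (W : Measure Ω) (mixture P)
  have hm := measurable_meanDensity hs h0 ht
  obtain ⟨ν, u, q, hν, hu, hq, hmix, hQ⟩ := exists_withDensity_eq (mixture P) (Q : Measure Ω)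
  have e1 (W : ProbabilityMeasure Ω) (hW : W ∈ hs.toFinset) :
      (W : Measure Ω) = ν.withDensity (u * (W : Measure Ω).rnDeriv (mixture P)) := by
    rw [withDensity_mul _ hu (hw W), ← hmix, Measure.withDensity_rnDeriv_eq _ _
      (absolutelyContinuous_mixture (hs.mem_toFinset.1 hW))]
  have e2 : meanMeasure α P = ν.withDensity (u * meanDensity α P) := by
    rw [withDensity_mul _ hu hm, ← hmix, meanMeasure]
  have : IsFiniteMeasure (meanMeasure α P) := ⟨(meanMeasure_univ_ne_top hs h0 ht).lt_top⟩
  rw [powerAffinity_eq_lintegral (hu.mul hm) hq e2 hQ ha.le]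
  have e3 (W : ProbabilityMeasure Ω) (hW : W ∈ hs.toFinset) :
      P W * powerAffinity α.toReal (W : Measure Ω) Q = ∫⁻ y, P W *
        ((u y * (W : Measure Ω).rnDeriv (mixture P) y) ^ α.toReal * q y ^ (1 - α.toReal)) ∂ν := by
    rw [powerAffinity_eq_lintegral (hu.mul (hw W)) hq (e1 W hW) hQ ha.le,
      lintegral_const_mul _ (by fun_prop)]
    rfl
  rw [Finset.sum_congr rfl e3, ← lintegral_finsetSum _ fun W _ => by fun_prop]
  refine lintegral_congr fun y => ?_
  rw [Pi.mul_apply, meanDensity_eq hs h0 ht, ENNReal.mul_rpow_of_nonneg _ _ ha.le,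
    ← ENNReal.rpow_mul, one_div_mul_cancel ha.ne', ENNReal.rpow_one, Finset.mul_sum,
    Finset.sum_mul]
  refine Finset.sum_congr rfl fun W _ => ?_
  rw [ENNReal.mul_rpow_of_nonneg _ _ ha.le]
  ring

/-- With `Q = W` for some `W` in the support, the averaged affinity contains the positive term P(W)
S_α(W,W) = P(W). -/
theorem meanMeasure_univ_ne_zero {P : PMF (ProbabilityMeasure Ω)} (hs : P.support.Finite)
    {α : ℝ≥0∞} (h0 : α ≠ 0) (ht : α ≠ ∞) : meanMeasure α P Set.univ ≠ 0 := by
  intro h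
  have hz : meanMeasure α P = 0 := Measure.measure_univ_eq_zero.1 h
  obtain ⟨W, hW⟩ := P.support_nonempty
  have ha : 0 < α.toReal := ENNReal.toReal_pos h0 ht
  have key := sum_powerAffinity_eq hs h0 ht W
  rw [hz, ← zero_smul ℝ≥0∞ (W : Measure Ω), powerAffinity_smul_left ENNReal.zero_ne_top ha.le,
    ENNReal.zero_rpow_of_pos ha, zero_mul, Finset.sum_eq_zero_iff] at key
  have := key W (hs.mem_toFinset.2 hW)
  rw [powerAffinity_self _ ha.le, measure_univ, mul_one] at this
  exact (P.mem_support_iff W).1 hW this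

/-- Sibson's identity. -/
theorem exists_sum_powerAffinity_eq {P : PMF (ProbabilityMeasure Ω)} (hs : P.support.Finite)
    {α : ℝ≥0∞} (h0 : α ≠ 0) (ht : α ≠ ∞) : ∃ q : ProbabilityMeasure Ω,
      ∀ Q : ProbabilityMeasure Ω, ∑' W : ProbabilityMeasure Ω,
        P W * powerAffinity α.toReal (W : Measure Ω) Q =
          meanMeasure α P Set.univ ^ α.toReal * powerAffinity α.toReal (q : Measure Ω) Q := by
  have hM0 := meanMeasure_univ_ne_zero hs h0 ht
  have hMt := meanMeasure_univ_ne_top hs h0 ht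
  have hfin : IsFiniteMeasure (meanMeasure α P) := ⟨hMt.lt_top⟩
  -- The center of the prior is the normalised mean measure; homogeneity of the affinity in its
  -- first argument produces the power of the total mass.
  refine ⟨⟨(meanMeasure α P Set.univ)⁻¹ • meanMeasure α P, ⟨by
    simp [ENNReal.inv_mul_cancel hM0 hMt]⟩⟩, fun Q => ?_⟩
  rw [PMF.tsum_mul_eq_sum hs, sum_powerAffinity_eq hs h0 ht, ProbabilityMeasure.coe_mk,
    powerAffinity_smul_left (ENNReal.inv_ne_top.2 hM0) ENNReal.toReal_nonneg, ← mul_assoc,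
    ← ENNReal.mul_rpow_of_nonneg _ _ ENNReal.toReal_nonneg, ENNReal.mul_inv_cancel hM0 hMt,
    ENNReal.one_rpow, one_mul]

/-! ### Rényi information and its comparison with the radius. -/

theorem renyiInformation_eq {α : ℝ≥0∞} (h0 : α ≠ 0) (h1 : α ≠ 1) (ht : α ≠ ∞)
    (P : PMF (ProbabilityMeasure Ω)) : renyiInformation α P =
      ((1 / (α.toReal - 1) : ℝ) : EReal) *
        ENNReal.log (meanMeasure α P Set.univ ^ α.toReal) := by
  rw [renyiInformation, if_neg h0, if_neg h1, if_neg ht, ENNReal.log_rpow, ← mul_assoc,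
    ← EReal.coe_mul, one_div_mul_eq_div]

theorem renyiInformation_le_iff_of_lt_one {α : ℝ≥0∞} (h0 : 0 < α) (h1 : α < 1)
    (P : PMF (ProbabilityMeasure Ω)) (c : ℝ) :
    renyiInformation α P ≤ c ↔ ENNReal.ofReal (Real.exp ((α.toReal - 1) * c)) ≤
      meanMeasure α P Set.univ ^ α.toReal := by
  have hlt : α.toReal - 1 < 0 := by
    have := (ENNReal.toReal_lt_toReal (h1.trans ENNReal.one_lt_top).ne ENNReal.one_ne_top).2 h1
    simpa using this
  rw [renyiInformation_eq h0.ne' h1.ne (h1.trans ENNReal.one_lt_top).ne,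
    ENNReal.inv_mul_log_le_iff_of_neg hlt]

theorem renyiInformation_le_iff_of_one_lt {α : ℝ≥0∞} (h1 : 1 < α) (ht : α ≠ ∞)
    (P : PMF (ProbabilityMeasure Ω)) (c : ℝ) :
    renyiInformation α P ≤ c ↔ meanMeasure α P Set.univ ^ α.toReal ≤
      ENNReal.ofReal (Real.exp ((α.toReal - 1) * c)) := by
  have hlt : 0 < α.toReal - 1 := by
    have := (ENNReal.toReal_lt_toReal ENNReal.one_ne_top ht).2 h1
    simpa using this
  rw [renyiInformation_eq (zero_lt_one.trans h1).ne' h1.ne' ht,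
    ENNReal.inv_mul_log_le_iff_of_pos hlt]

theorem PMF.tsum_mul_le {X : Type*} (P : PMF X) {f : X → ℝ≥0∞} {t : ℝ≥0∞}
    (h : ∀ x ∈ P.support, f x ≤ t) : ∑' x, P x * f x ≤ t := by
  calc ∑' x, P x * f x ≤ ∑' x, P x * t := by
        refine ENNReal.tsum_le_tsum fun x => ?_
        by_cases hx : x ∈ P.support
        · exact mul_le_mul_right (h x hx) _
        · simp [(P.apply_eq_zero_iff x).2 hx]
    _ = t := by rw [ENNReal.tsum_mul_right, P.tsum_coe, one_mul]

theorem PMF.le_tsum_mul {X : Type*} (P : PMF X) {f : X → ℝ≥0∞} {t : ℝ≥0∞}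
    (h : ∀ x ∈ P.support, t ≤ f x) : t ≤ ∑' x, P x * f x := by
  calc t = ∑' x, P x * t := by rw [ENNReal.tsum_mul_right, P.tsum_coe, one_mul]
    _ ≤ ∑' x, P x * f x := by
        refine ENNReal.tsum_le_tsum fun x => ?_
        by_cases hx : x ∈ P.support
        · exact mul_le_mul_right (h x hx) _
        · simp [(P.apply_eq_zero_iff x).2 hx]

theorem toReal_mem_of_lt_one {α : ℝ≥0∞} (h0 : 0 < α) (h1 : α < 1) :
    0 < α.toReal ∧ α.toReal < 1 :=
  ⟨ENNReal.toReal_pos h0.ne' (h1.trans ENNReal.one_lt_top).ne, by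
    simpa using (ENNReal.toReal_lt_toReal (h1.trans ENNReal.one_lt_top).ne ENNReal.one_ne_top).2 h1⟩

theorem one_lt_toReal {α : ℝ≥0∞} (h1 : 1 < α) (ht : α ≠ ∞) : 1 < α.toReal := by
  simpa using (ENNReal.toReal_lt_toReal ENNReal.one_ne_top ht).2 h1

/-- The assumed bounds are averaged over the prior, and Sibson's identity applies; the factor
S_α(q,Q) is at most one below order one and at least one above, in each case the helpful direction.
-/
theorem renyiInformation_le_of_forall_of_ne {P : PMF (ProbabilityMeasure Ω)}
    (hs : P.support.Finite) {α : ℝ≥0∞} (h0 : 0 < α) (h1 : α ≠ 1) (ht : α ≠ ∞)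
    {Q : ProbabilityMeasure Ω} {c : ℝ} (h : ∀ W ∈ P.support, renyiDiv α W Q ≤ c) :
    renyiInformation α P ≤ c := by
  obtain ⟨q, hq⟩ := exists_sum_powerAffinity_eq hs h0.ne' ht
  rcases lt_or_gt_of_ne h1 with h1 | h1
  · obtain ⟨ha0, ha1⟩ := toReal_mem_of_lt_one h0 h1
    rw [renyiInformation_le_iff_of_lt_one h0 h1]
    calc _ ≤ ∑' W : ProbabilityMeasure Ω, P W * powerAffinity α.toReal (W : Measure Ω) Q :=
          PMF.le_tsum_mul P fun W hW => (renyiDiv_le_iff_of_lt_one h0 h1 _ _ _).1 (h W hW)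
      _ ≤ _ * 1 := by
          rw [hq]
          exact mul_le_mul_right (powerAffinity_le_one q Q ha0 ha1) _
      _ = _ := mul_one _
  · rw [renyiInformation_le_iff_of_one_lt h1 ht]
    calc _ = _ * 1 := (mul_one _).symm
      _ ≤ ∑' W : ProbabilityMeasure Ω, P W * powerAffinity α.toReal (W : Measure Ω) Q := by
          rw [hq]
          exact mul_le_mul_right (one_le_powerAffinity q Q (one_lt_toReal h1 ht)) _
      _ ≤ _ := PMF.tsum_mul_le P fun W hW => (renyiDiv_le_iff_of_one_lt h1 ht _ _ _).1 (h W hW)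

open InformationTheory in
theorem klDiv_mixture {P : PMF (ProbabilityMeasure Ω)} (hs : P.support.Finite)
    {W : ProbabilityMeasure Ω} (hW : W ∈ P.support) :
    Integrable (fun y => ((W : Measure Ω).rnDeriv (mixture P) y).toReal *
      Real.log ((W : Measure Ω).rnDeriv (mixture P) y).toReal) (mixture P) ∧
    klDiv (W : Measure Ω) (mixture P) ≠ ∞ ∧
    ∫ y, ((W : Measure Ω).rnDeriv (mixture P) y).toReal *
      Real.log ((W : Measure Ω).rnDeriv (mixture P) y).toReal ∂(mixture P) =
        (klDiv (W : Measure Ω) (mixture P)).toReal := by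
  have hac := absolutelyContinuous_mixture hW
  set r : Ω → ℝ := fun y => ((W : Measure Ω).rnDeriv (mixture P) y).toReal with hr
  have hrm : Measurable r := (Measure.measurable_rnDeriv _ _).ennreal_toReal
  have hr0 y : 0 ≤ r y := ENNReal.toReal_nonneg
  have hri : Integrable r (mixture P) := Measure.integrable_toReal_rnDeriv
  have hr1 : ∫ y, r y ∂(mixture P) = 1 := by
    rw [hr, Measure.integral_toReal_rnDeriv hac]; simp
  have hp0 : P W ≠ 0 := (P.mem_support_iff W).1 hW
  have hbound : ∀ᵐ y ∂(mixture P), r y ≤ (P W).toReal⁻¹ := by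
    filter_upwards [mul_rnDeriv_mixture_le_one hs] with y hy
    rw [← ENNReal.toReal_inv]
    exact ENNReal.toReal_mono (ENNReal.inv_ne_top.2 hp0) (ENNReal.le_inv_iff_mul_le.2
      ((mul_comm _ _).trans_le (hy W (hs.mem_toFinset.2 hW))))
  have hint : Integrable (fun y => r y * Real.log (r y)) (mixture P) := by
    refine Integrable.of_bound (by fun_prop) (1 + (P W).toReal⁻¹ ^ 2) ?_
    filter_upwards [hbound] with y hy
    have h1 : r y * Real.log (r y) ≤ r y ^ 2 := by
      rw [pow_two]
      exact mul_le_mul_of_nonneg_left (Real.log_le_self (hr0 y)) (hr0 y)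
    have h2 : -1 ≤ r y * Real.log (r y) := by
      have := klFun_nonneg (hr0 y)
      rw [klFun_apply] at this
      linarith [hr0 y]
    have h3 : r y ^ 2 ≤ (P W).toReal⁻¹ ^ 2 := pow_le_pow_left₀ (hr0 y) hy 2
    rw [Real.norm_eq_abs, abs_le]
    constructor <;> nlinarith [sq_nonneg (P W).toReal⁻¹]
  have hkl : Integrable (fun y => klFun (r y)) (mixture P) :=
    (hint.add (integrable_const 1)).sub hri
  refine ⟨hint, klDiv_ne_top hac ((integrable_klFun_rnDeriv_iff hac).1 hkl), ?_⟩
  rw [toReal_klDiv_eq_integral_klFun hac]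
  have e : ∫ y, klFun (r y) ∂(mixture P) = ∫ y, (r y * Real.log (r y) + 1) - r y ∂(mixture P) := rfl
  have hi1 : Integrable (fun y => r y * Real.log (r y) + 1) (mixture P) :=
    hint.add (integrable_const 1)
  rw [e, integral_sub hi1 hri, integral_add hint (integrable_const 1),
    hr1]
  simp [hr]

open InformationTheory in
theorem renyiInformation_one_eq {P : PMF (ProbabilityMeasure Ω)} (hs : P.support.Finite) :
    renyiInformation 1 P = ((∑ W ∈ hs.toFinset,
      (P W).toReal * (klDiv (W : Measure Ω) (mixture P)).toReal : ℝ) : EReal) := by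
  rw [renyiInformation, if_neg one_ne_zero, if_pos rfl]
  congr 1
  have e (y : Ω) : ∑' W : ProbabilityMeasure Ω, (posterior P W y).toReal *
      Real.log ((posterior P W y).toReal / (P W).toReal) = ∑ W ∈ hs.toFinset, (P W).toReal *
        (((W : Measure Ω).rnDeriv (mixture P) y).toReal *
          Real.log ((W : Measure Ω).rnDeriv (mixture P) y).toReal) := by
    rw [tsum_eq_sum (s := hs.toFinset)]
    · refine Finset.sum_congr rfl fun W hW => ?_
      have hp : (P W).toReal ≠ 0 := ENNReal.toReal_ne_zero.2
        ⟨(P.mem_support_iff W).1 (hs.mem_toFinset.1 hW), P.apply_ne_top W⟩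
      rw [posterior, ENNReal.toReal_mul, mul_div_cancel_left₀ _ hp, mul_assoc]
    · intro W hW
      rw [Set.Finite.mem_toFinset, PMF.mem_support_iff, not_not] at hW
      simp [posterior, hW]
  simp only [e]
  rw [integral_finsetSum _ fun W hW =>
    (klDiv_mixture hs (hs.mem_toFinset.1 hW)).1.const_mul _]
  refine Finset.sum_congr rfl fun W hW => ?_
  rw [integral_const_mul, (klDiv_mixture hs (hs.mem_toFinset.1 hW)).2.2]

open InformationTheory in
-- The compensation identity: the average of D_1(W‖Q) equals the information plus D_1 of the mixture
-- from `Q`, and the latter is nonnegative. It follows from the chain rule for Radon-Nikodym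
-- derivatives.
theorem renyiInformation_one_le_of_forall {P : PMF (ProbabilityMeasure Ω)}
    (hs : P.support.Finite) {Q : ProbabilityMeasure Ω} {c : ℝ}
    (h : ∀ W ∈ P.support, renyiDiv 1 W Q ≤ c) : renyiInformation 1 P ≤ c := by
  rw [renyiInformation_one_eq hs, EReal.coe_le_coe_iff]
  have hW (W : ProbabilityMeasure Ω) (hW : W ∈ hs.toFinset) :
      (W : Measure Ω) ≪ Q ∧ Integrable (llr (W : Measure Ω) Q) W ∧
        ∫ y, llr (W : Measure Ω) Q y ∂(W : Measure Ω) ≤ c := by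
    obtain ⟨h0, h1⟩ := renyiDiv_one_le_iff.1 (h W (hs.mem_toFinset.1 hW))
    obtain ⟨hac, hi⟩ := klDiv_ne_top_iff.1 (h1.trans_lt ENNReal.ofReal_lt_top).ne
    refine ⟨hac, hi, ?_⟩
    rw [← toReal_klDiv_of_measure_eq hac (by simp)]
    exact ENNReal.toReal_le_of_le_ofReal h0 h1
  have hmQ : mixture P ≪ Q := by
    refine Measure.AbsolutelyContinuous.mk fun E hE hQE => ?_
    rw [mixture_apply P hE, PMF.tsum_mul_eq_sum hs]
    exact Finset.sum_eq_zero fun W hW' => by rw [(hW W hW').1 hQE, mul_zero]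
  have hchain (W : ProbabilityMeasure Ω) (hW' : W ∈ hs.toFinset) :
      llr (mixture P) Q =ᵐ[(W : Measure Ω)]
        fun y => llr (W : Measure Ω) Q y - llr (W : Measure Ω) (mixture P) y := by
    have hac := absolutelyContinuous_mixture (hs.mem_toFinset.1 hW')
    have hacQ := (hW W hW').1
    filter_upwards [hacQ.ae_le (Measure.rnDeriv_mul_rnDeriv (κ := (Q : Measure Ω)) hac),
      Measure.rnDeriv_pos hac, hac.ae_le (Measure.rnDeriv_pos hmQ),
      hac.ae_le (Measure.rnDeriv_lt_top (W : Measure Ω) (mixture P)),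
      hacQ.ae_le (Measure.rnDeriv_lt_top (mixture P) (Q : Measure Ω))] with y h1 h2 h3 h4 h5
    rw [llr_def, llr_def, llr_def]
    simp only
    rw [← h1, Pi.mul_apply, ENNReal.toReal_mul,
      Real.log_mul (ENNReal.toReal_pos h2.ne' h4.ne).ne' (ENNReal.toReal_pos h3.ne' h5.ne).ne']
    ring
  have hi (W : ProbabilityMeasure Ω) (hW' : W ∈ hs.toFinset) :
      Integrable (llr (W : Measure Ω) (mixture P)) W :=
    (klDiv_ne_top_iff.1 (klDiv_mixture hs (hs.mem_toFinset.1 hW')).2.1).2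
  have hmi (W : ProbabilityMeasure Ω) (hW' : W ∈ hs.toFinset) :
      Integrable (llr (mixture P) Q) (P W • (W : Measure Ω)) :=
    (((hW W hW').2.1.sub (hi W hW')).congr (hchain W hW').symm).smul_measure (P.apply_ne_top W)
  have hnonneg : 0 ≤ ∫ y, llr (mixture P) Q y ∂(mixture P) := by
    rw [← toReal_klDiv_of_measure_eq hmQ (by simp)]
    exact ENNReal.toReal_nonneg
  have e : ∫ y, llr (mixture P) Q y ∂(mixture P) = ∑ W ∈ hs.toFinset, (P W).toReal *
      (∫ y, llr (W : Measure Ω) Q y ∂(W : Measure Ω) -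
        (klDiv (W : Measure Ω) (mixture P)).toReal) := by
    refine (congrArg (fun ν => ∫ y, llr (mixture P) Q y ∂ν) (mixture_eq_sum hs)).trans
      ((integral_finsetSum_measure hmi).trans ?_)
    refine Finset.sum_congr rfl fun W hW' => ?_
    rw [integral_smul_measure, integral_congr_ae (hchain W hW'),
      integral_sub (hW W hW').2.1 (hi W hW'),
      toReal_klDiv_of_measure_eq (absolutelyContinuous_mixture (hs.mem_toFinset.1 hW')) (by simp),
      smul_eq_mul]
  rw [e] at hnonneg
  have h2 : ∑ W ∈ hs.toFinset, (P W).toReal * ∫ y, llr (W : Measure Ω) Q y ∂(W : Measure Ω) ≤ c := by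
    calc _ ≤ ∑ W ∈ hs.toFinset, (P W).toReal * c := Finset.sum_le_sum fun W hW' =>
          mul_le_mul_of_nonneg_left (hW W hW').2.2 ENNReal.toReal_nonneg
      _ = c := by rw [← Finset.sum_mul, PMF.sum_toReal_eq_one hs, one_mul]
  simp only [mul_sub, Finset.sum_sub_distrib] at hnonneg
  linarith

open InformationTheory in
-- Jensen for exp moves the average of the divergences out of the exponent; D_α ≤ D_1 and Sibson's
-- identity, both with the mixture as reference, finish the comparison.
theorem renyiInformation_le_of_renyiInformation_one_le {P : PMF (ProbabilityMeasure Ω)}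
    (hs : P.support.Finite) {α : ℝ≥0∞} (h0 : 0 < α) (h1 : α < 1) {c : ℝ}
    (h : renyiInformation 1 P ≤ c) : renyiInformation α P ≤ c := by
  rw [renyiInformation_one_eq hs, EReal.coe_le_coe_iff] at h
  obtain ⟨ha0, ha1⟩ := toReal_mem_of_lt_one h0 h1
  set Q : ProbabilityMeasure Ω := ⟨mixture P, inferInstance⟩ with hQ
  set K : ProbabilityMeasure Ω → ℝ := fun W => (klDiv (W : Measure Ω) (mixture P)).toReal with hK
  obtain ⟨q, hq⟩ := exists_sum_powerAffinity_eq hs h0.ne' (h1.trans ENNReal.one_lt_top).ne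
  have hS (W : ProbabilityMeasure Ω) (hW : W ∈ hs.toFinset) :
      ENNReal.ofReal (Real.exp ((α.toReal - 1) * K W)) ≤
        powerAffinity α.toReal (W : Measure Ω) Q := by
    refine exp_le_powerAffinity_of_klDiv_le (renyiDiv_one_le_iff.2
      ⟨ENNReal.toReal_nonneg, ?_⟩) ha0 ha1
    rw [ENNReal.ofReal_toReal (klDiv_mixture hs (hs.mem_toFinset.1 hW)).2.1]
    exact le_rfl
  rw [renyiInformation_le_iff_of_lt_one h0 h1]
  have hjensen := convexOn_exp.map_sum_le (t := hs.toFinset) (w := fun W => (P W).toReal)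
    (p := fun W => (α.toReal - 1) * K W) (fun _ _ => ENNReal.toReal_nonneg)
    (PMF.sum_toReal_eq_one hs) (fun _ _ => Set.mem_univ _)
  simp only [smul_eq_mul] at hjensen
  calc ENNReal.ofReal (Real.exp ((α.toReal - 1) * c))
      ≤ ENNReal.ofReal (∑ W ∈ hs.toFinset, (P W).toReal * Real.exp ((α.toReal - 1) * K W)) := by
        refine ENNReal.ofReal_le_ofReal (le_trans (Real.exp_le_exp.2 ?_) hjensen)
        have e : ∑ W ∈ hs.toFinset, (P W).toReal * ((α.toReal - 1) * K W) =
            (α.toReal - 1) * ∑ W ∈ hs.toFinset, (P W).toReal * K W := by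
          rw [Finset.mul_sum]
          exact Finset.sum_congr rfl fun _ _ => by ring
        rw [e]
        exact mul_le_mul_of_nonpos_left h (by linarith)
    _ = ∑ W ∈ hs.toFinset, P W * ENNReal.ofReal (Real.exp ((α.toReal - 1) * K W)) := by
        rw [ENNReal.ofReal_sum_of_nonneg fun W _ =>
          mul_nonneg ENNReal.toReal_nonneg (Real.exp_pos _).le]
        refine Finset.sum_congr rfl fun W _ => ?_
        rw [ENNReal.ofReal_mul ENNReal.toReal_nonneg, ENNReal.ofReal_toReal (P.apply_ne_top W)]
    _ ≤ ∑ W ∈ hs.toFinset, P W * powerAffinity α.toReal (W : Measure Ω) Q :=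
        Finset.sum_le_sum fun W hW => mul_le_mul_right (hS W hW) _
    _ = meanMeasure α P Set.univ ^ α.toReal * powerAffinity α.toReal (q : Measure Ω) Q := by
        rw [← hq, PMF.tsum_mul_eq_sum hs]
    _ ≤ _ * 1 := mul_le_mul_right (powerAffinity_le_one q Q ha0 ha1) _
    _ = _ := mul_one _

theorem rnDeriv_le_meanDensity_top {P : PMF (ProbabilityMeasure Ω)} {W : ProbabilityMeasure Ω}
    (hW : W ∈ P.support) (y : Ω) :
    (W : Measure Ω).rnDeriv (mixture P) y ≤ meanDensity ∞ P y := by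
  rw [meanDensity, if_neg ENNReal.top_ne_zero, if_pos rfl]
  exact le_iSup₂ (f := fun (W : ProbabilityMeasure Ω) (_ : W ∈ P.support) =>
    (W : Measure Ω).rnDeriv (mixture P) y) W hW

theorem renyiInformation_top_le_iff (P : PMF (ProbabilityMeasure Ω)) (c : ℝ) :
    renyiInformation ∞ P ≤ c ↔
      ∫⁻ y, meanDensity ∞ P y ∂(mixture P) ≤ ENNReal.ofReal (Real.exp c) := by
  rw [renyiInformation, if_neg ENNReal.top_ne_zero, if_neg ENNReal.top_ne_one, if_pos rfl,
    ENNReal.log_le_coe_iff, meanMeasure_univ]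

theorem measurable_meanDensity_top {P : PMF (ProbabilityMeasure Ω)} (hs : P.support.Finite) :
    Measurable (meanDensity ∞ P) := by
  have e : meanDensity ∞ P = fun y => ⨆ W ∈ P.support, (W : Measure Ω).rnDeriv (mixture P) y := by
    funext y
    rw [meanDensity, if_neg ENNReal.top_ne_zero, if_pos rfl]
  rw [e]
  exact Measurable.biSup _ hs.countable fun W _ => Measure.measurable_rnDeriv _ _

/-- Pointwise Σ P w^a ≤ (max w)^(a-1) Σ P w = (max w)^(a-1). Hölder against the constant one, over
the probability measure `mixture P`, passes this to the total masses. -/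
theorem renyiInformation_le_of_renyiInformation_top_le {P : PMF (ProbabilityMeasure Ω)}
    (hs : P.support.Finite) {α : ℝ≥0∞} (h1 : 1 < α) (ht : α ≠ ∞) {c : ℝ}
    (h : renyiInformation ∞ P ≤ c) : renyiInformation α P ≤ c := by
  have ha := one_lt_toReal h1 ht
  have h0 : α ≠ 0 := (zero_lt_one.trans h1).ne'
  set a := α.toReal with haa
  have ha0 : 0 < a := zero_lt_one.trans ha
  rw [renyiInformation_top_le_iff] at h
  rw [renyiInformation_le_iff_of_one_lt h1 ht, ← haa, meanMeasure_univ]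
  have hpt : ∀ᵐ y ∂(mixture P), meanDensity α P y ≤
      meanDensity ∞ P y ^ ((a - 1) / a) * (fun _ => 1) y ^ (1 / a) := by
    filter_upwards [sum_mul_rnDeriv_mixture hs] with y hy
    rw [meanDensity_eq hs h0 ht, ENNReal.one_rpow, mul_one, div_eq_mul_one_div (a - 1) a,
      ENNReal.rpow_mul]
    refine ENNReal.rpow_le_rpow ?_ (by positivity)
    calc ∑ W ∈ hs.toFinset, P W * (W : Measure Ω).rnDeriv (mixture P) y ^ a
        ≤ ∑ W ∈ hs.toFinset, P W * (W : Measure Ω).rnDeriv (mixture P) y *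
            meanDensity ∞ P y ^ (a - 1) := by
          refine Finset.sum_le_sum fun W hW => ?_
          rw [mul_assoc]
          refine mul_le_mul_right ?_ _
          nth_rewrite 1 [← add_sub_cancel 1 a]
          rw [ENNReal.rpow_add_of_nonneg _ _ zero_le_one (sub_nonneg.2 ha.le), ENNReal.rpow_one]
          exact mul_le_mul_right (ENNReal.rpow_le_rpow
            (rnDeriv_le_meanDensity_top (hs.mem_toFinset.1 hW) y) (sub_nonneg.2 ha.le)) _
      _ = meanDensity ∞ P y ^ (a - 1) := by rw [← Finset.sum_mul, hy, one_mul]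
  have hH := ENNReal.lintegral_mul_norm_pow_le (μ := mixture P)
    (measurable_meanDensity_top hs).aemeasurable (g := fun _ => 1) aemeasurable_const
    (p := (a - 1) / a) (q := 1 / a) (div_nonneg (sub_nonneg.2 ha.le) ha0.le) (by positivity)
    (by field_simp; ring)
  calc (∫⁻ y, meanDensity α P y ∂(mixture P)) ^ a
      ≤ ((∫⁻ y, meanDensity ∞ P y ∂(mixture P)) ^ ((a - 1) / a)) ^ a := by
        refine ENNReal.rpow_le_rpow ((lintegral_mono_ae hpt).trans (hH.trans ?_)) ha0.le
        simp
    _ = (∫⁻ y, meanDensity ∞ P y ∂(mixture P)) ^ (a - 1) := by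
        rw [← ENNReal.rpow_mul, div_mul_cancel₀ _ ha0.ne']
    _ ≤ ENNReal.ofReal (Real.exp c) ^ (a - 1) := ENNReal.rpow_le_rpow h (sub_nonneg.2 ha.le)
    _ = _ := by rw [ENNReal.ofReal_exp_rpow, mul_comm]

theorem ENNReal.exists_eq_ofReal_exp {x : ℝ≥0∞} (h0 : x ≠ 0) (ht : x ≠ ∞) {s : ℝ} (hs : s ≠ 0) :
    ∃ c : ℝ, x = ENNReal.ofReal (Real.exp (s * c)) := by
  refine ⟨Real.log x.toReal / s, ?_⟩
  rw [mul_div_cancel₀ _ hs, Real.exp_log (ENNReal.toReal_pos h0 ht), ENNReal.ofReal_toReal ht]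

/-- If P(W₀) = e^k is the smallest positive weight, then max w ≤ e^(-k/a) (Σ P w^a)^(1/a), and the
factor tends to one as a → ∞. -/
theorem renyiInformation_top_le_of_forall {P : PMF (ProbabilityMeasure Ω)}
    (hs : P.support.Finite) {c : ℝ}
    (h : ∀ α : ℝ≥0∞, 1 < α → α ≠ ∞ → renyiInformation α P ≤ c) : renyiInformation ∞ P ≤ c := by
  obtain ⟨W₀, hW₀, hmin⟩ := Finset.exists_min_image hs.toFinset P
    (hs.toFinset_nonempty.2 P.support_nonempty)
  have hp0 : P W₀ ≠ 0 := (P.mem_support_iff W₀).1 (hs.mem_toFinset.1 hW₀)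
  obtain ⟨k, hk⟩ := ENNReal.exists_eq_ofReal_exp hp0 (P.apply_ne_top W₀) one_ne_zero
  rw [one_mul] at hk
  rw [renyiInformation_top_le_iff]
  have hbound (n : ℕ) : ∫⁻ y, meanDensity ∞ P y ∂(mixture P) ≤ ENNReal.ofReal (Real.exp
      (-k * (1 / ((n + 1 : ℕ) + 1 : ℝ)) + (1 - 1 / ((n + 1 : ℕ) + 1 : ℝ)) * c)) := by
    set a : ℝ := (n + 1 : ℕ) + 1 with ha
    have ha1 : 1 < a := by
      rw [ha]; push_cast; linarith [(Nat.cast_nonneg n : (0 : ℝ) ≤ n)]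
    have ha0 : 0 < a := zero_lt_one.trans ha1
    have hα1 : 1 < ENNReal.ofReal a := by
      rw [← ENNReal.ofReal_one]; exact (ENNReal.ofReal_lt_ofReal_iff ha0).2 ha1
    have hI := h (ENNReal.ofReal a) hα1 ENNReal.ofReal_ne_top
    have h0 : ENNReal.ofReal a ≠ 0 := (zero_lt_one.trans hα1).ne'
    rw [renyiInformation_le_iff_of_one_lt hα1 ENNReal.ofReal_ne_top, ENNReal.toReal_ofReal ha0.le]
      at hI
    have hI' := (ENNReal.le_rpow_inv_iff ha0).2 hI
    rw [ENNReal.ofReal_exp_rpow, meanMeasure_univ] at hI'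
    set d := ENNReal.ofReal (Real.exp (-k * (1 / a))) with hd
    have hpt (y : Ω) : meanDensity ∞ P y ≤ d * meanDensity (ENNReal.ofReal a) P y := by
      have e : meanDensity ∞ P y = ⨆ W ∈ P.support, (W : Measure Ω).rnDeriv (mixture P) y := by
        rw [meanDensity, if_neg ENNReal.top_ne_zero, if_pos rfl]
      rw [e]
      refine iSup₂_le fun W hW => ?_
      have hW' := hs.mem_toFinset.2 hW
      set u := (W : Measure Ω).rnDeriv (mixture P) y
      rw [meanDensity_eq hs h0 ENNReal.ofReal_ne_top, ENNReal.toReal_ofReal ha0.le]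
      calc u = d * ENNReal.ofReal (Real.exp (k * (1 / a))) * u := by
            rw [hd, ← ENNReal.ofReal_mul (Real.exp_pos _).le, ← Real.exp_add]; simp
        _ = d * (P W₀ ^ (1 / a) * (u ^ a) ^ (1 / a)) := by
            rw [hk, ENNReal.ofReal_exp_rpow, ← ENNReal.rpow_mul, mul_one_div_cancel ha0.ne',
              ENNReal.rpow_one, mul_assoc]
        _ = d * (P W₀ * u ^ a) ^ (1 / a) := by
            rw [ENNReal.mul_rpow_of_nonneg _ _ (by positivity)]
        _ ≤ _ := by
            refine mul_le_mul_right (ENNReal.rpow_le_rpow ?_ (by positivity)) _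
            refine (mul_le_mul_left (hmin W hW') _).trans ?_
            exact Finset.single_le_sum (f := fun W : ProbabilityMeasure Ω =>
              P W * (W : Measure Ω).rnDeriv (mixture P) y ^ a) (fun _ _ => zero_le) hW'
    calc ∫⁻ y, meanDensity ∞ P y ∂(mixture P)
        ≤ ∫⁻ y, d * meanDensity (ENNReal.ofReal a) P y ∂(mixture P) := lintegral_mono hpt
      _ = d * ∫⁻ y, meanDensity (ENNReal.ofReal a) P y ∂(mixture P) :=
          lintegral_const_mul _ (measurable_meanDensity hs h0 ENNReal.ofReal_ne_top)
      _ ≤ d * ENNReal.ofReal (Real.exp ((a - 1) * c * a⁻¹)) := mul_le_mul_right hI' _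
      _ = _ := by
          rw [hd, ← ENNReal.ofReal_mul (Real.exp_pos _).le, ← Real.exp_add]
          congr 3
          field_simp
  have hlim : Tendsto (fun n : ℕ => (1 : ℝ) / ((n + 1 : ℕ) + 1 : ℝ)) atTop (𝓝 0) :=
    (tendsto_add_atTop_iff_nat 1).2 (tendsto_one_div_add_atTop_nhds_zero_nat (𝕜 := ℝ))
  have hlim2 := ENNReal.tendsto_ofReal ((Real.continuous_exp.tendsto _).comp
    ((hlim.const_mul (-k)).add ((hlim.const_sub 1).mul_const c)))
  simp only [mul_zero, sub_zero, one_mul, zero_add] at hlim2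
  exact ge_of_tendsto' hlim2 hbound

/-- The Rényi information is at most the Rényi radius relative to any probability measure. -/
theorem renyiInformation_le_of_forall {P : PMF (ProbabilityMeasure Ω)} (hs : P.support.Finite)
    {α : ℝ≥0∞} (h0 : 0 < α) {Q : ProbabilityMeasure Ω} {c : ℝ}
    (h : ∀ W ∈ P.support, renyiDiv α W Q ≤ c) : renyiInformation α P ≤ c := by
  rcases eq_or_ne α 1 with rfl | h1
  · exact renyiInformation_one_le_of_forall hs h
  rcases eq_or_ne α ∞ with rfl | ht
  · refine renyiInformation_top_le_of_forall hs fun β hβ hβt => ?_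
    exact renyiInformation_le_of_forall_of_ne hs (zero_lt_one.trans hβ) hβ.ne' hβt
      fun W hW => renyiDiv_le_of_le_of_le (zero_lt_one.trans hβ) le_top (h W hW)
  · exact renyiInformation_le_of_forall_of_ne hs h0 h1 ht h

theorem renyiCapacity_le_iff {α : ℝ≥0∞} {𝒲 : Set (ProbabilityMeasure Ω)} {c : EReal} :
    renyiCapacity α 𝒲 ≤ c ↔ ∀ P : PMF (ProbabilityMeasure Ω), P.support.Finite →
      P.support ⊆ 𝒲 → renyiInformation α P ≤ c := by
  rw [renyiCapacity, iSup₂_le_iff]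
  exact ⟨fun h P h1 h2 => h P ⟨h1, h2⟩, fun h P hP => h P hP.1 hP.2⟩

theorem renyiCapacity_le_of_forall {α : ℝ≥0∞} (h0 : 0 < α) {𝒲 : Set (ProbabilityMeasure Ω)}
    {Q : ProbabilityMeasure Ω} {c : ℝ} (h : ∀ W ∈ 𝒲, renyiDiv α W Q ≤ c) :
    renyiCapacity α 𝒲 ≤ c :=
  renyiCapacity_le_iff.2 fun _ h1 h2 => renyiInformation_le_of_forall h1 h0 fun W hW => h W (h2 hW)

/-! ### The minimax principle. -/

theorem ENNReal.exists_iSup_le_add {ι : Type*} [Nonempty ι] {K : ι → ℝ≥0∞} (hK : ⨆ i, K i ≠ ∞)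
    {d : ℝ≥0∞} (hd : d ≠ 0) : ∃ i, ⨆ j, K j ≤ K i + d := by
  by_contra! h
  rcases eq_or_ne (⨆ j, K j) 0 with h0 | h0
  · obtain ⟨i⟩ := ‹Nonempty ι›
    exact absurd (h i) (by simp [h0])
  · have hlt := ENNReal.sub_lt_self hK h0 hd
    obtain ⟨i, hi⟩ := lt_iSup_iff.1 hlt
    exact absurd (tsub_le_iff_right.1 hi.le) (not_le.2 (h i))

/-- An abstract minimax principle: nearly optimal mixing points have nearly equal centers. -/
theorem exists_minimax {X Pr : Type*} [MetricSpace X] [CompleteSpace X] [Nonempty Pr]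
    (h : Pr → X → ℝ≥0∞) (H : X → X → ℝ≥0∞) (K m : Pr → ℝ≥0∞) (c : Pr → X)
    (hcomp : ∀ p x, h p x = K p + m p * H (c p) x) (hself : ∀ x, H x x = 0)
    (hmix : ∀ p p' (s t : ℝ≥0∞), s + t = 1 → ∃ p'', ∀ x, h p'' x = s * h p x + t * h p' x)
    {m₀ : ℝ≥0∞} (hm₀ : m₀ ≠ 0) (hm₀t : m₀ ≠ ∞) (hm : ∀ p, m₀ ≤ m p) (hK : ⨆ p, K p ≠ ∞)
    (hdist : ∀ η : ℝ, 0 < η → ∃ δ : ℝ≥0∞, 0 < δ ∧ ∀ x y, H x y ≤ δ → dist x y ≤ η) :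
    ∃ (q : X) (p : ℕ → Pr), Tendsto (fun n => K (p n)) atTop (𝓝 (⨆ i, K i)) ∧
      Tendsto (fun n => c (p n)) atTop (𝓝 q) ∧
      ∀ p', (∀ (u : ℕ → X) (t : ℕ → ℝ≥0∞) (x : X) (t₀ : ℝ≥0∞), Tendsto u atTop (𝓝 x) →
        Tendsto t atTop (𝓝 t₀) → (∀ n, h p' (u n) ≤ t n) → h p' x ≤ t₀) → h p' q ≤ ⨆ i, K i := by
  set κ := ⨆ p, K p with hκ
  have hKt p : K p ≠ ∞ := ((le_iSup K p).trans_lt hK.lt_top).ne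
  -- The point `x` is the center of the mixture of `p` and `p'`, where the functional of the mixture
  -- takes its value `K p'' ≤ κ`. Near-optimality of `p` cancels the term `s * K p` up to `d`.
  have mixing (p p' : Pr) (s t d : ℝ≥0∞) (hst : s + t = 1) (hd : κ ≤ K p + d) :
      ∃ x, s * (m₀ * H (c p) x) + t * h p' x ≤ d + t * κ := by
    obtain ⟨p'', hp''⟩ := hmix p p' s t hst
    refine ⟨c p'', ?_⟩
    have hs1 : s ≤ 1 := hst ▸ le_self_add
    have h1 : s * K p + (s * (m₀ * H (c p) (c p'')) + t * h p' (c p'')) ≤ κ := by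
      calc _ = s * (K p + m₀ * H (c p) (c p'')) + t * h p' (c p'') := by ring
        _ ≤ s * h p (c p'') + t * h p' (c p'') := by
            rw [hcomp p]
            gcongr
            exact hm p
        _ = K p'' := by rw [← hp'', hcomp, hself, mul_zero, add_zero]
        _ ≤ κ := le_iSup K p''
    have h2 : κ ≤ s * K p + (d + t * κ) := by
      calc κ = s * κ + t * κ := by rw [← add_mul, hst, one_mul]
        _ ≤ s * (K p + d) + t * κ := by gcongr
        _ ≤ s * K p + 1 * d + t * κ := by rw [mul_add]; gcongr
        _ = _ := by ring
    exact (ENNReal.add_le_add_iff_left (ENNReal.mul_ne_top (hs1.trans_lt ENNReal.one_lt_top).ne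
      (hKt p))).1 (h1.trans h2)
  -- Priors optimal up to δ² are perturbed with weight δ, so dividing the error by the weight still
  -- leaves δ → 0. The shift by 2 keeps the remaining weight at least one half.
  set δ : ℕ → ℝ≥0∞ := fun n => ((n : ℝ≥0∞) + 2)⁻¹ with hδ
  have hδ0 n : δ n ≠ 0 := ENNReal.inv_ne_zero.2 (by simp)
  have hδ2 n : δ n ≤ 2⁻¹ := ENNReal.inv_le_inv.2 le_add_self
  have hδt n : δ n ≠ ∞ := ((hδ2 n).trans_lt (by simp)).ne
  have hδlim : Tendsto δ atTop (𝓝 0) := by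
    have := (tendsto_add_atTop_iff_nat 2).2 ENNReal.tendsto_inv_nat_nhds_zero
    refine this.congr fun n => ?_
    simp [hδ]
  choose p hp using fun n => ENNReal.exists_iSup_le_add hK (mul_ne_zero (hδ0 n) (hδ0 n))
  have hδδ : Tendsto (fun n => δ n * δ n) atTop (𝓝 0) := by
    have := ENNReal.Tendsto.mul hδlim (Or.inr (by simp)) hδlim (Or.inr (by simp))
    simpa using this
  have close {x y : ℕ → X} {e : ℕ → ℝ≥0∞} (he : Tendsto e atTop (𝓝 0))
      (hxy : ∀ n, m₀ * H (x n) (y n) ≤ e n) : Tendsto (fun n => dist (x n) (y n)) atTop (𝓝 0) := by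
    have he' : Tendsto (fun n => m₀⁻¹ * e n) atTop (𝓝 0) := by
      have := ENNReal.Tendsto.const_mul (a := m₀⁻¹) he (Or.inr (ENNReal.inv_ne_top.2 hm₀))
      simpa using this
    refine Metric.tendsto_atTop.2 fun η hη => ?_
    obtain ⟨d, hd, hH⟩ := hdist (η / 2) (half_pos hη)
    obtain ⟨N, hN⟩ := eventually_atTop.1 ((tendsto_order.1 he').2 d hd)
    refine ⟨N, fun n hn => ?_⟩
    rw [Real.dist_eq, sub_zero, abs_of_nonneg dist_nonneg]
    refine (hH _ _ (le_trans ?_ (hN n hn).le)).trans_lt (half_lt_self hη)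
    calc H (x n) (y n) = m₀⁻¹ * (m₀ * H (x n) (y n)) := by
          rw [← mul_assoc, ENNReal.inv_mul_cancel hm₀ hm₀t, one_mul]
      _ ≤ m₀⁻¹ * e n := mul_le_mul_right (hxy n) _
  have h22 : (2⁻¹ : ℝ≥0∞) + 2⁻¹ = 1 := ENNReal.inv_two_add_inv_two
  -- The center of the even mixture is close to both centers; the triangle inequality then gives a
  -- Cauchy sequence.
  have pair (n k : ℕ) : ∃ x, m₀ * H (c (p n)) x ≤ 2 * (δ n * δ n + δ k * δ k) ∧
      m₀ * H (c (p k)) x ≤ 2 * (δ n * δ n + δ k * δ k) := by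
    obtain ⟨x, hx⟩ := mixing (p n) (p k) 2⁻¹ 2⁻¹ (δ n * δ n) h22 (hp n)
    have h1 : 2⁻¹ * K (p k) + (2⁻¹ * (m₀ * H (c (p n)) x) + 2⁻¹ * (m₀ * H (c (p k)) x)) ≤
        2⁻¹ * K (p k) + (δ n * δ n + 2⁻¹ * (δ k * δ k)) := by
      calc _ = 2⁻¹ * (m₀ * H (c (p n)) x) + 2⁻¹ * (K (p k) + m₀ * H (c (p k)) x) := by ring
        _ ≤ 2⁻¹ * (m₀ * H (c (p n)) x) + 2⁻¹ * h (p k) x := by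
            rw [hcomp (p k)]; gcongr; exact hm _
        _ ≤ δ n * δ n + 2⁻¹ * κ := hx
        _ ≤ δ n * δ n + 2⁻¹ * (K (p k) + δ k * δ k) := by gcongr; exact hp k
        _ = _ := by ring
    have h2 := (ENNReal.add_le_add_iff_left (ENNReal.mul_ne_top (by simp) (hKt (p k)))).1 h1
    have h3 : δ n * δ n + 2⁻¹ * (δ k * δ k) ≤ δ n * δ n + δ k * δ k :=
      add_le_add_right ((mul_le_mul_left (ENNReal.inv_le_one.2 one_le_two) _).trans_eq
        (one_mul _)) _
    have h4 (a : ℝ≥0∞) : a = 2 * (2⁻¹ * a) := by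
      rw [← mul_assoc, ENNReal.mul_inv_cancel two_ne_zero ENNReal.ofNat_ne_top, one_mul]
    refine ⟨x, ?_, ?_⟩
    · rw [h4 (m₀ * H (c (p n)) x)]
      exact mul_le_mul_right (le_self_add.trans (h2.trans h3)) _
    · rw [h4 (m₀ * H (c (p k)) x)]
      exact mul_le_mul_right (le_add_self.trans (h2.trans h3)) _
  have hcauchy : CauchySeq fun n => c (p n) := by
    refine Metric.cauchySeq_iff.2 fun η hη => ?_
    obtain ⟨d, hd, hH⟩ := hdist (η / 3) (by positivity)
    have hlim : Tendsto (fun n => δ n * δ n) atTop (𝓝 0) := hδδ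
    have hpos : 0 < m₀ * d / 4 := ENNReal.div_pos (mul_ne_zero hm₀ hd.ne') (by simp)
    obtain ⟨N, hN⟩ := eventually_atTop.1 ((tendsto_order.1 hlim).2 _ hpos)
    refine ⟨N, fun n hn k hk => ?_⟩
    obtain ⟨x, hx1, hx2⟩ := pair n k
    have hb : 2 * (δ n * δ n + δ k * δ k) ≤ m₀ * d := by
      calc _ ≤ 2 * (m₀ * d / 4 + m₀ * d / 4) := by
            gcongr
            exacts [(hN n hn).le, (hN k hk).le]
        _ = m₀ * d := by
            rw [← two_mul, ← mul_assoc]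
            norm_num
            exact ENNReal.mul_div_cancel (by simp) (by simp)
    have hc {y : X} (hy : m₀ * H y x ≤ m₀ * d) : dist y x ≤ η / 3 :=
      hH _ _ ((ENNReal.mul_le_mul_iff_right hm₀ hm₀t).1 hy)
    have h1 := hc (hx1.trans hb)
    have h2 := hc (hx2.trans hb)
    have := dist_triangle_right (c (p n)) (c (p k)) x
    linarith
  obtain ⟨q, hq⟩ := cauchySeq_tendsto_of_complete hcauchy
  refine ⟨q, p, ?_, hq, fun p' hlsc => ?_⟩
  · have h1 : Tendsto (fun n => κ - δ n * δ n) atTop (𝓝 κ) := by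
      have := ENNReal.Tendsto.sub (tendsto_const_nhds (x := κ)) hδδ (Or.inl hK)
      simpa using this
    refine tendsto_of_tendsto_of_tendsto_of_le_of_le h1 tendsto_const_nhds (fun n => ?_)
      fun n => le_iSup K (p n)
    exact tsub_le_iff_right.2 (hp n)
  -- Adding `p'` with weight δ_n moves the center only slightly, so `x n` still tends to `q`.
  -- Division by δ_n gives `h p' (x n) ≤ δ n + κ`, and lower semicontinuity of `h p'` concludes.
  · choose x hx using fun n => mixing (p n) p' (1 - δ n) (δ n) (δ n * δ n)
      (tsub_add_cancel_of_le ((hδ2 n).trans (by simp))) (hp n)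
    have hhalf n : 2⁻¹ ≤ 1 - δ n := by
      rw [← ENNReal.one_sub_inv_two]
      exact tsub_le_tsub_left (hδ2 n) _
    have hH n : m₀ * H (c (p n)) (x n) ≤ 2 * (δ n * δ n + δ n * κ) := by
      calc m₀ * H (c (p n)) (x n) = 2 * (2⁻¹ * (m₀ * H (c (p n)) (x n))) := by
            rw [← mul_assoc 2, ENNReal.mul_inv_cancel two_ne_zero ENNReal.ofNat_ne_top, one_mul]
        _ ≤ 2 * ((1 - δ n) * (m₀ * H (c (p n)) (x n))) := by gcongr; exact hhalf n
        _ ≤ _ := mul_le_mul_right (le_self_add.trans (hx n)) _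
    have hlim0 : Tendsto (fun n => 2 * (δ n * δ n + δ n * κ)) atTop (𝓝 0) := by
      have h1 : Tendsto (fun n => δ n * κ) atTop (𝓝 0) := by
        have := ENNReal.Tendsto.mul_const (b := κ) hδlim (Or.inr hK)
        simpa using this
      have := ENNReal.Tendsto.const_mul (a := 2) (hδδ.add h1) (Or.inr (by simp))
      simpa using this
    have hd0 := close hlim0 hH
    have hxq : Tendsto x atTop (𝓝 q) := tendsto_iff_dist_tendsto_zero.2 (by
      have h1 := hd0.add (tendsto_iff_dist_tendsto_zero.1 hq)
      rw [add_zero] at h1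
      refine squeeze_zero (fun _ => dist_nonneg) (fun n => ?_) h1
      exact dist_triangle_left _ _ _)
    refine hlsc x (fun n => δ n + κ) q κ hxq ?_ fun n => ?_
    · have := hδlim.add_const κ
      simpa using this
    · have h1 := le_add_self.trans (hx n)
      rw [← mul_add] at h1
      exact (ENNReal.mul_le_mul_iff_right (hδ0 n) (hδt n)).1 h1

/-! ### Strong centers for finite orders other than one. -/

theorem PMF.exists_mix {X : Type*} (P P' : PMF X) {s t : ℝ≥0∞} (hst : s + t = 1) :
    ∃ R : PMF X, (∀ x, R x = s * P x + t * P' x) ∧ R.support ⊆ P.support ∪ P'.support := by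
  refine ⟨⟨fun x => s * P x + t * P' x, ?_⟩, fun x => rfl, fun x hx => ?_⟩
  · rw [ENNReal.summable.hasSum_iff, ENNReal.tsum_add, ENNReal.tsum_mul_left,
      ENNReal.tsum_mul_left, P.tsum_coe, P'.tsum_coe, mul_one, mul_one, hst]
  · by_contra h
    rw [Set.mem_union, not_or, PMF.mem_support_iff, PMF.mem_support_iff, not_not, not_not] at h
    refine (PMF.mem_support_iff _ _).1 hx ?_
    change s * P x + t * P' x = 0
    simp [h.1, h.2]

theorem PMF.tsum_pure_mul {X : Type*} (x : X) (f : X → ℝ≥0∞) :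
    ∑' y, PMF.pure x y * f y = f x := by
  rw [tsum_eq_single x]
  · simp
  · intro y hy
    simp [PMF.pure_apply, hy]

/-- `q` is a Rényi center of order `α` with capacity `c`, in the strong sense that the radius
relative to any `Q` exceeds the capacity by at least the divergence of `q` from `Q`. -/
structure IsStrongCenter (α : ℝ≥0∞) (𝒲 : Set (ProbabilityMeasure Ω)) (q : ProbabilityMeasure Ω)
    (c : ℝ) : Prop where
  capacity_eq : renyiCapacity α 𝒲 = c
  div_le : ∀ W ∈ 𝒲, renyiDiv α W q ≤ c
  div_center_le : ∀ (Q : ProbabilityMeasure Ω) (c' : ℝ), (∀ W ∈ 𝒲, renyiDiv α W Q ≤ c') →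
    renyiDiv α q Q ≤ ((c' - c : ℝ) : EReal)

theorem ENNReal.ofReal_exp_div (x y : ℝ) : ENNReal.ofReal (Real.exp x) / ENNReal.ofReal (Real.exp y) =
    ENNReal.ofReal (Real.exp (x - y)) := by
  rw [← ENNReal.ofReal_div_of_pos (Real.exp_pos y), Real.exp_sub]

/-- The finitely supported priors on a set. -/
abbrev FinitePrior (𝒲 : Set (ProbabilityMeasure Ω)) : Type _ :=
  {P : PMF (ProbabilityMeasure Ω) // P.support.Finite ∧ P.support ⊆ 𝒲}

/-- The point mass as a finitely supported prior. -/
def FinitePrior.pure {𝒲 : Set (ProbabilityMeasure Ω)} {W : ProbabilityMeasure Ω} (hW : W ∈ 𝒲) :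
    FinitePrior 𝒲 :=
  ⟨PMF.pure W, by simp, by simpa using hW⟩

theorem FinitePrior.exists_mix {𝒲 : Set (ProbabilityMeasure Ω)} (P P' : FinitePrior 𝒲)
    {s t : ℝ≥0∞} (hst : s + t = 1) : ∃ R : FinitePrior 𝒲, ∀ f : ProbabilityMeasure Ω → ℝ≥0∞,
      ∑' W, R.1 W * f W = s * ∑' W, P.1 W * f W + t * ∑' W, P'.1 W * f W := by
  obtain ⟨R, hR, hsupp⟩ := PMF.exists_mix P.1 P'.1 hst
  refine ⟨⟨R, (P.2.1.union P'.2.1).subset hsupp, hsupp.trans (Set.union_subset P.2.2 P'.2.2)⟩,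
    fun f => ?_⟩
  rw [← ENNReal.tsum_mul_left, ← ENNReal.tsum_mul_left, ← ENNReal.tsum_add]
  exact tsum_congr fun W => by rw [hR]; ring

theorem tendsto_tvDist_self (W : ProbabilityMeasure Ω) :
    Tendsto (fun _ : ℕ => tvDist W W) atTop (𝓝 0) := by
  simp [tvDist_self]

/-- The minimax principle is applied to one minus the averaged affinity. By Sibson's identity this
is 1 - M S = (1 - M) + M (1 - S), with M the power of the mass of the mean measure, bounded below by
exp((α-1)c). -/
theorem exists_isStrongCenter_of_lt_one {α : ℝ≥0∞} (h0 : 0 < α) (h1 : α < 1)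
    {𝒲 : Set (ProbabilityMeasure Ω)} (hne : 𝒲.Nonempty) {c : ℝ} (hC : renyiCapacity α 𝒲 = c) :
    ∃ q, IsStrongCenter α 𝒲 q c := by
  obtain ⟨ha0, ha1⟩ := toReal_mem_of_lt_one h0 h1
  have ht := (h1.trans ENNReal.one_lt_top).ne
  set a := α.toReal with ha
  set E : ℝ → ℝ≥0∞ := fun s => ENNReal.ofReal (Real.exp ((a - 1) * s)) with hE
  have hEt s : E s ≠ ∞ := ENNReal.ofReal_ne_top
  have hE0 s : E s ≠ 0 := (ENNReal.ofReal_pos.2 (Real.exp_pos _)).ne'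
  let S : ProbabilityMeasure Ω → ProbabilityMeasure Ω → ℝ≥0∞ :=
    fun W Q => powerAffinity a (W : Measure Ω) Q
  have hS1 W Q : S W Q ≤ 1 := powerAffinity_le_one W Q ha0 ha1
  have hSself W : S W W = 1 := by
    simp only [S]; rw [powerAffinity_self _ ha0.le, measure_univ]
  let M : FinitePrior 𝒲 → ℝ≥0∞ := fun P => meanMeasure α P.1 Set.univ ^ a
  choose q hq using fun P : FinitePrior 𝒲 => exists_sum_powerAffinity_eq P.2.1 h0.ne' ht
  replace hq : ∀ (P : FinitePrior 𝒲) Q, ∑' W, P.1 W * S W Q = M P * S (q P) Q := hq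
  have hM1 P : M P ≤ 1 := by
    have h := hq P (q P)
    rw [hSself, mul_one] at h
    exact h ▸ PMF.tsum_mul_le P.1 fun W _ => hS1 W _
  have hMt P : M P ≠ ∞ := ((hM1 P).trans_lt ENNReal.one_lt_top).ne
  have hcap (s : ℝ) : renyiCapacity α 𝒲 ≤ s ↔ ∀ P, E s ≤ M P := by
    rw [renyiCapacity_le_iff]
    simp only [renyiInformation_le_iff_of_lt_one h0 h1]
    exact ⟨fun h P => h P.1 P.2.1 P.2.2, fun h P h1 h2 => h ⟨P, h1, h2⟩⟩
  have hMc P : E c ≤ M P := (hcap c).1 hC.le P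
  have hEc1 : E c ≤ 1 := by
    obtain ⟨W, hW⟩ := hne
    exact (hMc (FinitePrior.pure hW)).trans (hM1 _)
  have hsum1 (P : FinitePrior 𝒲) Q : ∑' W, P.1 W * S W Q ≤ 1 :=
    PMF.tsum_mul_le P.1 fun W _ => hS1 W Q
  let _ := tvMetricSpace Ω
  have := tvMetricSpace_completeSpace (Ω := Ω)
  have : Nonempty (FinitePrior 𝒲) := ⟨FinitePrior.pure hne.some_mem⟩
  -- Since α < 1, the capacity being `c` means that `E c` is the infimum of the `M P`. The case `1 -
  -- κ = 0` is separate because an exponential never vanishes.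
  have hsup : ⨆ P, (1 - M P) = 1 - E c := by
    refine le_antisymm (iSup_le fun P => tsub_le_tsub_left (hMc P) _) ?_
    set κ := ⨆ P, (1 - M P) with hκ
    have hle P : 1 - κ ≤ M P := by
      have := le_iSup (fun P => 1 - M P) P
      rw [tsub_le_iff_right] at this ⊢
      rwa [add_comm]
    rcases eq_or_ne (1 - κ) 0 with hz | hz
    · exact tsub_le_self.trans (tsub_eq_zero_iff_le.1 hz)
    · obtain ⟨c', hc'⟩ := ENNReal.exists_eq_ofReal_exp hz
        (ENNReal.sub_ne_top ENNReal.one_ne_top) (s := a - 1) (by linarith)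
      have h3 : renyiCapacity α 𝒲 ≤ c' := (hcap c').2 fun P => hc'.symm.le.trans (hle P)
      rw [hC, EReal.coe_le_coe_iff] at h3
      have h4 : 1 - κ ≤ E c := by
        rw [hc']
        exact ENNReal.ofReal_le_ofReal (Real.exp_le_exp.2
          (mul_le_mul_of_nonpos_left h3 (by linarith)))
      rw [tsub_le_iff_right] at h4 ⊢
      rwa [add_comm]
  have hadd {x : ℝ≥0∞} (hx : x ≤ 1) : (1 - x) + x = 1 := tsub_add_cancel_of_le hx
  obtain ⟨q₀, p, hKlim, hqlim, hle⟩ := exists_minimax (X := ProbabilityMeasure Ω)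
    (fun (P : FinitePrior 𝒲) Q => 1 - ∑' W, P.1 W * S W Q) (fun P Q => 1 - S P Q)
    (fun P => 1 - M P) M q
    (fun P Q => by
      refine ENNReal.sub_eq_of_eq_add
        ((hsum1 P Q).trans_lt ENNReal.one_lt_top).ne ?_
      rw [hq, add_assoc, ← mul_add, hadd (hS1 _ _), mul_one, hadd (hM1 P)])
    (fun Q => by rw [hSself, tsub_self])
    (fun P P' s t hst => by
      obtain ⟨R, hR⟩ := FinitePrior.exists_mix P P' hst
      refine ⟨R, fun Q => ENNReal.sub_eq_of_eq_add
        ((hsum1 R Q).trans_lt ENNReal.one_lt_top).ne ?_⟩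
      rw [hR, add_add_add_comm, ← mul_add, ← mul_add, hadd (hsum1 P Q), hadd (hsum1 P' Q),
        mul_one, mul_one, hst])
    (hE0 c) (hEt c) hMc (by rw [hsup]; exact ENNReal.sub_ne_top ENNReal.one_ne_top)
    (fun η hη => by
      obtain ⟨δ, hδ, hP⟩ := exists_tvDist_le_of_renyiDiv_le (Ω := Ω) h0 hη
      have hlt : E δ < 1 := by
        rw [hE, ← ENNReal.ofReal_one]
        refine (ENNReal.ofReal_lt_ofReal_iff one_pos).2 (Real.exp_lt_one_iff.2 ?_)
        exact mul_neg_of_neg_of_pos (by linarith) hδ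
      refine ⟨1 - E δ, tsub_pos_of_lt hlt, fun P Q hPQ => hP α le_rfl h1.ne ht P Q ?_⟩
      rw [renyiDiv_le_iff_of_lt_one h0 h1]
      have h3 : E δ + (1 - E δ) ≤ S P Q + (1 - E δ) := by
        rw [add_comm, hadd hlt.le, add_comm]
        exact tsub_le_iff_right.1 hPQ
      exact (ENNReal.add_le_add_iff_right (ENNReal.sub_ne_top ENNReal.one_ne_top)).1 h3)
  rw [hsup] at hKlim hle
  refine ⟨q₀, hC, fun W hW => ?_, fun Q c' hc' => ?_⟩
  · have h3 := hle (FinitePrior.pure hW) (fun u t x t₀ hu htlim hb => by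
      simp only [FinitePrior.pure, PMF.tsum_pure_mul] at hb ⊢
      have h4 := le_powerAffinity_of_tendsto_of_lt_one ha0 ha1 (P := fun _ => W) (P₀ := W) (Q := u)
        (Q₀ := x) (tendsto_tvDist_self W) (tendsto_iff_dist_tendsto_zero.1 hu)
        (ENNReal.Tendsto.sub tendsto_const_nhds htlim (Or.inl ENNReal.one_ne_top))
        (fun n => by
          have := hb n
          rw [tsub_le_iff_right] at this ⊢
          rwa [add_comm])
      rw [tsub_le_iff_right] at h4 ⊢
      rwa [add_comm])
    simp only [FinitePrior.pure, PMF.tsum_pure_mul] at h3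
    rw [renyiDiv_le_iff_of_lt_one h0 h1]
    have h4 : E c + (1 - E c) ≤ S W q₀ + (1 - E c) := by
      rw [add_comm, hadd hEc1, add_comm]
      exact tsub_le_iff_right.1 h3
    exact (ENNReal.add_le_add_iff_right (ENNReal.sub_ne_top ENNReal.one_ne_top)).1 h4
  · rw [renyiDiv_le_iff_of_lt_one h0 h1]
    -- For the strong property, average the hypothesis on `Q` over `p n`: `E c' ≤ M (p n) * S (q (p
    -- n)) Q`. Division by `M (p n) → E c` leaves exp((α-1)(c' - c)) in the limit.
    have hMlim : Tendsto (fun n => M (p n)) atTop (𝓝 (E c)) := by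
      have := ENNReal.Tendsto.sub tendsto_const_nhds hKlim (Or.inl ENNReal.one_ne_top)
      rw [ENNReal.sub_sub_cancel ENNReal.one_ne_top hEc1] at this
      refine this.congr fun n => ENNReal.sub_sub_cancel ENNReal.one_ne_top (hM1 _)
    have hM0 n : M (p n) ≠ 0 := ((pos_iff_ne_zero.2 (hE0 c)).trans_le (hMc _)).ne'
    have hlim := ENNReal.Tendsto.div (tendsto_const_nhds (x := E c')) (Or.inl (hE0 c')) hMlim
      (Or.inr (hEt c'))
    rw [ENNReal.ofReal_exp_div, ← mul_sub] at hlim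
    refine le_powerAffinity_of_tendsto_of_lt_one ha0 ha1 (tendsto_iff_dist_tendsto_zero.1 hqlim)
      (tendsto_tvDist_self Q) hlim fun n => ?_
    rw [ENNReal.div_le_iff (hM0 n) (hMt _), mul_comm]
    refine le_trans ?_ (hq (p n) Q).le
    exact PMF.le_tsum_mul _ fun W hW =>
      (renyiDiv_le_iff_of_lt_one h0 h1 _ _ _).1 (hc' W ((p n).2.2 hW))

/-- The same argument with reversed signs: M S - 1 = (M - 1) + M (S - 1), where now M ≥ 1 gives the
lower bound on the weights. -/
theorem exists_isStrongCenter_of_one_lt {α : ℝ≥0∞} (h1 : 1 < α) (ht : α ≠ ∞)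
    {𝒲 : Set (ProbabilityMeasure Ω)} (hne : 𝒲.Nonempty) {c : ℝ} (hC : renyiCapacity α 𝒲 = c) :
    ∃ q, IsStrongCenter α 𝒲 q c := by
  have ha1 := one_lt_toReal h1 ht
  have h0 : 0 < α := zero_lt_one.trans h1
  set a := α.toReal with ha
  have ha0 : 0 < a := zero_lt_one.trans ha1
  set E : ℝ → ℝ≥0∞ := fun s => ENNReal.ofReal (Real.exp ((a - 1) * s)) with hE
  have hEt s : E s ≠ ∞ := ENNReal.ofReal_ne_top
  have hE0 s : E s ≠ 0 := (ENNReal.ofReal_pos.2 (Real.exp_pos _)).ne'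
  let S : ProbabilityMeasure Ω → ProbabilityMeasure Ω → ℝ≥0∞ :=
    fun W Q => powerAffinity a (W : Measure Ω) Q
  have hS1 W Q : 1 ≤ S W Q := one_le_powerAffinity W Q ha1
  have hSself W : S W W = 1 := by
    simp only [S]; rw [powerAffinity_self _ ha0.le, measure_univ]
  let M : FinitePrior 𝒲 → ℝ≥0∞ := fun P => meanMeasure α P.1 Set.univ ^ a
  choose q hq using fun P : FinitePrior 𝒲 => exists_sum_powerAffinity_eq P.2.1 h0.ne' ht
  replace hq : ∀ (P : FinitePrior 𝒲) Q, ∑' W, P.1 W * S W Q = M P * S (q P) Q := hq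
  have hM1 P : 1 ≤ M P := by
    have h := hq P (q P)
    rw [hSself, mul_one] at h
    exact h ▸ PMF.le_tsum_mul P.1 fun W _ => hS1 W _
  have hcap (s : ℝ) : renyiCapacity α 𝒲 ≤ s ↔ ∀ P, M P ≤ E s := by
    rw [renyiCapacity_le_iff]
    simp only [renyiInformation_le_iff_of_one_lt h1 ht]
    exact ⟨fun h P => h P.1 P.2.1 P.2.2, fun h P h1 h2 => h ⟨P, h1, h2⟩⟩
  have hMc P : M P ≤ E c := (hcap c).1 hC.le P
  have hMt P : M P ≠ ∞ := ((hMc P).trans_lt (hEt c).lt_top).ne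
  have hEc1 : 1 ≤ E c := by
    obtain ⟨W, hW⟩ := hne
    exact (hM1 _).trans (hMc (FinitePrior.pure hW))
  have hsum1 (P : FinitePrior 𝒲) Q : 1 ≤ ∑' W, P.1 W * S W Q :=
    PMF.le_tsum_mul P.1 fun W _ => hS1 W Q
  let _ := tvMetricSpace Ω
  have := tvMetricSpace_completeSpace (Ω := Ω)
  have : Nonempty (FinitePrior 𝒲) := ⟨FinitePrior.pure hne.some_mem⟩
  have hadd {x : ℝ≥0∞} (hx : 1 ≤ x) : (x - 1) + 1 = x := tsub_add_cancel_of_le hx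
  have hsup : ⨆ P, (M P - 1) = E c - 1 := by
    refine le_antisymm (iSup_le fun P => tsub_le_tsub_right (hMc P) _) ?_
    set κ := ⨆ P, (M P - 1) with hκ
    have hκle : κ ≤ E c - 1 := iSup_le fun P => tsub_le_tsub_right (hMc P) _
    have hκt : κ + 1 ≠ ∞ := ENNReal.add_ne_top.2
      ⟨(hκle.trans_lt (ENNReal.sub_ne_top (hEt c)).lt_top).ne, ENNReal.one_ne_top⟩
    have hle P : M P ≤ κ + 1 := tsub_le_iff_right.1 (le_iSup (fun P => M P - 1) P)
    obtain ⟨c', hc'⟩ := ENNReal.exists_eq_ofReal_exp (by simp) hκt (s := a - 1) (by linarith)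
    have h3 : renyiCapacity α 𝒲 ≤ c' := (hcap c').2 fun P => (hle P).trans_eq hc'
    rw [hC, EReal.coe_le_coe_iff] at h3
    rw [tsub_le_iff_right, hc']
    exact ENNReal.ofReal_le_ofReal (Real.exp_le_exp.2
      (mul_le_mul_of_nonneg_left h3 (by linarith)))
  obtain ⟨q₀, p, hKlim, hqlim, hle⟩ := exists_minimax (X := ProbabilityMeasure Ω)
    (fun (P : FinitePrior 𝒲) Q => ∑' W, P.1 W * S W Q - 1) (fun P Q => S P Q - 1)
    (fun P => M P - 1) M q
    (fun P Q => by
      refine ENNReal.sub_eq_of_eq_add ENNReal.one_ne_top ?_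
      rw [hq]
      calc M P * S (q P) Q = M P * (S (q P) Q - 1 + 1) := by rw [hadd (hS1 _ _)]
        _ = M P + M P * (S (q P) Q - 1) := by ring
        _ = (M P - 1 + 1) + M P * (S (q P) Q - 1) := by rw [hadd (hM1 P)]
        _ = _ := by ring)
    (fun Q => by rw [hSself, tsub_self])
    (fun P P' s t hst => by
      obtain ⟨R, hR⟩ := FinitePrior.exists_mix P P' hst
      refine ⟨R, fun Q => ENNReal.sub_eq_of_eq_add ENNReal.one_ne_top ?_⟩
      rw [hR]
      nth_rewrite 1 [← hadd (hsum1 P Q)]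
      nth_rewrite 1 [← hadd (hsum1 P' Q)]
      rw [mul_add, mul_add, mul_one, mul_one, add_add_add_comm, hst])
    one_ne_zero ENNReal.one_ne_top hM1 (by rw [hsup]; exact ENNReal.sub_ne_top (hEt c))
    (fun η hη => by
      obtain ⟨δ, hδ, hP⟩ := exists_tvDist_le_of_renyiDiv_le (Ω := Ω) h0 hη
      have hlt : 1 < E δ := by
        rw [hE, ← ENNReal.ofReal_one]
        exact (ENNReal.ofReal_lt_ofReal_iff (Real.exp_pos _)).2
          (Real.one_lt_exp_iff.2 (mul_pos (by linarith) hδ))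
      refine ⟨E δ - 1, tsub_pos_of_lt hlt, fun P Q hPQ => hP α le_rfl h1.ne' ht P Q ?_⟩
      rw [renyiDiv_le_iff_of_one_lt h1 ht]
      have h3 := tsub_le_iff_right.1 hPQ
      rwa [hadd hlt.le] at h3)
  rw [hsup] at hKlim hle
  refine ⟨q₀, hC, fun W hW => ?_, fun Q c' hc' => ?_⟩
  · have h3 := hle (FinitePrior.pure hW) (fun u t x t₀ hu htlim hb => by
      simp only [FinitePrior.pure, PMF.tsum_pure_mul] at hb ⊢
      rw [tsub_le_iff_right]
      exact powerAffinity_le_of_tendsto_of_one_lt ha1 (P := fun _ => W) (P₀ := W) (Q := u)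
        (Q₀ := x) (tendsto_tvDist_self W) (tendsto_iff_dist_tendsto_zero.1 hu)
        (htlim.add_const 1) (fun n => tsub_le_iff_right.1 (hb n)))
    simp only [FinitePrior.pure, PMF.tsum_pure_mul] at h3
    rw [renyiDiv_le_iff_of_one_lt h1 ht]
    have h4 := tsub_le_iff_right.1 h3
    rwa [hadd hEc1] at h4
  · rw [renyiDiv_le_iff_of_one_lt h1 ht]
    have hMlim : Tendsto (fun n => M (p n)) atTop (𝓝 (E c)) := by
      have := hKlim.add_const 1
      rw [hadd hEc1] at this
      exact this.congr fun n => hadd (hM1 _)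
    have hM0 n : M (p n) ≠ 0 := (zero_lt_one.trans_le (hM1 _)).ne'
    have hlim := ENNReal.Tendsto.div (tendsto_const_nhds (x := E c')) (Or.inl (hE0 c')) hMlim
      (Or.inr (hEt c'))
    rw [ENNReal.ofReal_exp_div, ← mul_sub] at hlim
    refine powerAffinity_le_of_tendsto_of_one_lt ha1 (tendsto_iff_dist_tendsto_zero.1 hqlim)
      (tendsto_tvDist_self Q) hlim fun n => ?_
    rw [ENNReal.le_div_iff_mul_le (Or.inl (hM0 n)) (Or.inl (hMt _)), mul_comm]
    refine (hq (p n) Q).symm.le.trans ?_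
    exact PMF.tsum_mul_le _ fun W hW =>
      (renyiDiv_le_iff_of_one_lt h1 ht _ _ _).1 (hc' W ((p n).2.2 hW))

theorem exists_isStrongCenter_of_ne {α : ℝ≥0∞} (h0 : 0 < α) (h1 : α ≠ 1) (ht : α ≠ ∞)
    {𝒲 : Set (ProbabilityMeasure Ω)} (hne : 𝒲.Nonempty) {c : ℝ} (hC : renyiCapacity α 𝒲 = c) :
    ∃ q, IsStrongCenter α 𝒲 q c := by
  rcases lt_or_gt_of_ne h1 with h1 | h1
  · exact exists_isStrongCenter_of_lt_one h0 h1 hne hC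
  · exact exists_isStrongCenter_of_one_lt h1 ht hne hC

/-! ### Monotonicity of the capacity and consequences of strong centers. -/

theorem nonneg_of_renyiCapacity_le_of_ne {α : ℝ≥0∞} (h0 : 0 < α) (h1 : α ≠ 1) (ht : α ≠ ∞)
    {𝒲 : Set (ProbabilityMeasure Ω)} (hne : 𝒲.Nonempty) {c : ℝ} (h : renyiCapacity α 𝒲 ≤ c) :
    0 ≤ c := by
  obtain ⟨W, hW⟩ := hne
  set P := FinitePrior.pure hW
  have hP := renyiCapacity_le_iff.1 h P.1 P.2.1 P.2.2
  obtain ⟨q, hq⟩ := exists_sum_powerAffinity_eq P.2.1 h0.ne' ht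
  -- Sibson's identity for a point mass, evaluated at its own center, expresses the mass as an
  -- affinity of probability measures, whose position relative to one is known.
  have hq' := hq q
  simp only [P, FinitePrior.pure, PMF.tsum_pure_mul] at hq'
  rw [powerAffinity_self _ ENNReal.toReal_nonneg, measure_univ (μ := (q : Measure Ω)), mul_one] at hq'
  rcases lt_or_gt_of_ne h1 with h1 | h1
  · obtain ⟨ha0, ha1⟩ := toReal_mem_of_lt_one h0 h1
    rw [renyiInformation_le_iff_of_lt_one h0 h1] at hP
    have := hP.trans (hq'.symm.le.trans (powerAffinity_le_one W q ha0 ha1))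
    rw [ENNReal.ofReal_le_one, Real.exp_le_one_iff] at this
    exact nonneg_of_mul_nonpos_right this (by linarith)
  · have ha1 := one_lt_toReal h1 ht
    rw [renyiInformation_le_iff_of_one_lt h1 ht] at hP
    have := (one_le_powerAffinity W q ha1).trans (hq'.le.trans hP)
    rw [ENNReal.one_le_ofReal, Real.one_le_exp_iff] at this
    exact nonneg_of_mul_nonneg_right this (by linarith)

theorem EReal.exists_eq_coe_of_le {x : EReal} {c : ℝ} (h : x ≤ c) (h' : ∀ c : ℝ, x ≤ c → 0 ≤ c) :
    ∃ r : ℝ, x = r := by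
  induction x with
  | bot => exact absurd (h' (-1) bot_le) (by norm_num)
  | top => exact absurd h (by simp)
  | coe r => exact ⟨r, rfl⟩

/-- The center of order β has β-radius equal to the capacity; its α-radius is no larger and bounds
the capacity of order α. -/
theorem renyiCapacity_le_of_le_of_ne {α β : ℝ≥0∞} (h0 : 0 < α) (hαβ : α ≤ β) (hβ1 : β ≠ 1)
    (hβt : β ≠ ∞) {𝒲 : Set (ProbabilityMeasure Ω)} (hne : 𝒲.Nonempty) {c : ℝ}
    (h : renyiCapacity β 𝒲 ≤ c) : renyiCapacity α 𝒲 ≤ c := by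
  have hβ0 := h0.trans_le hαβ
  obtain ⟨r, hr⟩ := EReal.exists_eq_coe_of_le h fun _ =>
    nonneg_of_renyiCapacity_le_of_ne hβ0 hβ1 hβt hne
  obtain ⟨q, hq⟩ := exists_isStrongCenter_of_ne hβ0 hβ1 hβt hne hr
  exact (renyiCapacity_le_of_forall h0 fun W hW =>
    renyiDiv_le_of_le_of_le h0 hαβ (hq.div_le W hW)).trans (hr ▸ h)

/-- The Rényi capacity is nondecreasing in the order. -/
theorem renyiCapacity_le_of_le {α β : ℝ≥0∞} (h0 : 0 < α) (hαβ : α ≤ β)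
    {𝒲 : Set (ProbabilityMeasure Ω)} (hne : 𝒲.Nonempty) {c : ℝ} (h : renyiCapacity β 𝒲 ≤ c) :
    renyiCapacity α 𝒲 ≤ c := by
  rcases eq_or_lt_of_le hαβ with rfl | hlt
  · exact h
  rcases eq_or_ne β ∞ with rfl | hβt
  -- Centers of orders one and infinity are not available at this point, so those orders are
  -- compared prior by prior: infinity with some finite `β' > 1`, and one directly with α.
  · obtain ⟨β', hβ', hβt⟩ := exists_between (max_lt hlt ENNReal.one_lt_top)
    have h1 := (le_max_right _ _).trans_lt hβ'
    exact renyiCapacity_le_of_le_of_ne h0 ((le_max_left _ _).trans_lt hβ').le h1.ne' hβt.ne hne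
      (renyiCapacity_le_iff.2 fun P hP hP' => renyiInformation_le_of_renyiInformation_top_le hP h1
        hβt.ne (renyiCapacity_le_iff.1 h P hP hP'))
  rcases eq_or_ne β 1 with rfl | hβ1
  · exact renyiCapacity_le_iff.2 fun P hP hP' =>
      renyiInformation_le_of_renyiInformation_one_le hP h0 hlt (renyiCapacity_le_iff.1 h P hP hP')
  · exact renyiCapacity_le_of_le_of_ne h0 hαβ hβ1 hβt hne h

theorem nonneg_of_renyiCapacity_le {α : ℝ≥0∞} (h0 : 0 < α) {𝒲 : Set (ProbabilityMeasure Ω)}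
    (hne : 𝒲.Nonempty) {c : ℝ} (h : renyiCapacity α 𝒲 ≤ c) : 0 ≤ c := by
  obtain ⟨β, hβ0, hβ⟩ := exists_between (lt_min h0 zero_lt_one)
  have hβ1 := hβ.trans_le (min_le_right _ _)
  exact nonneg_of_renyiCapacity_le_of_ne hβ0 hβ1.ne (hβ1.trans ENNReal.one_lt_top).ne hne
    (renyiCapacity_le_of_le hβ0 (hβ.trans_le (min_le_left _ _)).le hne h)

theorem exists_renyiCapacity_eq_coe {α β : ℝ≥0∞} (h0 : 0 < α) (hαβ : α ≤ β)
    {𝒲 : Set (ProbabilityMeasure Ω)} (hne : 𝒲.Nonempty) {c : ℝ} (h : renyiCapacity β 𝒲 ≤ c) :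
    ∃ r : ℝ, renyiCapacity α 𝒲 = r :=
  EReal.exists_eq_coe_of_le (renyiCapacity_le_of_le h0 hαβ hne h) fun _ =>
    nonneg_of_renyiCapacity_le h0 hne

/-- A uniform Pinsker inequality for the orders bounded away from zero. -/
theorem exists_tvDist_le_of_renyiDiv_le_of_le {α₀ : ℝ≥0∞} (h0 : 0 < α₀) {η : ℝ} (hη : 0 < η) :
    ∃ δ : ℝ, 0 < δ ∧ ∀ α, α₀ ≤ α → ∀ P Q : ProbabilityMeasure Ω, renyiDiv α P Q ≤ δ →
      tvDist P Q ≤ η := by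
  obtain ⟨β, hβ0, hβ⟩ := exists_between (lt_min h0 zero_lt_one)
  have hβ1 := hβ.trans_le (min_le_right _ _)
  obtain ⟨δ, hδ, h⟩ := exists_tvDist_le_of_renyiDiv_le (Ω := Ω) hβ0 hη
  exact ⟨δ, hδ, fun α hα P Q hPQ => h β le_rfl hβ1.ne (hβ1.trans ENNReal.one_lt_top).ne P Q
    (renyiDiv_le_of_le_of_le hβ0 ((hβ.trans_le (min_le_left _ _)).le.trans hα) hPQ)⟩

theorem IsStrongCenter.le_of_le {α β : ℝ≥0∞} (h0 : 0 < α) (hαβ : α ≤ β)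
    {𝒲 : Set (ProbabilityMeasure Ω)} (hne : 𝒲.Nonempty) {q q' : ProbabilityMeasure Ω} {c c' : ℝ}
    (hq : IsStrongCenter α 𝒲 q c) (hq' : IsStrongCenter β 𝒲 q' c') : c ≤ c' := by
  have := renyiCapacity_le_of_le h0 hαβ hne hq'.capacity_eq.le
  rwa [hq.capacity_eq, EReal.coe_le_coe_iff] at this

/-- The center of order β is used as the competitor `Q`; its α-radius is at most its β-radius. -/
theorem IsStrongCenter.renyiDiv_le {α β : ℝ≥0∞} (h0 : 0 < α) (hαβ : α ≤ β)
    {𝒲 : Set (ProbabilityMeasure Ω)} {q q' : ProbabilityMeasure Ω} {c c' : ℝ}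
    (hq : IsStrongCenter α 𝒲 q c) (hq' : IsStrongCenter β 𝒲 q' c') :
    renyiDiv α q q' ≤ ((c' - c : ℝ) : EReal) :=
  hq.div_center_le q' c' fun W hW => renyiDiv_le_of_le_of_le h0 hαβ (hq'.div_le W hW)

/-- A measure with radius equal to the capacity is a competitor with `c' = c`, so its divergence
from the strong center is at most zero. -/
theorem IsStrongCenter.isRenyiCenter_iff {α : ℝ≥0∞} (h0 : 0 < α) {𝒲 : Set (ProbabilityMeasure Ω)}
    {q : ProbabilityMeasure Ω} {c : ℝ} (hq : IsStrongCenter α 𝒲 q c) (q' : ProbabilityMeasure Ω) :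
    IsRenyiCenter α 𝒲 q' ↔ q' = q := by
  refine ⟨fun h => ?_, ?_⟩
  · have := hq.div_center_le q' c fun W hW => by
      rw [← hq.capacity_eq, h]
      exact le_iSup₂ (f := fun W _ => renyiDiv α W q') W hW
    rw [sub_self] at this
    exact (eq_of_renyiDiv_le_zero h0 this).symm
  · rintro rfl
    rw [IsRenyiCenter]
    refine le_antisymm (EReal.le_of_forall_lt_iff_le.1 fun z hz => ?_) ?_
    · exact renyiCapacity_le_of_forall h0 fun W hW =>
        (le_iSup₂ (f := fun W _ => renyiDiv α W q') W hW).trans hz.le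
    · rw [hq.capacity_eq]
      exact iSup₂_le hq.div_le

theorem IsStrongCenter.unique {α : ℝ≥0∞} (h0 : 0 < α) {𝒲 : Set (ProbabilityMeasure Ω)}
    {q q' : ProbabilityMeasure Ω} {c c' : ℝ} (hq : IsStrongCenter α 𝒲 q c)
    (hq' : IsStrongCenter α 𝒲 q' c') : q = q' :=
  (hq'.isRenyiCenter_iff h0 q).1 ((hq.isRenyiCenter_iff h0 q).2 rfl)

/-! ### Limits of centers from below; orders one and infinity. -/

/-- The strong centers converge as the order increases to `γ`, and the limit is a strong center of
order `γ`. -/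
theorem exists_isStrongCenter_tendsto {γ : ℝ≥0∞} (h0 : 0 < γ) {𝒲 : Set (ProbabilityMeasure Ω)}
    (hne : 𝒲.Nonempty) {q : ℝ≥0∞ → ProbabilityMeasure Ω} {c : ℝ≥0∞ → ℝ}
    (hq : ∀ α, 0 < α → α < γ → IsStrongCenter α 𝒲 (q α) (c α)) {K : ℝ}
    (hK : renyiCapacity γ 𝒲 ≤ K) : ∃ c₀ q₀, IsStrongCenter γ 𝒲 q₀ c₀ ∧
      Tendsto (fun α => tvDist (q α) q₀) (𝓝[<] γ) (𝓝 0) := by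
  have hcle {α β : ℝ≥0∞} (hα : 0 < α) (hαβ : α ≤ β) (hβ : β < γ) : c α ≤ c β :=
    (hq α hα (hαβ.trans_lt hβ)).le_of_le hα hαβ hne (hq β (hα.trans_le hαβ) hβ)
  obtain ⟨r, hr⟩ := exists_renyiCapacity_eq_coe h0 le_rfl hne hK
  have hcr {α : ℝ≥0∞} (hα : 0 < α) (hαγ : α < γ) : c α ≤ r := by
    have := renyiCapacity_le_of_le hα hαγ.le hne hr.le
    rwa [(hq α hα hαγ).capacity_eq, EReal.coe_le_coe_iff] at this
  set c₀ := sSup (c '' Set.Ioo 0 γ) with hc₀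
  have hIoo : (Set.Ioo 0 γ).Nonempty := Set.nonempty_Ioo.2 h0
  have hbdd : BddAbove (c '' Set.Ioo 0 γ) := ⟨r, by rintro _ ⟨α, hα, rfl⟩; exact hcr hα.1 hα.2⟩
  have hcc₀ {α : ℝ≥0∞} (hα : 0 < α) (hαγ : α < γ) : c α ≤ c₀ :=
    le_csSup hbdd (Set.mem_image_of_mem c ⟨hα, hαγ⟩)
  have hapx {δ : ℝ} (hδ : 0 < δ) : ∃ x, 0 < x ∧ x < γ ∧ c₀ - δ < c x := by
    obtain ⟨_, ⟨x, hx, rfl⟩, hxc⟩ := exists_lt_of_lt_csSup (hIoo.image c) (sub_lt_self c₀ hδ)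
    exact ⟨x, hx.1, hx.2, hxc⟩
  let _ := tvMetricSpace Ω
  have := tvMetricSpace_completeSpace (Ω := Ω)
  have : (𝓝[<] γ).NeBot := nhdsLT_neBot_of_exists_lt ⟨0, h0⟩
  -- Past `x` the capacities vary by less than δ, hence so does D_α(q_α‖q_β); the Pinsker bound is
  -- uniform over orders at least `α₀`.
  have hcauchy : Cauchy (map q (𝓝[<] γ)) := by
    refine Metric.cauchy_iff.2 ⟨inferInstance, fun η hη => ?_⟩
    obtain ⟨α₀, hα₀, hα₀γ⟩ := exists_between h0
    obtain ⟨δ, hδ, h⟩ := exists_tvDist_le_of_renyiDiv_le_of_le (Ω := Ω) hα₀ (half_pos hη)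
    obtain ⟨x, hx0, hxγ, hxc⟩ := hapx hδ
    have hdist {α β : ℝ≥0∞} (hα : max α₀ x < α) (hαβ : α ≤ β) (hβ : β < γ) :
        dist (q α) (q β) < η := by
      have hα0 := hα₀.trans ((le_max_left _ _).trans_lt hα)
      have hβ0 := hα0.trans_le hαβ
      refine (h α ((le_max_left _ _).trans_lt hα).le _ _ (((hq α hα0 (hαβ.trans_lt hβ)).renyiDiv_le
        hα0 hαβ (hq β hβ0 hβ)).trans (EReal.coe_le_coe_iff.2 ?_))).trans_lt (half_lt_self hη)
      have := hcc₀ hβ0 hβ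
      have := hcle hx0 ((le_max_right _ _).trans_lt hα).le (hαβ.trans_lt hβ)
      linarith
    refine ⟨q '' Set.Ioo (max α₀ x) γ, image_mem_map (Ioo_mem_nhdsLT (max_lt hα₀γ hxγ)), ?_⟩
    rintro _ ⟨α, hα, rfl⟩ _ ⟨β, hβ, rfl⟩
    rcases le_total α β with hαβ | hαβ
    · exact hdist hα.1 hαβ hβ.2
    · rw [dist_comm]; exact hdist hβ.1 hαβ hα.2
  obtain ⟨q₀, hq₀⟩ := CompleteSpace.complete hcauchy
  have hlim : Tendsto (fun α => tvDist (q α) q₀) (𝓝[<] γ) (𝓝 0) :=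
    tendsto_iff_dist_tendsto_zero.1 (show Tendsto q (𝓝[<] γ) (𝓝 q₀) from hq₀)
  have hseq {x : ℝ≥0∞} (hx : x < γ) : ∃ α : ℕ → ℝ≥0∞, (∀ n, x < α n ∧ α n < γ) ∧
      Tendsto (fun n => tvDist (q (α n)) q₀) atTop (𝓝 0) := by
    obtain ⟨α, hα, hαγ⟩ := exists_seq_tendsto_of_lt hx
    exact ⟨α, hα, hlim.comp (tendsto_nhdsWithin_iff.2 ⟨hαγ, .of_forall fun n => (hα n).2⟩)⟩
  -- At fixed α < γ, the bound D_α(W‖q_β) ≤ c_β ≤ c₀ survives β ↑ γ by lower semicontinuity; left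
  -- continuity in the order then raises α to γ.
  have hdiv (W) (hW : W ∈ 𝒲) : renyiDiv γ W q₀ ≤ c₀ := by
    refine renyiDiv_le_of_forall_lt h0 fun α hα hαγ hα1 => ?_
    obtain ⟨β, hβ, hβlim⟩ := hseq hαγ
    exact renyiDiv_le_of_tendsto hα hα1 (hαγ.trans_le le_top).ne (tendsto_tvDist_self W) hβlim
      (tendsto_const_nhds (x := c₀)) fun n => (renyiDiv_le_of_le_of_le hα (hβ n).1.le
        ((hq (β n) (hα.trans (hβ n).1) (hβ n).2).div_le W hW)).trans
        (EReal.coe_le_coe_iff.2 (hcc₀ (hα.trans (hβ n).1) (hβ n).2))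
  refine ⟨c₀, q₀, ⟨le_antisymm (renyiCapacity_le_of_forall h0 hdiv) ?_, hdiv, fun Q c' hc' => ?_⟩,
    hlim⟩
  · rw [hr, EReal.coe_le_coe_iff]
    exact csSup_le (hIoo.image c) (by rintro _ ⟨α, hα, rfl⟩; exact hcr hα.1 hα.2)
  -- For z > c' - c₀ the order `x` is chosen with c_x > c' - z, so D_β(q_β‖Q) ≤ c' - c_β ≤ z for β
  -- beyond `x`. The limit is taken as for `hdiv`, now in the first argument.
  · refine EReal.le_of_forall_lt_iff_le.1 fun z hz => ?_
    rw [EReal.coe_lt_coe_iff] at hz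
    obtain ⟨x, hx0, hxγ, hxc⟩ := hapx (sub_pos.2 hz)
    refine renyiDiv_le_of_forall_lt h0 fun α hα hαγ hα1 => ?_
    obtain ⟨β, hβ, hβlim⟩ := hseq (max_lt hαγ hxγ)
    refine renyiDiv_le_of_tendsto hα hα1 (hαγ.trans_le le_top).ne hβlim (tendsto_tvDist_self Q)
      (tendsto_const_nhds (x := z)) fun n => ?_
    have hαβ := (le_max_left _ _).trans_lt (hβ n).1
    have hxβ := (le_max_right _ _).trans_lt (hβ n).1
    refine (renyiDiv_le_of_le_of_le hα hαβ.le ((hq _ (hα.trans hαβ) (hβ n).2).div_center_le Q c'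
      fun W hW => renyiDiv_le_of_le_of_le (hα.trans hαβ) (hβ n).2.le (hc' W hW))).trans
      (EReal.coe_le_coe_iff.2 ?_)
    have := hcle hx0 hxβ.le (hβ n).2
    linarith

/-- Order one is obtained from the orders below it; this completes all finite orders, and infinity
is then also a limit from below. -/
theorem exists_isStrongCenter {γ : ℝ≥0∞} (h0 : 0 < γ) {𝒲 : Set (ProbabilityMeasure Ω)}
    (hne : 𝒲.Nonempty) {K : ℝ} (hK : renyiCapacity γ 𝒲 ≤ K) : ∃ c q, IsStrongCenter γ 𝒲 q c := by
  have hex {α : ℝ≥0∞} (hα : 0 < α) (hαγ : α ≤ γ) (h1 : α ≠ 1) (ht : α ≠ ∞) :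
      ∃ c q, IsStrongCenter α 𝒲 q c := by
    obtain ⟨c, hc⟩ := exists_renyiCapacity_eq_coe hα hαγ hne hK
    exact ⟨c, exists_isStrongCenter_of_ne hα h1 ht hne hc⟩
  have hlimit {β : ℝ≥0∞} (hβ : 0 < β) (hβγ : β ≤ γ)
      (h : ∀ α, 0 < α → α < β → ∃ c q, IsStrongCenter α 𝒲 q c) :
      ∃ c q, IsStrongCenter β 𝒲 q c := by
    have : Nonempty (ProbabilityMeasure Ω) := ⟨hne.some⟩
    choose! c q hq using h
    obtain ⟨c₀, q₀, hq₀, -⟩ := exists_isStrongCenter_tendsto hβ hne hq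
      (renyiCapacity_le_of_le hβ hβγ hne hK)
    exact ⟨c₀, q₀, hq₀⟩
  have hfin {α : ℝ≥0∞} (hα : 0 < α) (hαγ : α ≤ γ) (ht : α ≠ ∞) :
      ∃ c q, IsStrongCenter α 𝒲 q c := by
    rcases eq_or_ne α 1 with rfl | h1
    · exact hlimit hα hαγ fun β hβ hβ1 =>
        hex hβ (hβ1.le.trans hαγ) hβ1.ne (hβ1.trans ENNReal.one_lt_top).ne
    · exact hex hα hαγ h1 ht
  exact hlimit h0 le_rfl fun α hα hαγ => hfin hα hαγ.le (hαγ.trans_le le_top).ne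

/-! ### Right continuity of the capacity. -/

theorem powerAffinity_smul_right {μ ρ : Measure Ω} [IsFiniteMeasure μ] [IsFiniteMeasure ρ]
    {c : ℝ≥0∞} (hc0 : c ≠ 0) (hc : c ≠ ∞) {a : ℝ} (ha : 0 ≤ a) :
    powerAffinity a μ (c • ρ) = c ^ (1 - a) * powerAffinity a μ ρ := by
  obtain ⟨ν, f, g, hν, hf, hg, hμ, hρ⟩ := exists_withDensity_eq μ ρ
  have : IsFiniteMeasure (c • ρ) := Measure.smul_finite ρ hc
  have hcρ : c • ρ = ν.withDensity (c • g) := by rw [withDensity_smul _ hg, hρ]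
  rw [powerAffinity_eq_lintegral hf (hg.const_smul c) hμ hcρ ha,
    powerAffinity_eq_lintegral hf hg hμ hρ ha, ← lintegral_const_mul _ (by fun_prop)]
  refine lintegral_congr fun y => ?_
  rw [Pi.smul_apply, smul_eq_mul, ENNReal.mul_rpow_of_ne_zero_of_ne_top hc0 hc, mul_left_comm]

theorem powerAffinity_add_right {μ ρ σ : Measure Ω} [IsFiniteMeasure μ] [IsFiniteMeasure ρ]
    [IsFiniteMeasure σ] {a : ℝ} (ha : 0 ≤ a) :
    (a ≤ 1 → powerAffinity a μ ρ ≤ powerAffinity a μ (ρ + σ)) ∧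
      (1 ≤ a → powerAffinity a μ (ρ + σ) ≤ powerAffinity a μ ρ) := by
  set ν := μ + ρ + σ
  have hμ : μ = ν.withDensity (μ.rnDeriv ν) := (Measure.withDensity_rnDeriv_eq _ _
    ((Measure.AbsolutelyContinuous.rfl.add_right ρ).add_right σ)).symm
  have hρ : ρ = ν.withDensity (ρ.rnDeriv ν) := (Measure.withDensity_rnDeriv_eq _ _ (by
    simp only [ν]; rw [add_comm μ]
    exact (Measure.AbsolutelyContinuous.rfl.add_right μ).add_right σ)).symm
  have hσ : σ = ν.withDensity (σ.rnDeriv ν) := (Measure.withDensity_rnDeriv_eq _ _ (by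
    simp only [ν]; rw [add_comm _ σ]
    exact Measure.AbsolutelyContinuous.rfl.add_right _)).symm
  have mμ := Measure.measurable_rnDeriv μ ν
  have mρ := Measure.measurable_rnDeriv ρ ν
  have mσ := Measure.measurable_rnDeriv σ ν
  have hsum : ρ + σ = ν.withDensity (ρ.rnDeriv ν + σ.rnDeriv ν) := by
    rw [withDensity_add_left mρ, ← hρ, ← hσ]
  rw [powerAffinity_eq_lintegral mμ mρ hμ hρ ha,
    powerAffinity_eq_lintegral mμ (mρ.add mσ) hμ hsum ha]
  refine ⟨fun h => lintegral_mono fun y => mul_le_mul_right ?_ _,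
    fun h => lintegral_mono fun y => mul_le_mul_right ?_ _⟩
  · exact ENNReal.rpow_le_rpow (by simp) (sub_nonneg.2 h)
  · exact ENNReal.rpow_le_rpow_of_nonpos_exponent (by simp) (sub_nonpos.2 h)

/-- A reference measure dominating s P costs at most -ln s: enlarging the second measure raises the
affinity below order one and lowers it above. -/
theorem renyiDiv_le_of_eq_smul_add {α : ℝ≥0∞} (h0 : 0 < α) (h1 : α ≠ 1) (ht : α ≠ ∞)
    {W P Q : ProbabilityMeasure Ω} {σ : Measure Ω} [IsFiniteMeasure σ] {s c : ℝ} (hs : 0 < s)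
    (hQ : (Q : Measure Ω) = ENNReal.ofReal s • (P : Measure Ω) + σ)
    (h : renyiDiv α W P ≤ c) : renyiDiv α W Q ≤ ((c - Real.log s : ℝ) : EReal) := by
  have hs0 : ENNReal.ofReal s ≠ 0 := (ENNReal.ofReal_pos.2 hs).ne'
  have hexp : ENNReal.ofReal s = ENNReal.ofReal (Real.exp (Real.log s)) := by rw [Real.exp_log hs]
  have : IsFiniteMeasure (ENNReal.ofReal s • (P : Measure Ω)) :=
    Measure.smul_finite _ ENNReal.ofReal_ne_top
  have hmono := powerAffinity_add_right (μ := (W : Measure Ω))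
    (ρ := ENNReal.ofReal s • (P : Measure Ω)) (σ := σ) (ENNReal.toReal_nonneg (a := α))
  rw [← hQ, powerAffinity_smul_right hs0 ENNReal.ofReal_ne_top ENNReal.toReal_nonneg] at hmono
  have hE : ENNReal.ofReal s ^ (1 - α.toReal) * ENNReal.ofReal (Real.exp ((α.toReal - 1) * c)) =
      ENNReal.ofReal (Real.exp ((α.toReal - 1) * (c - Real.log s))) := by
    rw [hexp, ENNReal.ofReal_exp_rpow, ← ENNReal.ofReal_mul (Real.exp_pos _).le, ← Real.exp_add]
    congr 2; ring
  rcases lt_or_gt_of_ne h1 with h1 | h1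
  · rw [renyiDiv_le_iff_of_lt_one h0 h1] at h ⊢
    rw [← hE]
    exact (mul_le_mul_right h _).trans (hmono.1 (toReal_mem_of_lt_one h0 h1).2.le)
  · rw [renyiDiv_le_iff_of_one_lt h1 ht] at h ⊢
    rw [← hE]
    exact (hmono.2 (one_lt_toReal h1 ht).le).trans (mul_le_mul_right h _)

theorem exists_probabilityMeasure_eq_add (P P' : ProbabilityMeasure Ω) {s : ℝ} (hs : 0 < s)
    (hs1 : s < 1) : ∃ Q : ProbabilityMeasure Ω, (Q : Measure Ω) =
      ENNReal.ofReal (1 - s) • (P : Measure Ω) + ENNReal.ofReal s • (P' : Measure Ω) := by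
  refine ⟨⟨_, ⟨?_⟩⟩, rfl⟩
  simp only [Measure.add_apply, Measure.smul_apply, measure_univ, smul_eq_mul, mul_one]
  rw [← ENNReal.ofReal_add (by linarith) hs.le, sub_add_cancel, ENNReal.ofReal_one]

/-- With x = (w/q)^(t/2) and y = 1/x this is w (x + y - 2)² ≥ 0. The degenerate values are those
where w/q has no finite positive meaning. -/
theorem ENNReal.four_mul_rpow_add_rpow_le (w q : ℝ≥0∞) {t : ℝ} (ht : 0 < t) (ht1 : t < 1) :
    4 * (w ^ (1 + t / 2) * q ^ (1 - (1 + t / 2)) + w ^ (1 - t / 2) * q ^ (1 - (1 - t / 2))) ≤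
      w ^ (1 + t) * q ^ (1 - (1 + t)) + w ^ (1 - t) * q ^ (1 - (1 - t)) + 6 * w := by
  have e1 : 1 - (1 + t) = -t := by ring
  have e2 : 1 - (1 - t) = t := by ring
  rcases eq_or_ne w 0 with rfl | hw0
  · rw [ENNReal.zero_rpow_of_pos (by linarith), ENNReal.zero_rpow_of_pos (by linarith)]
    simp
  rcases eq_or_ne w ∞ with rfl | hwt
  · simp
  rcases eq_or_ne q 0 with rfl | hq0
  · rw [e1, ENNReal.zero_rpow_of_neg (y := -t) (by linarith), ENNReal.mul_top (by simp [hw0, hwt])]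
    simp
  rcases eq_or_ne q ∞ with rfl | hqt
  · rw [e2, ENNReal.top_rpow_of_pos (y := t) ht, ENNReal.mul_top (by simp [hw0, hwt])]
    simp
  obtain ⟨u, rfl⟩ := ENNReal.exists_eq_ofReal_exp hw0 hwt one_ne_zero
  obtain ⟨v, rfl⟩ := ENNReal.exists_eq_ofReal_exp hq0 hqt one_ne_zero
  simp only [ENNReal.ofReal_exp_rpow, one_mul]
  have h4 : (4 : ℝ≥0∞) = ENNReal.ofReal 4 := by simp
  have h6 : (6 : ℝ≥0∞) = ENNReal.ofReal 6 := by simp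
  rw [h4, h6]
  simp only [← ENNReal.ofReal_mul (Real.exp_pos _).le,
    ← ENNReal.ofReal_mul (show (0 : ℝ) ≤ 6 by norm_num), ← Real.exp_add]
  rw [← ENNReal.ofReal_add (by positivity) (by positivity),
    ← ENNReal.ofReal_add (by positivity) (by positivity),
    ← ENNReal.ofReal_add (by positivity) (by positivity),
    ← ENNReal.ofReal_mul zero_le_four]
  refine ENNReal.ofReal_le_ofReal ?_
  set x := Real.exp (t / 2 * (u - v)) with hx
  have hx0 : 0 < x := Real.exp_pos _
  set y := Real.exp (-(t / 2 * (u - v))) with hy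
  have hxy : x * y = 1 := by rw [hx, hy, ← Real.exp_add]; simp
  have E1 : Real.exp (u * (1 + t / 2) + v * (1 - (1 + t / 2))) = Real.exp u * x := by
    rw [hx, ← Real.exp_add]; congr 1; ring
  have E2 : Real.exp (u * (1 - t / 2) + v * (1 - (1 - t / 2))) = Real.exp u * y := by
    rw [hy, ← Real.exp_add]; congr 1; ring
  have E3 : Real.exp (u * (1 + t) + v * (1 - (1 + t))) = Real.exp u * (x * x) := by
    rw [hx, ← Real.exp_add, ← Real.exp_add]; congr 1; ring
  have E4 : Real.exp (u * (1 - t) + v * (1 - (1 - t))) = Real.exp u * (y * y) := by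
    rw [hy, ← Real.exp_add, ← Real.exp_add]; congr 1; ring
  have hu := Real.exp_pos u
  have key : 0 ≤ Real.exp u * (x + y - 2) ^ 2 := by positivity
  have : Real.exp u * (x + y - 2) ^ 2 = Real.exp u * (x * x) + Real.exp u * (y * y) +
      6 * Real.exp u - 4 * (Real.exp u * x + Real.exp u * y) + 2 * Real.exp u * (x * y - 1) := by
    ring
  simp only [E1, E2, E3, E4]
  rw [this, hxy] at key
  linarith

theorem four_mul_powerAffinity_add_le (W Q : ProbabilityMeasure Ω) {t : ℝ} (ht : 0 < t)
    (ht1 : t < 1) :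
    4 * (powerAffinity (1 + t / 2) (W : Measure Ω) Q + powerAffinity (1 - t / 2) (W : Measure Ω) Q)
      ≤ powerAffinity (1 + t) (W : Measure Ω) Q + powerAffinity (1 - t) (W : Measure Ω) Q + 6 := by
  obtain ⟨ν, f, g, hν, hf, hg, hμ, hρ⟩ := exists_withDensity_eq (W : Measure Ω) Q
  have hW : ∫⁻ y, f y ∂ν = 1 := by
    rw [lintegral_eq_of_eq_withDensity hμ, measure_univ]
  have h6 : (6 : ℝ≥0∞) = 6 * ∫⁻ y, f y ∂ν := by rw [hW, mul_one]
  rw [h6]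
  rw [powerAffinity_eq_lintegral hf hg hμ hρ (by linarith),
    powerAffinity_eq_lintegral hf hg hμ hρ (by linarith),
    powerAffinity_eq_lintegral hf hg hμ hρ (by linarith),
    powerAffinity_eq_lintegral hf hg hμ hρ (by linarith),
    ← lintegral_add_left (by fun_prop), ← lintegral_add_left (by fun_prop),
    ← lintegral_const_mul _ (by fun_prop), ← lintegral_const_mul _ (by fun_prop),
    ← lintegral_add_left (by fun_prop)]
  exact lintegral_mono fun y => ENNReal.four_mul_rpow_add_rpow_le _ _ ht ht1

/-- The excess G(t) = S_(1+t) + S_(1-t) - 2 satisfies 4 G(t/2) ≤ G(t), so repeated halving makes it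
decay quadratically in t, uniformly in the pair of measures. -/
theorem powerAffinity_add_le_two_add {W Q : ProbabilityMeasure Ω} {T L : ℝ} (hT : 0 < T)
    (hT1 : T < 1) (hL : 0 ≤ L)
    (h : powerAffinity (1 + T) (W : Measure Ω) Q ≤ ENNReal.ofReal L) (n : ℕ) :
    powerAffinity (1 + T / 2 ^ n) (W : Measure Ω) Q +
      powerAffinity (1 - T / 2 ^ n) (W : Measure Ω) Q ≤ ENNReal.ofReal (2 + L / 4 ^ n) := by
  induction n with
  | zero =>
    simp only [pow_zero, div_one]
    have := powerAffinity_le_one W Q (a := 1 - T) (by linarith) (by linarith)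
    calc _ ≤ ENNReal.ofReal L + 1 := add_le_add h this
      _ = ENNReal.ofReal (L + 1) := by rw [ENNReal.ofReal_add hL zero_le_one, ENNReal.ofReal_one]
      _ ≤ _ := ENNReal.ofReal_le_ofReal (by linarith)
  | succ n ih =>
    have hT' : T / 2 ^ n < 1 :=
      (div_le_self hT.le (one_le_pow₀ one_le_two)).trans_lt hT1
    have := (four_mul_powerAffinity_add_le W Q (by positivity) hT').trans (add_le_add_left ih 6)
    rw [div_div, ← pow_succ] at this
    have h4 : ENNReal.ofReal (2 + L / 4 ^ n) + 6 = 4 * ENNReal.ofReal (2 + L / 4 ^ (n + 1)) := by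
      have e4 : (4 : ℝ≥0∞) = ENNReal.ofReal 4 := by simp
      have e6 : (6 : ℝ≥0∞) = ENNReal.ofReal 6 := by simp
      rw [e4, e6, ← ENNReal.ofReal_mul zero_le_four,
        ← ENNReal.ofReal_add (by positivity) (by norm_num)]
      congr 1; rw [pow_succ]; field_simp; ring
    rw [h4] at this
    exact (ENNReal.mul_le_mul_iff_right (by simp) (by simp)).1 this

/-- A uniform right continuity of the Rényi divergence at order one. -/
theorem exists_renyiDiv_one_add_le {T K c ε : ℝ} (hT : 0 < T) (hT1 : T < 1) (hε : 0 < ε) :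
    ∃ β : ℝ≥0∞, 1 < β ∧ ∀ W Q : ProbabilityMeasure Ω,
      renyiDiv (ENNReal.ofReal (1 + T)) W Q ≤ (K : EReal) →
      (∀ α : ℝ≥0∞, 0 < α → α < 1 → renyiDiv α W Q ≤ (c : EReal)) →
      renyiDiv β W Q ≤ ((c + ε : ℝ) : EReal) := by
  -- The excess is of size e^(TK)/4^n, whereas t = T/2^n is only of size 2^(-n); this `n` makes the
  -- excess at most tε. Then S_(1+t) ≤ 2 + tε - e^(-tc) ≤ 1 + t(c+ε) ≤ e^(t(c+ε)).
  obtain ⟨n, hn⟩ := pow_unbounded_of_one_lt (Real.exp (T * K) / (T * ε)) one_lt_two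
  set t := T / 2 ^ n with ht
  have ht0 : 0 < t := by positivity
  have ht1 : t < 1 := (div_le_self hT.le (one_le_pow₀ one_le_two)).trans_lt hT1
  have of_lt {x : ℝ} (hx : 0 < x) : 1 < ENNReal.ofReal (1 + x) := by
    rw [← ENNReal.ofReal_one]
    exact (ENNReal.ofReal_lt_ofReal_iff (by linarith)).2 (by linarith)
  refine ⟨ENNReal.ofReal (1 + t), of_lt ht0, fun W Q h h' => ?_⟩
  rw [renyiDiv_le_iff_of_one_lt (of_lt hT) ENNReal.ofReal_ne_top,
    ENNReal.toReal_ofReal (by linarith), add_sub_cancel_left] at h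
  rw [renyiDiv_le_iff_of_one_lt (of_lt ht0) ENNReal.ofReal_ne_top,
    ENNReal.toReal_ofReal (by linarith), add_sub_cancel_left]
  have h1 := powerAffinity_add_le_two_add hT hT1 (Real.exp_pos _).le h n
  have hα0 : 0 < ENNReal.ofReal (1 - t) := ENNReal.ofReal_pos.2 (by linarith)
  have hα1 : ENNReal.ofReal (1 - t) < 1 := by
    rw [← ENNReal.ofReal_one]
    exact (ENNReal.ofReal_lt_ofReal_iff one_pos).2 (by linarith)
  have h2 := (renyiDiv_le_iff_of_lt_one hα0 hα1 W Q c).1 (h' _ hα0 hα1)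
  rw [ENNReal.toReal_ofReal (by linarith)] at h2
  have h3 := (add_le_add_right h2 _).trans h1
  have h4 : powerAffinity (1 + t) (W : Measure Ω) Q ≤ ENNReal.ofReal (2 + Real.exp (T * K) / 4 ^ n -
      Real.exp ((1 - t - 1) * c)) := by
    rw [ENNReal.ofReal_sub _ (Real.exp_pos _).le]
    exact ENNReal.le_sub_of_add_le_right ENNReal.ofReal_ne_top h3
  refine h4.trans (ENNReal.ofReal_le_ofReal ?_)
  have e1 := Real.add_one_le_exp ((1 - t - 1) * c)
  have e2 := Real.add_one_le_exp (t * (c + ε))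
  have e3 : Real.exp (T * K) / 4 ^ n ≤ t * ε := by
    rw [div_lt_iff₀ (by positivity)] at hn
    have e4 : (4 : ℝ) ^ n = 2 ^ n * 2 ^ n := by rw [← mul_pow]; norm_num
    rw [ht, e4, div_le_iff₀ (by positivity)]
    have : T / 2 ^ n * ε * (2 ^ n * 2 ^ n) = 2 ^ n * (T * ε) := by field_simp
    linarith
  linarith

/-- Divergences from `q` may be infinite at larger orders. Mixing `q` with weight e^(-ε) and `q'`
with the remaining weight costs ε relative to `q` and a fixed constant relative to `q'`, giving
control at both orders. -/
theorem exists_mixture_renyiDiv_le (q q' : ProbabilityMeasure Ω) {ε : ℝ} (hε : 0 < ε) :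
    ∃ (Q : ProbabilityMeasure Ω) (k : ℝ), ∀ (W : ProbabilityMeasure Ω) (α : ℝ≥0∞) (c : ℝ), 0 < α →
      α ≠ 1 → α ≠ ∞ → (renyiDiv α W q ≤ c → renyiDiv α W Q ≤ ((c + ε : ℝ) : EReal)) ∧
        (renyiDiv α W q' ≤ c → renyiDiv α W Q ≤ ((c + k : ℝ) : EReal)) := by
  have h1 : Real.exp (-ε) < 1 := Real.exp_lt_one_iff.2 (neg_lt_zero.2 hε)
  have hs : 0 < 1 - Real.exp (-ε) := sub_pos.2 h1
  obtain ⟨Q, hQ⟩ := exists_probabilityMeasure_eq_add q q' hs (by linarith [Real.exp_pos (-ε)])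
  have (s : ℝ) (P : ProbabilityMeasure Ω) : IsFiniteMeasure (ENNReal.ofReal s • (P : Measure Ω)) :=
    Measure.smul_finite _ ENNReal.ofReal_ne_top
  rw [sub_sub_cancel] at hQ
  refine ⟨Q, -Real.log (1 - Real.exp (-ε)), fun W α c h0 h1 ht => ⟨fun h => ?_, fun h => ?_⟩⟩
  · have := renyiDiv_le_of_eq_smul_add h0 h1 ht (Real.exp_pos _) hQ h
    rwa [Real.log_exp, sub_neg_eq_add] at this
  · rw [add_comm] at hQ
    exact renyiDiv_le_of_eq_smul_add h0 h1 ht hs hQ h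

/-- The Rényi divergence, multiplied by the order minus one, is convex in the order. -/
theorem renyiDiv_le_of_between {γ β τ : ℝ≥0∞} (hγ : 1 < γ) (hγβ : γ < β) (hβτ : β < τ)
    (hτ : τ ≠ ∞) {W Q : ProbabilityMeasure Ω} {c k : ℝ} (h : renyiDiv γ W Q ≤ c)
    (h' : renyiDiv τ W Q ≤ k) :
    renyiDiv β W Q ≤ ((((τ.toReal - β.toReal) / (τ.toReal - γ.toReal) * ((γ.toReal - 1) * c) +
      (1 - (τ.toReal - β.toReal) / (τ.toReal - γ.toReal)) * ((τ.toReal - 1) * k)) /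
        (β.toReal - 1) : ℝ) : EReal) := by
  have hβt : β ≠ ∞ := (hβτ.trans_le le_top).ne
  have hγt : γ ≠ ∞ := (hγβ.trans_le le_top).ne
  have hg := one_lt_toReal hγ hγt
  have hgb : γ.toReal < β.toReal := (ENNReal.toReal_lt_toReal hγt hβt).2 hγβ
  have hbt : β.toReal < τ.toReal := (ENNReal.toReal_lt_toReal hβt hτ).2 hβτ
  rw [renyiDiv_le_iff_of_one_lt hγ hγt] at h
  rw [renyiDiv_le_iff_of_one_lt (hγ.trans (hγβ.trans hβτ)) hτ] at h'
  rw [renyiDiv_le_iff_of_one_lt (hγ.trans hγβ) hβt, mul_div_cancel₀ _ (by linarith)]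
  have hpos : 0 < τ.toReal - γ.toReal := by linarith
  set θ := (τ.toReal - β.toReal) / (τ.toReal - γ.toReal) with hθ
  have hθ0 : 0 < θ := div_pos (by linarith) hpos
  have hθ1 : θ < 1 := (div_lt_one hpos).2 (by linarith)
  have hb : β.toReal = θ * γ.toReal + (1 - θ) * τ.toReal := by
    have : θ * (τ.toReal - γ.toReal) = τ.toReal - β.toReal := div_mul_cancel₀ _ hpos.ne'
    linarith
  refine (powerAffinity_le_mul (by linarith) hgb hbt hθ0 hθ1 hb
    (h'.trans_lt ENNReal.ofReal_lt_top).ne).trans ?_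
  refine (mul_le_mul' (ENNReal.rpow_le_rpow h hθ0.le)
    (ENNReal.rpow_le_rpow h' (sub_pos.2 hθ1).le)).trans_eq ?_
  rw [ENNReal.ofReal_exp_rpow, ENNReal.ofReal_exp_rpow, ← ENNReal.ofReal_mul (Real.exp_pos _).le,
    ← Real.exp_add]
  congr 2; ring

theorem exists_lt_and_lt_of_continuousAt {γ τ : ℝ≥0∞} (hγτ : γ < τ) {f : ℝ → ℝ} {r : ℝ}
    (hf : ContinuousAt f γ.toReal) (hr : f γ.toReal < r) :
    ∃ β, γ < β ∧ β < τ ∧ f β.toReal < r := by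
  have hγ : γ ≠ ∞ := (hγτ.trans_le le_top).ne
  have h1 : ∀ᶠ β in 𝓝 γ, f β.toReal < r :=
    (hf.comp (ENNReal.continuousAt_toReal hγ)).eventually_lt_const hr
  have : (𝓝[>] γ).NeBot := nhdsGT_neBot_of_exists_gt ⟨τ, hγτ⟩
  obtain ⟨β, hβ, hβ'⟩ := ((h1.filter_mono nhdsWithin_le_nhds).and
    (Ioo_mem_nhdsGT hγτ)).exists
  exact ⟨β, hβ'.1, hβ'.2, hβ⟩

/-- The Rényi capacity is right-continuous in the order. -/
theorem exists_renyiCapacity_le_add {γ τ : ℝ≥0∞} (h0 : 0 < γ) (hγτ : γ < τ)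
    {𝒲 : Set (ProbabilityMeasure Ω)} {q q' : ProbabilityMeasure Ω} {c c' : ℝ}
    (hq : IsStrongCenter γ 𝒲 q c) (hq' : IsStrongCenter τ 𝒲 q' c') {ε : ℝ} (hε : 0 < ε) :
    ∃ β, γ < β ∧ renyiCapacity β 𝒲 ≤ ((c + ε : ℝ) : EReal) := by
  have hγ : γ ≠ ∞ := (hγτ.trans_le le_top).ne
  have hg : 0 < γ.toReal := ENNReal.toReal_pos h0.ne' hγ
  obtain ⟨Q, k, hQ⟩ := exists_mixture_renyiDiv_le q q' (half_pos hε)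
  rcases lt_trichotomy γ 1 with h1 | rfl | h1
  · have hg1 := (toReal_mem_of_lt_one h0 h1).2
    -- Below order one the ratio inequality bounds D_β(W‖q) by D_γ(W‖q) uniformly in `W`, so no
    -- mixing is needed.
    have hcont : ContinuousAt (fun b => b * (1 - γ.toReal) / (γ.toReal * (1 - b)) * c) γ.toReal :=
      ((continuousAt_id.mul continuousAt_const).div
        (continuousAt_const.mul (continuousAt_const.sub continuousAt_id))
        (mul_pos hg (sub_pos.2 hg1)).ne').mul continuousAt_const
    obtain ⟨β, hγβ, hβ1, hβ⟩ := exists_lt_and_lt_of_continuousAt h1 hcont (r := c + ε) (by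
      rw [div_self (mul_pos hg (sub_pos.2 hg1)).ne', one_mul]
      linarith)
    exact ⟨β, hγβ, renyiCapacity_le_of_forall (h0.trans hγβ) fun W hW =>
      (renyiDiv_le_ratio_mul h0 hγβ hβ1 (hq.div_le W hW)).trans (EReal.coe_le_coe_iff.2 hβ.le)⟩
  · obtain ⟨T, hT, hT1⟩ := ENNReal.lt_iff_exists_add_pos_lt.1 (lt_min hγτ ENNReal.one_lt_two)
    have hT' : (T : ℝ) < 1 := by
      have h2 := hT1.trans_le (min_le_right _ _)
      rw [← one_add_one_eq_two] at h2
      have h3 := (ENNReal.add_lt_add_iff_left ENNReal.one_ne_top).1 h2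
      exact_mod_cast h3
    have hT0 : 0 < (T : ℝ) := hT
    have hTe : ENNReal.ofReal (1 + T) = 1 + T := by
      rw [ENNReal.ofReal_add zero_le_one hT0.le, ENNReal.ofReal_one, ENNReal.ofReal_coe_nnreal]
    have hTt : 1 + (T : ℝ≥0∞) ≠ ∞ := ENNReal.add_ne_top.2 ⟨ENNReal.one_ne_top, ENNReal.coe_ne_top⟩
    have hT1' : 1 + (T : ℝ≥0∞) ≠ 1 :=
      (ENNReal.lt_add_right ENNReal.one_ne_top (ENNReal.coe_ne_zero.2 hT.ne')).ne'
    obtain ⟨β, hβ1, hβ⟩ := exists_renyiDiv_one_add_le (Ω := Ω) (K := c' + k) (c := c + ε / 2) hT0 hT'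
      (half_pos hε)
    refine ⟨β, hβ1, renyiCapacity_le_of_forall (Q := Q) (h0.trans hβ1) fun W hW => ?_⟩
    have h3 := hβ W Q (hTe ▸ (hQ W _ c' (by simp) hT1' hTt).2 (renyiDiv_le_of_le_of_le (by simp)
        (hT1.le.trans (min_le_left _ _)) (hq'.div_le W hW)))
      fun α hα hα1 => (hQ W α c hα hα1.ne (hα1.trans ENNReal.one_lt_top).ne).1
        (renyiDiv_le_of_le_of_le hα hα1.le (hq.div_le W hW))
    rwa [add_assoc, add_halves] at h3
  · obtain ⟨t, hγt, htτ⟩ := exists_between hγτ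
    have htt : t ≠ ∞ := (htτ.trans_le le_top).ne
    have hgt : γ.toReal < t.toReal := (ENNReal.toReal_lt_toReal hγ htt).2 hγt
    have hg1 := one_lt_toReal h1 hγ
    -- Convexity in the order between γ and `t` bounds D_β(W‖Q) by this function, independent of
    -- `W`; at γ it equals c + ε/2. An intermediate `t` is used since `τ` may be infinite.
    have hcont : ContinuousAt (fun b => ((t.toReal - b) / (t.toReal - γ.toReal) *
        ((γ.toReal - 1) * (c + ε / 2)) + (1 - (t.toReal - b) / (t.toReal - γ.toReal)) *
          ((t.toReal - 1) * (c' + k))) / (b - 1)) γ.toReal :=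
      ContinuousAt.div (by fun_prop) (by fun_prop) (sub_pos.2 hg1).ne'
    obtain ⟨β, hγβ, hβt, hβ⟩ := exists_lt_and_lt_of_continuousAt hγt hcont (r := c + ε) (by
      rw [div_self (sub_pos.2 hgt).ne', one_mul, sub_self, zero_mul, add_zero,
        mul_div_cancel_left₀ _ (sub_pos.2 hg1).ne']
      linarith)
    refine ⟨β, hγβ, renyiCapacity_le_of_forall (Q := Q) (h0.trans hγβ) fun W hW => ?_⟩
    have ht1 := h1.trans hγt
    exact (renyiDiv_le_of_between h1 hγβ hβt htt
      ((hQ W γ c h0 h1.ne' hγ).1 (hq.div_le W hW))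
      ((hQ W t c' (h0.trans hγt) ht1.ne' htt).2
        (renyiDiv_le_of_le_of_le (h0.trans hγt) htτ.le (hq'.div_le W hW)))).trans
      (EReal.coe_le_coe_iff.2 hβ.le)

/-! ### Continuity of the centers and conclusion. -/

theorem continuousOn_of_forall_isStrongCenter {ϑ : ℝ≥0∞} {𝒲 : Set (ProbabilityMeasure Ω)}
    (h𝒲 : 𝒲.Nonempty) {q : ℝ≥0∞ → ProbabilityMeasure Ω} {c : ℝ≥0∞ → ℝ}
    (hq : ∀ α, 0 < α → α ≤ ϑ → IsStrongCenter α 𝒲 (q α) (c α)) :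
    @ContinuousOn ℝ≥0∞ (ProbabilityMeasure Ω) ENNReal.instTopologicalSpace (tvTopology Ω) q
      (Set.Ioc 0 ϑ) := by
  let _ := tvMetricSpace Ω
  intro γ hγ
  refine Metric.tendsto_nhds.2 fun η hη => ?_
  have hγc := hq γ hγ.1 hγ.2
  have hleft : ∀ᶠ α in 𝓝[<] γ, dist (q α) (q γ) < η := by
    obtain ⟨c₀, q₀, hq₀, hlim⟩ := exists_isStrongCenter_tendsto hγ.1 h𝒲
      (fun α hα hαγ => hq α hα (hαγ.le.trans hγ.2)) hγc.capacity_eq.le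
    rw [hq₀.unique hγ.1 hγc] at hlim
    exact hlim.eventually_lt_const hη
  -- For β > γ the divergence D_γ(q_γ‖q_β) is at most the capacity difference, which right
  -- continuity makes small; Pinsker converts this to distance.
  have hright : ∀ᶠ β in 𝓝 γ, γ < β → β ≤ ϑ → dist (q β) (q γ) < η := by
    rcases eq_or_lt_of_le hγ.2 with rfl | hlt
    · exact .of_forall fun β h1 h2 => absurd h1 h2.not_gt
    obtain ⟨δ, hδ, h⟩ := exists_tvDist_le_of_renyiDiv_le_of_le (Ω := Ω) hγ.1 (half_pos hη)
    obtain ⟨β₀, hβ₀, hcap⟩ := exists_renyiCapacity_le_add hγ.1 hlt hγc (hq ϑ (hγ.1.trans_le hγ.2) le_rfl) hδ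
    filter_upwards [Iio_mem_nhds hβ₀] with β hβ hγβ hβϑ
    have hβ0 := hγ.1.trans hγβ
    have hle := renyiCapacity_le_of_le hβ0 (Set.mem_Iio.1 hβ).le h𝒲 hcap
    rw [(hq β hβ0 hβϑ).capacity_eq, EReal.coe_le_coe_iff] at hle
    rw [dist_comm]
    exact (h γ le_rfl _ _ ((hγc.renyiDiv_le hγ.1 hγβ.le (hq β hβ0 hβϑ)).trans
      (EReal.coe_le_coe_iff.2 (by linarith)))).trans_lt (half_lt_self hη)
  rw [eventually_nhdsWithin_iff] at hleft
  rw [eventually_nhdsWithin_iff]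
  filter_upwards [hleft, hright] with β h1 h2 hβ
  rcases lt_trichotomy β γ with h | rfl | h
  · exact h1 h
  · rwa [dist_self]
  · exact h2 h hβ.2

end

theorem mainTheorem5 {Ω : Type*} [MeasurableSpace Ω] (𝒲 : Set (ProbabilityMeasure Ω))
    (h𝒲 : 𝒲.Nonempty) (ϑ : ℝ≥0∞) (hϑ : 0 < ϑ) (hC : renyiCapacity ϑ 𝒲 < ⊤) :
    ∃ q : ℝ≥0∞ → ProbabilityMeasure Ω,
      (∀ α ∈ Set.Ioc 0 ϑ, ∀ q' : ProbabilityMeasure Ω, IsRenyiCenter α 𝒲 q' ↔ q' = q α) ∧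
      (∀ α β : ℝ≥0∞, 0 < α → α < β → β ≤ ϑ →
        renyiDiv α (q α) (q β) ≤ renyiCapacity β 𝒲 - renyiCapacity α 𝒲) ∧
      @ContinuousOn ℝ≥0∞ (ProbabilityMeasure Ω) ENNReal.instTopologicalSpace (tvTopology Ω) q
        (Set.Ioc 0 ϑ) := by
  obtain ⟨K, hK, -⟩ := EReal.lt_iff_exists_real_btwn.1 hC
  have hex (α : ℝ≥0∞) (hα : 0 < α) (hαϑ : α ≤ ϑ) : ∃ c q, IsStrongCenter α 𝒲 q c :=
    exists_isStrongCenter hα h𝒲 (renyiCapacity_le_of_le hα hαϑ h𝒲 hK.le)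
  have : Nonempty (ProbabilityMeasure Ω) := ⟨h𝒲.some⟩
  choose! c q hq using hex
  refine ⟨q, fun α hα => (hq α hα.1 hα.2).isRenyiCenter_iff hα.1, fun α β hα hαβ hβ => ?_, ?_⟩
  · rw [(hq α hα (hαβ.le.trans hβ)).capacity_eq, (hq β (hα.trans hαβ) hβ).capacity_eq,
      ← EReal.coe_sub]
    exact (hq α hα (hαβ.le.trans hβ)).renyiDiv_le hα hαβ.le (hq β (hα.trans hαβ) hβ)
  · exact continuousOn_of_forall_isStrongCenter h𝒲 hq
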